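/- **Setting.** Let $n\ge 1$. Qubits sit on the $n$ edges $(i,i+1)$ of the cycle with vertex set $\mathbb Z_n$. A (bit-flip) error is a set $E$ of edges; its syndrome $\partial E\subseteq\mathbb Z_n$ is the set of vertices exactly one of whose two incident edges (counted with multiplicity) lies in $E$. Each vertex carries binary registers $\mathrm{Def}$ (defect), $\mathrm{FwS}$ (forward-signal), $\mathrm{BwS}$ (backward-signal), $\mathrm{AnS}$ (anti-signal) and a stack $\mathrm{Sta}\in\mathbb N$. Initially $\mathrm{Def}$ is the indicator of $\partial E$ and all other registers are $0$. One time step of the *asymmetric signal-rule* (ASR), with signal speeds $k_a=k_b=3$, performs the following instructions one after the other, each in parallel on all sites $C$, where $L=C-1$ and $R=C+1$ (temporary bits $\mathrm{Tmp},\mathrm{Cor}$ start at $0$): 1. If $(\mathrm{Def}_L,\mathrm{Def}_C,\mathrm{Def}_R)=(0,1,1)$, set $\mathrm{Cor}_C=1$, $\mathrm{Def}_C=0$. Then, if $\mathrm{Cor}_L=1$, set $\mathrm{Def}_C=0$. 2. If $(\mathrm{Def}_C,\mathrm{Def}_R)=(1,0)$ and $\mathrm{FwS}_C=0$, set $\mathrm{FwS}_C=1$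 and increment $\mathrm{Sta}_C$. Then move all forward-signals one site to the right. 3. If $\mathrm{Def}_C=\mathrm{FwS}_C=1$, set $\mathrm{Tmp}_C=1$, $\mathrm{Def}_C=0$, and replace $(\mathrm{FwS}_C,\mathrm{BwS}_C)$ by $(0,1)$ if it equals $(1,0)$. Then, if $\mathrm{Tmp}_R=1$, set $\mathrm{Cor}_C=1$, $\mathrm{Def}_C=1$, and replace $(\mathrm{FwS}_C,\mathrm{BwS}_C)$ by $(0,1)$ if it equals $(1,0)$. 4. Repeat $k_b$ times: move all backward-signals one site to the left; if $\mathrm{BwS}_C=\mathrm{AnS}_C=1$ set both to $0$; if $\mathrm{BwS}_C=1$ and $\mathrm{Sta}_C>0$, set $\mathrm{BwS}_C=0$ and decrement $\mathrm{Sta}_C$. 5. If $\mathrm{Def}_C=\mathrm{AnS}_C=0$ and $\mathrm{Sta}_C>0$, set $\mathrm{AnS}_C=1$ and decrement $\mathrm{Sta}_C$. 6. Repeat $k_a-1$ times: move all anti-signals one site to the right; if $\mathrm{AnS}_C=\mathrm{FwS}_C=1$ set both to $0$; if $\mathrm{AnS}_C=\mathrm{BwS}_C=1$ set both to $0$. Finally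 move all anti-signals one more site to the right and, if $\mathrm{AnS}_C=\mathrm{BwS}_C=1$, set both to $0$. At the end of the step the edge $(C,C+1)$ is flipped for every $C$ with $\mathrm{Cor}_C=1$. Decoding *succeeds* after $\tau$ steps if no edge carries an error any more and all registers are $0$. For $E$ containing each edge independently with probability $\varepsilon$, let $\varepsilon_L(n,\tau,\varepsilon)$ be the probability that decoding does not succeed after $\tau$ steps. **Theorem 1 (ASR code-capacity threshold).** Let $\varepsilon_{th}=1/232$ and $\alpha_*=\log 2/\log 232$; then $\varepsilon_{th}>0.4\%$ and $\alpha_*>0.12$. There is $\tau:\mathbb N\to\mathbb N$ with $\tau(n)=O(n)$ such that: (i) there is a constant $K$ such that for all $n\ge1$ and all $0<\varepsilon<\varepsilon_{th}$, $$\varepsilon_L(n,\tau(n),\varepsilon)\le K\exp\!\Big[\tfrac12\,n^{\alpha_*}\log\frac{\varepsilon}{\varepsilon_{th}}\Big];$$ (ii) for every $0<\alpha<\alpha_*$ and every $0\le\varepsilon<\varepsilon_{th}$, one has $\varepsilon_L(n,\tau(n),\varepsilon)\le\exp(-n^{\alpha})$ for all sufficiently large $n$; (iii) there are $\varepsilon_0>0$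 and $\alpha>0$ such that $\varepsilon_L(n,\tau(n),\varepsilon)\le\exp(-n^{\alpha})$ for all $n\ge1$ and all $0\le\varepsilon<\varepsilon_0$. -/

import Mathlib

namespace SignalRule

/-- A configuration of the decoder on the sites `V` of a one-dimensional lattice (`i - 1` and
`i + 1` are the left and right neighbours of `i`): the four binary registers recording defects,
forward-signals, backward-signals and anti-signals, and the stack register. -/
@[ext]
structure Config (V : Type*) where
  defect : V → Bool
  fwd : V → Bool
  bwd : V → Bool
  anti : V → Bool
  stack : V → ℕ

/-- The registers during one iteration: a configuration together with the temporary variable used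
for information transfer between sites and the variable that saves the correction. -/
@[ext]
structure Work (V : Type*) extends Config V where
  tmp : V → Bool
  cor : V → Bool

/-- The configuration with all variables equal to zero. -/
def Config.zero (V : Type*) : Config V where
  defect := fun _ => false
  fwd := fun _ => false
  bwd := fun _ => false
  anti := fun _ => false
  stack := fun _ => 0

section Rule

variable {V : Type*} [AddGroupWithOne V]

/-! Each function below is one instruction of the update rule, applied in parallel on all sites:
every right-hand side reads the registers as they were before the instruction. -/

/-- Start of an iteration: the correction and the temporary variable are set to 0. -/
def start (u : Config V) : Work V :=
  { u with tmp := fun _ => false, cor := fun _ => false }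

/-- If `(Def.L, Def.C, Def.R) = (0, 1, 1)`, set `Cor.C` to 1 and `Def.C` to 0. -/
def matchLeft (w : Work V) : Work V :=
  let hit : V → Bool := fun i => !w.defect (i - 1) && w.defect i && w.defect (i + 1)
  { w with
    cor := fun i => if hit i then true else w.cor i
    defect := fun i => if hit i then false else w.defect i }

/-- If `Cor.L = 1`, set `Def.C` to 0. -/
def matchRight (w : Work V) : Work V :=
  { w with defect := fun i => if w.cor (i - 1) then false else w.defect i }

/-- If `(Def.C, Def.R) = (1, 0)` and `FwS.C = 0`, set `FwS.C` to 1 and increment `Sta.C`. -/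
def sendForward (w : Work V) : Work V :=
  let hit : V → Bool := fun i => w.defect i && !w.defect (i + 1) && !w.fwd i
  { w with
    fwd := fun i => if hit i then true else w.fwd i
    stack := fun i => if hit i then w.stack i + 1 else w.stack i }

/-- Propagate forward-signals by one site to the right; `Tmp` ends at 0. -/
def moveForward (w : Work V) : Work V :=
  { w with
    fwd := fun i => w.fwd (i - 1)
    tmp := fun _ => false }

/-- If `Def.C = FwS.C = 1`, set `Tmp.C` to 1 and `Def.C` to 0, and set `(FwS.C, BwS.C)` to `(0, 1)`
if it is `(1, 0)`. -/
def reflectHere (w : Work V) : Work V :=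
  let hit : V → Bool := fun i => w.defect i && w.fwd i
  let flip : V → Bool := fun i => hit i && w.fwd i && !w.bwd i
  { w with
    tmp := fun i => if hit i then true else w.tmp i
    defect := fun i => if hit i then false else w.defect i
    fwd := fun i => if flip i then false else w.fwd i
    bwd := fun i => if flip i then true else w.bwd i }

/-- If `Tmp.R = 1`, set `Cor.C` to 1 and `Def.C` to 1, and set `(FwS.C, BwS.C)` to `(0, 1)` if it is
`(1, 0)`. -/
def reflectLeft (w : Work V) : Work V :=
  let hit : V → Bool := fun i => w.tmp (i + 1)
  let flip : V → Bool := fun i => hit i && w.fwd i && !w.bwd i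
  { w with
    cor := fun i => if hit i then true else w.cor i
    defect := fun i => if hit i then true else w.defect i
    fwd := fun i => if flip i then false else w.fwd i
    bwd := fun i => if flip i then true else w.bwd i }

/-- Propagate backward-signals by one site to the left. -/
def moveBackward (w : Work V) : Work V :=
  { w with
    tmp := w.bwd
    bwd := fun i => w.bwd (i + 1) }

/-- If `BwS.C = AnS.C = 1`, set both to 0. -/
def annihilateBackward (w : Work V) : Work V :=
  let hit : V → Bool := fun i => w.bwd i && w.anti i
  { w with
    bwd := fun i => if hit i then false else w.bwd i
    anti := fun i => if hit i then false else w.anti i }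

/-- If `BwS.C = 1` and `Sta.C > 0`, set `BwS.C` to 0 and decrement `Sta.C`. -/
def absorbBackward (w : Work V) : Work V :=
  let hit : V → Bool := fun i => w.bwd i && decide (0 < w.stack i)
  { w with
    bwd := fun i => if hit i then false else w.bwd i
    stack := fun i => if hit i then w.stack i - 1 else w.stack i }

/-- If `Def.C = AnS.C = 0` and `Sta.C > 0`, set `AnS.C` to 1 and decrement `Sta.C`. -/
def sendAnti (w : Work V) : Work V :=
  let hit : V → Bool := fun i => !w.defect i && !w.anti i && decide (0 < w.stack i)
  { w with
    anti := fun i => if hit i then true else w.anti i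
    stack := fun i => if hit i then w.stack i - 1 else w.stack i }

/-- Propagate anti-signals by one site to the right. -/
def moveAnti (w : Work V) : Work V :=
  { w with
    tmp := w.anti
    anti := fun i => w.anti (i - 1) }

/-- If `AnS.C = FwS.C = 1`, set both to 0. -/
def annihilateForward (w : Work V) : Work V :=
  let hit : V → Bool := fun i => w.anti i && w.fwd i
  { w with
    anti := fun i => if hit i then false else w.anti i
    fwd := fun i => if hit i then false else w.fwd i }

/-- One round of the propagation of backward-signals. -/
def backwardRound (w : Work V) : Work V :=
  absorbBackward (annihilateBackward (moveBackward w))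

/-- One of the first `ka - 1` rounds of the propagation of anti-signals. -/
def antiRound (w : Work V) : Work V :=
  annihilateBackward (annihilateForward (moveAnti w))

/-- The last round of the propagation of anti-signals. -/
def lastAntiRound (w : Work V) : Work V :=
  annihilateBackward (moveAnti w)

/-- One iteration of the asymmetric signal-rule, where anti-signals travel at speed `ka` and
backward-signals at speed `kb`. -/
def iteration (ka kb : ℕ) (u : Config V) : Work V :=
  let w₁ := matchRight (matchLeft (start u))
  let w₂ := moveForward (sendForward w₁)
  let w₃ := reflectLeft (reflectHere w₂)
  let w₄ := backwardRound^[kb] w₃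
  lastAntiRound (antiRound^[ka - 1] (sendAnti w₄))

/-- The syndrome (boundary) of an error. The qubit labelled `i` is the edge `(i, i + 1)`, so the
edges incident to the vertex `i` are `i - 1` and `i`. -/
def syndrome (E : V → Bool) : V → Bool :=
  fun i => xor (E (i - 1)) (E i)

/-- The initial configuration: defects on the syndrome of `E`, all other variables zero. -/
def initial (E : V → Bool) : Config V :=
  { Config.zero V with defect := syndrome E }

/-- One time step on the decoder together with the error on the qubits. The rule moves or removes
defects along the edge `(C, R)` exactly when it sets `Cor.C` to 1, and that edge is flipped. -/
def step (ka kb : ℕ) (s : Config V × (V → Bool)) : Config V × (V → Bool) :=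
  let w := iteration ka kb s.1
  (w.toConfig, fun i => xor (s.2 i) (w.cor i))

/-- The decoder configuration and the remaining error after `t` time steps on the initial
error `E`. -/
def run (ka kb : ℕ) (E : V → Bool) (t : ℕ) : Config V × (V → Bool) :=
  (step ka kb)^[t] (initial E, E)

/-- Decoding succeeds if the error is corrected and all decoder variables are back to zero. -/
def Success (ka kb : ℕ) (E : V → Bool) (t : ℕ) : Prop :=
  run ka kb E t = (Config.zero V, fun _ => false)

end Rule

/-- Probability of the error `E` when each qubit of the `n`-cycle is flipped independently with
probability `ε`. -/
def errorProb (n : ℕ) [NeZero n] (ε : ℝ) (E : ZMod n → Bool) : ℝ :=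
  ∏ i, if E i then ε else 1 - ε

open Classical in
/-- Probability that decoding fails (a logical flip or a nonzero decoder configuration) after `t`
time steps on the `n`-cycle, with both signal speeds `ka = kb = 3`. -/
noncomputable def logicalErrorRate (n : ℕ) [NeZero n] (t : ℕ) (ε : ℝ) : ℝ :=
  ∑ E : ZMod n → Bool with ¬ Success 3 3 E t, errorProb n ε E

/-- The threshold `1 / 232`. -/
noncomputable def epsTh : ℝ := 1 / 232

/-- The exponent `log 2 / log 232`. -/
noncomputable def alphaStar : ℝ := Real.log 2 / Real.log 232

end SignalRule

/-! The proof separates a deterministic part on the line from a union bound. Count a stack entry and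
an anti-signal as +1, a forward- or backward-signal as -1, and let the height be the cumulative sum
of these charges. Emission, reflection, absorption and annihilation conserve charge locally; the
height at a site rises only when a forward-signal leaves it to the right, and falls when an
anti-signal leaves it or a backward-signal enters it from the right. The height stays nonnegative
and vanishes just to the left of every defect (`exists_step`). Hence, although two kinds of signals
have speed 3, an empty region is invaded only from the left and only at unit speed (`quiet_window`).

An error supported on an interval of length `d` is corrected in time linear in `d` (`run_eq_zero`).
The core is that two defects at rest cannot coexist for long (`false_of_two_stays`): the left one
keeps emitting forward-signals, which either strike the right one or meet a nonempty stack. By then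
such a stack is old; it has shielded the sites to its right long enough for the fast
backward-signals there to drain, after which the height forces it to empty or the right defect to be
gone. By induction on the distance to the left end, defects neither arrive nor depart late
(`settlesEarly`). A single surviving defect is impossible, since the syndrome of a finite error is
even; the remaining signals then cancel or run out.

By linear correction and finite propagation speed, a cluster of errors with a wide enough empty
neighbourhood may be deleted without changing the state at a later time (`run_prune`). Iterating
over growing scales, an error that survives level `k` belongs to a chunk: two disjoint chunks of the
previous level that are close together, `2 ^ k` errors in all (`exists_chunk_of_reduced`). Without
such a chunk decoding succeeds.

The cycle is treated by lifting its error to a periodic error on the line. A chunk of diameter below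
`n` projects injectively, so failure forces one of at most `n * (shapes k).card` sets of `2 ^ k`
edges to be in error. The scales grow by a factor 116, and the recursion for the number of shapes
bounds the sum by `(232 * ε) ^ 2 ^ k / 2`, with 232 = 2 * 116. Taking `k` to be the logarithm of `n`
to base 116 gives the stretched exponential. -/

namespace SignalRule

/-! ### One time step in terms of a height function -/

/-- The integer value of a bit. -/
def bit (b : Bool) : ℤ := if b then 1 else 0

@[simp] theorem bit_true : bit true = 1 := rfl

@[simp] theorem bit_false : bit false = 0 := rfl

theorem bit_nonneg (b : Bool) : 0 ≤ bit b := by cases b <;> simp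

/-- Stack entries and anti-signals count positively, forward- and backward-signals negatively. -/
def charge (u : Config ℤ) (x : ℤ) : ℤ :=
  u.stack x + bit (u.anti x) - bit (u.fwd x) - bit (u.bwd x)

/-- `h` is a cumulative sum of the charges of `u`. -/
def Balanced (u : Config ℤ) (h : ℤ → ℤ) : Prop :=
  ∀ x, h x = h (x - 1) + charge u x

/-- Site `x` is the left member of a pair of defects that is matched. -/
def pairStart (D : ℤ → Bool) (x : ℤ) : Bool := !D (x - 1) && D x && D (x + 1)

/-- The defect at `x` is not matched with a neighbouring defect. -/
def kept (D : ℤ → Bool) (x : ℤ) : Bool := D x && !pairStart D x && !pairStart D (x - 1)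

/-- The defect at `x` emits a forward-signal. -/
def emits (D : ℤ → Bool) (x : ℤ) : Bool := kept D x && !kept D (x + 1)

/-- A forward-signal is about to move from `x` to `x + 1`. -/
def sent (u : Config ℤ) (x : ℤ) : Bool := u.fwd x || emits u.defect x

/-- The defect at `x` is reached by a forward-signal, and moves to `x - 1`. -/
def hit (u : Config ℤ) (x : ℤ) : Bool := kept u.defect x && sent u (x - 1)

/-- The defect at `x` is neither matched nor moved. -/
def stays (u : Config ℤ) (x : ℤ) : Bool := kept u.defect x && !hit u x

/-- The invariant of the dynamics: the height vanishes to the left of every defect, so that signals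
never pass a defect. -/
structure Inv (u : Config ℤ) (h : ℤ → ℤ) : Prop where
  balanced : Balanced u h
  nonneg : ∀ x, 0 ≤ h x
  defect_height : ∀ x, u.defect x → h (x - 1) = 0
  defect_fwd : ∀ x, u.defect x → u.fwd x = false
  defect_anti : ∀ x, u.defect x → u.anti x = false
  bwd_defect : ∀ x, u.bwd x → u.defect x = false
  bwd_defect_succ : ∀ x, u.bwd x → u.defect (x + 1) = false
  bwd_stack : ∀ x, u.bwd x → u.stack x = 0
  bwd_anti : ∀ x, u.bwd x → u.anti x = false

/-- An anti-signal may be launched from `y`, or pass through `y`. -/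
def Launch (u u' : Config ℤ) (y : ℤ) : Prop :=
  u.anti y = true ∨ ((0 < u.stack y ∨ emits u.defect y = true) ∧ u'.defect y = false)

/-- What happens to a configuration `u` of height `h` in one time step. -/
structure StepFacts (u : Config ℤ) (h : ℤ → ℤ) (u' : Config ℤ) (h' : ℤ → ℤ) : Prop where
  defect_eq : ∀ x, u'.defect x = (stays u x || hit u (x + 1))
  fwd_sent : ∀ x, u'.fwd x → sent u (x - 1) = true ∧ hit u x = false ∧ hit u (x + 1) = false
  fwd_source : ∀ x, u'.fwd x → u.fwd (x - 1) = true ∨ stays u (x - 1) = true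
  fwd_kill : ∀ x, sent u (x - 1) → hit u x = false → hit u (x + 1) = false → u'.fwd x = false →
    ∃ y, (y = x - 1 ∨ y = x - 2) ∧ Launch u u' y ∧ 1 ≤ h y + bit (sent u y)
  anti_source : ∀ x, u'.anti x → Launch u u' (x - 3) ∧ 1 ≤ h (x - 3) + bit (sent u (x - 3)) ∧
    1 ≤ h (x - 2) + bit (sent u (x - 2)) ∧ 1 ≤ h (x - 1) + bit (sent u (x - 1))
  stack_le : ∀ x, (u'.stack x : ℤ) ≤ u.stack x + bit (emits u.defect x)
  stack_hit : ∀ x, hit u x → u'.stack x ≤ u.stack x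
  stack_arrive : ∀ x, hit u (x + 1) → u'.stack x = 0
  stack_send : ∀ x, u'.defect x = false → u.defect x = false → u.anti x = false →
    u'.stack x ≤ u.stack x - 1
  block : ∀ x, u'.defect x = false → 0 < u'.stack x → u'.fwd (x + 1) = false
  bwd_source : ∀ x, u'.bwd x →
    (u.bwd (x + 3) = true ∨
      sent u (x + 2) = true ∧ (hit u (x + 3) = true ∨ hit u (x + 4) = true)) ∧
    1 ≤ h x + bit (sent u x) ∧ 1 ≤ h (x + 1) + bit (sent u (x + 1)) ∧
    1 ≤ h (x + 2) + bit (sent u (x + 2))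
  height_le : ∀ x, h' x ≤ h x + bit (sent u x)
  height_block : ∀ x, u'.defect x = false → 0 < u'.stack x → h' x ≤ h x + bit (sent u x) - 1

/-! #### Matching, forward-signals and reflection -/

/-- The registers after the forward-signals have been reflected. -/
def reflected (u : Config ℤ) : Work ℤ :=
  reflectLeft (reflectHere (moveForward (sendForward (matchRight (matchLeft (start u))))))

theorem kept_defect {D : ℤ → Bool} {x : ℤ} (hk : kept D x) : D x = true := by
  simp only [kept, Bool.and_eq_true] at hk
  exact hk.1.1

/-- A surviving defect at `x` carries no forward-signal, so the one striking `x + 1` would have to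
be its own; but a defect emits only if its right neighbour does not survive. So a defect never moves
onto an occupied site. -/
theorem kept_false_of_hit_succ {u : Config ℤ} (hF : ∀ x, u.defect x → u.fwd x = false) {x : ℤ}
    (hx : hit u (x + 1)) : kept u.defect x = false := by
  by_contra hk
  rw [Bool.not_eq_false] at hk
  simp only [hit, sent, emits, add_sub_cancel_right, hF x (kept_defect hk), hk,
    Bool.and_eq_true, Bool.false_or, Bool.true_and, Bool.not_eq_true'] at hx
  simp [hx.1] at hx

theorem matched_defect (u : Config ℤ) (x : ℤ) :
    (matchRight (matchLeft (start u))).defect x = kept u.defect x := by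
  simp only [matchRight, matchLeft, start, kept, pairStart]
  grind

theorem sendForward_hit {u : Config ℤ} (hF : ∀ x, u.defect x → u.fwd x = false) (x : ℤ) :
    (kept u.defect x && !kept u.defect (x + 1) && !u.fwd x) = emits u.defect x := by
  by_cases hk : kept u.defect x
  · simp [emits, hF x (kept_defect hk)]
  · simp [emits, hk]

theorem moved_fwd {u : Config ℤ} (hF : ∀ x, u.defect x → u.fwd x = false) (x : ℤ) :
    (moveForward (sendForward (matchRight (matchLeft (start u))))).fwd x = sent u (x - 1) := by
  have : ∀ y, (sendForward (matchRight (matchLeft (start u)))).fwd y = sent u y := by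
    intro y
    have e := sendForward_hit hF y
    simp only [sendForward, matched_defect]
    simp only [matchRight, matchLeft, start, e, sent]
    grind
  simpa [moveForward] using this (x - 1)

theorem moved_stack {u : Config ℤ} (hF : ∀ x, u.defect x → u.fwd x = false) (x : ℤ) :
    (moveForward (sendForward (matchRight (matchLeft (start u))))).stack x =
      if emits u.defect x then u.stack x + 1 else u.stack x := by
  have e := sendForward_hit hF x
  simp only [moveForward, sendForward, matched_defect]
  simp only [matchRight, matchLeft, start, e]

theorem moved_defect (u : Config ℤ) (x : ℤ) :
    (moveForward (sendForward (matchRight (matchLeft (start u))))).defect x =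
      kept u.defect x := by
  simpa [moveForward, sendForward] using matched_defect u x

section Reflected

variable {u : Config ℤ} {h : ℤ → ℤ}

theorem reflected_defect (hu : Inv u h) (x : ℤ) :
    (reflected u).defect x = (stays u x || hit u (x + 1)) := by
  simp only [reflected, reflectLeft, reflectHere, moved_defect, moved_fwd hu.defect_fwd, stays, hit]
  simp only [moveForward]
  grind

theorem bwd_of_hit (hu : Inv u h) {x : ℤ} (hx : hit u x) : u.bwd x = false := by
  have hd : u.defect x = true := kept_defect (by simp only [hit, Bool.and_eq_true] at hx; exact hx.1)
  by_contra hb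
  rw [Bool.not_eq_false] at hb
  simp [hu.bwd_defect x hb] at hd

theorem bwd_of_hit_succ (hu : Inv u h) {x : ℤ} (hx : hit u (x + 1)) : u.bwd x = false := by
  have hd : u.defect (x + 1) = true :=
    kept_defect (by simp only [hit, Bool.and_eq_true] at hx; exact hx.1)
  by_contra hb
  rw [Bool.not_eq_false] at hb
  simp [hu.bwd_defect_succ x hb] at hd

theorem reflected_fwd (hu : Inv u h) (x : ℤ) :
    (reflected u).fwd x = (sent u (x - 1) && !hit u x && !hit u (x + 1)) := by
  have h1 := @bwd_of_hit u h hu x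
  have h2 := @bwd_of_hit_succ u h hu x
  simp only [hit] at h1 h2
  simp only [reflected, reflectLeft, reflectHere, moved_defect, moved_fwd hu.defect_fwd, hit]
  simp only [moveForward, sendForward, matchRight, matchLeft, start]
  grind

theorem reflected_bwd (hu : Inv u h) (x : ℤ) :
    (reflected u).bwd x = (u.bwd x || sent u (x - 1) && (hit u x || hit u (x + 1))) := by
  have h1 := @bwd_of_hit u h hu x
  have h2 := @bwd_of_hit_succ u h hu x
  simp only [hit] at h1 h2
  simp only [reflected, reflectLeft, reflectHere, moved_defect, moved_fwd hu.defect_fwd, hit]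
  simp only [moveForward, sendForward, matchRight, matchLeft, start]
  grind

theorem reflected_anti (u : Config ℤ) (x : ℤ) : (reflected u).anti x = u.anti x := rfl

theorem reflected_stack (hu : Inv u h) (x : ℤ) :
    (reflected u).stack x = if emits u.defect x then u.stack x + 1 else u.stack x :=
  moved_stack hu.defect_fwd x

theorem reflected_cor (hu : Inv u h) (x : ℤ) :
    (reflected u).cor x = (pairStart u.defect x || hit u (x + 1)) := by
  simp only [reflected, reflectLeft, reflectHere, moved_defect, moved_fwd hu.defect_fwd, hit]
  simp only [moveForward, sendForward, matchRight, matchLeft, start, pairStart]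
  grind

/-- A backward-signal sits on an empty stack without anti-signal, so the charge there is negative,
and the height after it is still nonnegative. -/
theorem one_le_height_of_bwd (hu : Inv u h) {x : ℤ} (hb : u.bwd x) : 1 ≤ h (x - 1) := by
  have := hu.balanced x
  have h0 := hu.nonneg x
  have hf := bit_nonneg (u.fwd x)
  simp only [charge, hu.bwd_stack x hb, hu.bwd_anti x hb, hb, bit_true, bit_false] at this
  push_cast at this
  omega

/-- Emission adds a stack entry and a signal, and reflection trades one negative charge for another.
Only the step to the right matters: it moves a negative charge past `x` and raises the height there
by one. -/
theorem reflected_balanced (hu : Inv u h) :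
    Balanced (reflected u).toConfig fun x => h x + bit (sent u x) := by
  intro x
  have h1 := @bwd_of_hit u h hu x
  have h2 := @bwd_of_hit_succ u h hu x
  have hx := hu.balanced x
  have hF := hu.defect_fwd x
  have hk : emits u.defect x → u.defect x = true := fun he => kept_defect (by
    simp only [emits, Bool.and_eq_true] at he; exact he.1)
  simp only [charge, reflected_stack hu, reflected_anti, reflected_fwd hu, reflected_bwd hu]
  simp only [charge] at hx
  have hs : bit (sent u x) = bit (u.fwd x) + bit (emits u.defect x) := by
    simp only [sent]
    revert hF hk
    cases u.fwd x <;> cases emits u.defect x <;> simp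
  rw [hs, hx]
  revert h1 h2
  cases emits u.defect x <;> cases sent u (x - 1) <;> cases hit u x <;> cases hit u (x + 1) <;>
    cases u.bwd x <;> simp <;> omega

/-- This is the reserve spent later: the moves of the backward-signals lower the height by exactly
what is budgeted here, and a forward-signal at `x + 1` still has its unit afterwards. -/
theorem reflected_room (hu : Inv u h) (x : ℤ) :
    bit ((reflected u).fwd (x + 1)) + bit ((reflected u).bwd (x + 1)) ≤ h x + bit (sent u x) := by
  have h1 := @one_le_height_of_bwd u h hu (x + 1)
  have h0 := hu.nonneg x
  simp only [reflected_fwd hu, reflected_bwd hu, add_sub_cancel_right] at *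
  revert h1
  cases sent u x <;> cases hit u (x + 1) <;> cases hit u (x + 1 + 1) <;>
    cases u.bwd (x + 1) <;> simp <;> omega

end Reflected

/-! #### Backward-signals -/

section Backward

variable {w : Work ℤ} {h : ℤ → ℤ}

theorem backwardRound_bwd (w : Work ℤ) (x : ℤ) :
    (backwardRound w).bwd x = (w.bwd (x + 1) && !w.anti x && decide (w.stack x = 0)) := by
  simp only [backwardRound, absorbBackward, annihilateBackward, moveBackward]
  grind

theorem backwardRound_anti (w : Work ℤ) (x : ℤ) :
    (backwardRound w).anti x = (w.anti x && !w.bwd (x + 1)) := by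
  simp only [backwardRound, absorbBackward, annihilateBackward, moveBackward]
  grind

theorem backwardRound_stack (w : Work ℤ) (x : ℤ) :
    (backwardRound w).stack x =
      if w.bwd (x + 1) && !w.anti x then w.stack x - 1 else w.stack x := by
  simp only [backwardRound, absorbBackward, annihilateBackward, moveBackward]
  grind

/-- A backward-signal stepping left carries a negative charge across to the sum up to `x`;
annihilation and absorption remove opposite charges at one site. -/
theorem backwardRound_balanced (hw : Balanced w.toConfig h) :
    Balanced (backwardRound w).toConfig fun x => h x - bit (w.bwd (x + 1)) := by
  intro x
  have hx := hw x
  have hf : (backwardRound w).fwd = w.fwd := rfl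
  simp only [charge] at hx
  simp only [charge, backwardRound_bwd, backwardRound_anti, backwardRound_stack, hf, hx,
    sub_add_cancel]
  cases w.bwd (x + 1) <;> cases w.anti x <;> rcases Nat.eq_zero_or_pos (w.stack x) with hs | hs <;>
    simp [hs, Nat.ne_of_gt] <;> omega

/-- There is room for the forward- and the backward-signal at `x + 1` in the height at `x`. -/
def Room (w : Work ℤ) (h : ℤ → ℤ) : Prop :=
  ∀ x, bit (w.fwd (x + 1)) + bit (w.bwd (x + 1)) ≤ h x

theorem backwardRound_fwd_le (hr : Room w h) (x : ℤ) :
    bit (w.fwd (x + 1)) ≤ h x - bit (w.bwd (x + 1)) := by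
  have := hr x
  omega

theorem backwardRound_bwd_clear {x : ℤ} (hb : (backwardRound w).bwd x) :
    (backwardRound w).stack x = 0 ∧ (backwardRound w).anti x = false := by
  rw [backwardRound_bwd] at hb
  simp only [Bool.and_eq_true, Bool.not_eq_true', decide_eq_true_eq] at hb
  simp [backwardRound_stack, backwardRound_anti, hb.1.1, hb.2, hb.1.2]

theorem backwardRound_room (hw : Balanced w.toConfig h) (hr : Room w h) :
    Room (backwardRound w) fun x => h x - bit (w.bwd (x + 1)) := by
  intro x
  have hf : (backwardRound w).fwd = w.fwd := rfl
  have h1 := backwardRound_fwd_le hr x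
  have h2 := backwardRound_fwd_le hr (x + 1)
  have h3 := bit_nonneg (w.fwd (x + 1 + 1))
  have hb := backwardRound_balanced hw (x + 1)
  have hc := @backwardRound_bwd_clear w (x + 1)
  simp only [charge, hf, add_sub_cancel_right] at hb
  rw [hf]
  revert hc hb
  cases (backwardRound w).bwd (x + 1)
  · simp; omega
  · intro hc hb
    simp only [hc rfl, bit_true, bit_false] at hb ⊢
    push_cast at hb
    omega

/-- The three rounds of propagation of the backward-signals. -/
theorem backward_phase (hw : Balanced w.toConfig h) (hr : Room w h) :
    ∃ k : ℤ → ℤ, Balanced (backwardRound^[3] w).toConfig k ∧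
      (∀ x, bit (w.fwd (x + 1)) ≤ k x) ∧
      (∀ x, k x ≤ h x - bit (w.bwd (x + 1))) ∧
      (∀ x, (backwardRound^[3] w).stack x ≤ w.stack x) ∧
      (∀ x, (backwardRound^[3] w).anti x → w.anti x = true) ∧
      (∀ x, (backwardRound^[3] w).bwd x → w.bwd (x + 3) = true ∧ 1 ≤ h (x + 2) ∧
        1 ≤ h (x + 1) - bit (w.bwd (x + 2)) ∧ 1 ≤ h x - bit (w.bwd (x + 1))) ∧
      (∀ x, (backwardRound^[3] w).bwd x →
        (backwardRound^[3] w).stack x = 0 ∧ (backwardRound^[3] w).anti x = false) := by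
  have e3 : backwardRound^[3] w = backwardRound (backwardRound (backwardRound w)) := rfl
  rw [e3]
  have b1 := backwardRound_balanced hw
  have r1 := backwardRound_room hw hr
  have b2 := backwardRound_balanced b1
  have r2 := backwardRound_room b1 r1
  have b3 := backwardRound_balanced b2
  have l3 := backwardRound_fwd_le r2
  have hst : ∀ (w : Work ℤ) x, (backwardRound w).stack x ≤ w.stack x := by
    intro w x
    rw [backwardRound_stack]
    split <;> omega
  have han : ∀ (w : Work ℤ) x, (backwardRound w).anti x → w.anti x = true := by
    intro w x hx
    rw [backwardRound_anti] at hx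
    simp only [Bool.and_eq_true] at hx
    exact hx.1
  have hbw : ∀ (w : Work ℤ) x, (backwardRound w).bwd x → w.bwd (x + 1) = true := by
    intro w x hx
    rw [backwardRound_bwd] at hx
    simp only [Bool.and_eq_true] at hx
    exact hx.1.1
  refine ⟨_, b3, l3, ?_, ?_, ?_, ?_, fun x => backwardRound_bwd_clear⟩
  · intro x
    have := bit_nonneg ((backwardRound w).bwd (x + 1))
    have := bit_nonneg ((backwardRound (backwardRound w)).bwd (x + 1))
    omega
  · exact fun x => (hst _ x).trans ((hst _ x).trans (hst _ x))
  · exact fun x hx => han _ x (han _ x (han _ x hx))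
  · intro x hx
    have i1 := hbw _ x hx
    have i2 := hbw _ _ i1
    have i3 := hbw _ _ i2
    have g3 := hr (x + 2)
    have g2 : _ ≤ h (x + 1) - bit (w.bwd (x + 1 + 1)) := r1 (x + 1)
    have g1 : _ ≤ h x - bit (w.bwd (x + 1)) - bit ((backwardRound w).bwd (x + 1)) := r2 x
    rw [show x + 1 + 1 = x + 2 by ring] at i2 i3 g2
    rw [show x + 2 + 1 = x + 3 by ring] at i3 g3
    rw [i3] at g3
    rw [i2] at g2
    rw [i1] at g1
    have f1 := bit_nonneg (w.fwd (x + 3))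
    have f2 := bit_nonneg ((backwardRound w).fwd (x + 2))
    have f3 := bit_nonneg ((backwardRound (backwardRound w)).fwd (x + 1))
    have f4 := bit_nonneg ((backwardRound w).bwd (x + 1))
    refine ⟨i3, ?_, ?_, ?_⟩ <;> simp only [bit_true] at * <;> omega

end Backward

/-! #### Anti-signals -/

section Anti

variable {w : Work ℤ} {h : ℤ → ℤ}

theorem sendAnti_anti (w : Work ℤ) (x : ℤ) :
    (sendAnti w).anti x = (w.anti x || !w.defect x && decide (0 < w.stack x)) := by
  simp only [sendAnti]
  grind

theorem sendAnti_stack (w : Work ℤ) (x : ℤ) :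
    (sendAnti w).stack x = if !w.defect x && !w.anti x then w.stack x - 1 else w.stack x := by
  simp only [sendAnti]
  grind

theorem sendAnti_balanced (hw : Balanced w.toConfig h) : Balanced (sendAnti w).toConfig h := by
  intro x
  have hx := hw x
  have hf : (sendAnti w).fwd = w.fwd := rfl
  have hb : (sendAnti w).bwd = w.bwd := rfl
  simp only [charge] at hx
  simp only [charge, sendAnti_anti, sendAnti_stack, hf, hb, hx]
  cases w.anti x <;> cases w.defect x <;> rcases Nat.eq_zero_or_pos (w.stack x) with hs | hs <;>
    simp [hs]

theorem antiRound_anti (w : Work ℤ) (x : ℤ) :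
    (antiRound w).anti x = (w.anti (x - 1) && !w.fwd x && !w.bwd x) := by
  simp only [antiRound, annihilateForward, annihilateBackward, moveAnti]
  grind

theorem antiRound_fwd (w : Work ℤ) (x : ℤ) :
    (antiRound w).fwd x = (w.fwd x && !w.anti (x - 1)) := by
  simp only [antiRound, annihilateForward, annihilateBackward, moveAnti]
  grind

theorem antiRound_bwd (w : Work ℤ) (x : ℤ) :
    (antiRound w).bwd x = (w.bwd x && !(w.anti (x - 1) && !w.fwd x)) := by
  simp only [antiRound, annihilateForward, annihilateBackward, moveAnti]
  grind

theorem antiRound_balanced (hw : Balanced w.toConfig h) :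
    Balanced (antiRound w).toConfig fun x => h x - bit (w.anti x) := by
  intro x
  have hx := hw x
  have hs : (antiRound w).stack = w.stack := rfl
  simp only [charge] at hx
  simp only [charge, antiRound_anti, antiRound_fwd, antiRound_bwd, hs, hx]
  cases w.anti (x - 1) <;> cases w.fwd x <;> cases w.bwd x <;> simp <;> omega

theorem lastAntiRound_anti (w : Work ℤ) (x : ℤ) :
    (lastAntiRound w).anti x = (w.anti (x - 1) && !w.bwd x) := by
  simp only [lastAntiRound, annihilateBackward, moveAnti]
  grind

theorem lastAntiRound_bwd (w : Work ℤ) (x : ℤ) :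
    (lastAntiRound w).bwd x = (w.bwd x && !w.anti (x - 1)) := by
  simp only [lastAntiRound, annihilateBackward, moveAnti]
  grind

theorem lastAntiRound_balanced (hw : Balanced w.toConfig h) :
    Balanced (lastAntiRound w).toConfig fun x => h x - bit (w.anti x) := by
  intro x
  have hx := hw x
  have hs : (lastAntiRound w).stack = w.stack := rfl
  have hf : (lastAntiRound w).fwd = w.fwd := rfl
  simp only [charge] at hx
  simp only [charge, lastAntiRound_anti, lastAntiRound_bwd, hs, hf, hx]
  cases w.anti (x - 1) <;> cases w.bwd x <;> simp <;> omega

/-- An anti-signal that survives the round has met no negative charge at its new site, so the height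
there is at least one more than the nonnegative height on its left. -/
theorem antiRound_room (hw : Balanced w.toConfig h) (hA : ∀ x, bit (w.anti x) ≤ h x) (x : ℤ) :
    bit ((antiRound w).anti x) ≤ h x - bit (w.anti x) := by
  have hb := antiRound_balanced hw x
  have h0 := hA (x - 1)
  have h1 := hA x
  simp only [charge] at hb
  by_cases ha : (antiRound w).anti x
  · have := ha
    rw [antiRound_anti] at this
    simp only [Bool.and_eq_true, Bool.not_eq_true'] at this
    simp only [antiRound_fwd, antiRound_bwd, this, bit_true, Bool.false_and, bit_false, ha] at hb ⊢
    rw [this.1.1, bit_true] at h0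
    omega
  · simp only [Bool.not_eq_true] at ha
    simp only [ha, bit_false]
    omega

/-- The three rounds of propagation of the anti-signals. -/
theorem anti_phase (hw : Balanced w.toConfig h) (hA : ∀ x, bit (w.anti x) ≤ h x) :
    ∃ k : ℤ → ℤ, Balanced (lastAntiRound (antiRound^[3 - 1] w)).toConfig k ∧
      (∀ x, 0 ≤ k x) ∧
      (∀ x, k x ≤ h x - bit (w.anti x)) ∧
      (∀ x, (lastAntiRound (antiRound^[3 - 1] w)).anti x → w.anti (x - 3) = true ∧
        1 ≤ h (x - 3) ∧ 1 ≤ h (x - 2) ∧ 1 ≤ h (x - 1)) ∧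
      (∀ x, (lastAntiRound (antiRound^[3 - 1] w)).fwd x → w.fwd x = true) ∧
      (∀ x, w.anti x → (lastAntiRound (antiRound^[3 - 1] w)).fwd (x + 1) = false) ∧
      (∀ x, w.fwd x → (lastAntiRound (antiRound^[3 - 1] w)).fwd x = false →
        ∃ y, (y = x - 1 ∨ y = x - 2) ∧ w.anti y = true ∧ 1 ≤ h y) ∧
      (∀ x, (lastAntiRound (antiRound^[3 - 1] w)).bwd x →
        w.bwd x = true ∧ (lastAntiRound (antiRound^[3 - 1] w)).anti x = false) := by
  have e3 : antiRound^[3 - 1] w = antiRound (antiRound w) := rfl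
  rw [e3]
  have b1 := antiRound_balanced hw
  have r1 := antiRound_room hw hA
  have b2 := antiRound_balanced b1
  have r2 := antiRound_room b1 r1
  have b3 := lastAntiRound_balanced b2
  have hff : (lastAntiRound (antiRound (antiRound w))).fwd = (antiRound (antiRound w)).fwd := rfl
  have han : ∀ (w : Work ℤ) x, (antiRound w).anti x → w.anti (x - 1) = true := by
    intro w x hx
    rw [antiRound_anti] at hx
    simp only [Bool.and_eq_true] at hx
    exact hx.1.1
  have hfw : ∀ (w : Work ℤ) x, (antiRound w).fwd x → w.fwd x = true := by
    intro w x hx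
    rw [antiRound_fwd] at hx
    simp only [Bool.and_eq_true] at hx
    exact hx.1
  have hbw : ∀ (w : Work ℤ) x, (antiRound w).bwd x → w.bwd x = true := by
    intro w x hx
    rw [antiRound_bwd] at hx
    simp only [Bool.and_eq_true] at hx
    exact hx.1
  have one : ∀ {b : Bool} {z : ℤ}, bit b ≤ z → b = true → 1 ≤ z := by
    intro b z hz hb
    simpa [hb] using hz
  refine ⟨_, b3, ?_, ?_, ?_, ?_, ?_, ?_, ?_⟩
  · intro x
    have := r2 x
    omega
  · intro x
    have := bit_nonneg ((antiRound w).anti x)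
    have := bit_nonneg ((antiRound (antiRound w)).anti x)
    omega
  · intro x hx
    rw [lastAntiRound_anti] at hx
    simp only [Bool.and_eq_true] at hx
    have i1 := hx.1
    have i2 := han _ _ i1
    have i3 := han _ _ i2
    rw [show x - 1 - 1 = x - 2 by ring] at i2 i3
    rw [show x - 2 - 1 = x - 3 by ring] at i3
    have g1 := one (r2 (x - 1)) i1
    have g2 := one (r1 (x - 2)) i2
    have g3 := one (hA (x - 3)) i3
    have f1 := bit_nonneg (w.anti (x - 1))
    have f2 := bit_nonneg ((antiRound w).anti (x - 1))
    have f3 := bit_nonneg (w.anti (x - 2))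
    exact ⟨i3, g3, by omega, by omega⟩
  · intro x hx
    exact hfw _ x (hfw _ x hx)
  · intro x hx
    rw [hff, antiRound_fwd, antiRound_fwd, add_sub_cancel_right, hx]
    simp
  · intro x hx hx'
    rw [hff, antiRound_fwd] at hx'
    by_cases ha : w.anti (x - 1)
    · exact ⟨x - 1, Or.inl rfl, ha, one (hA _) ha⟩
    · have hx1 : (antiRound w).fwd x = true := by
        rw [antiRound_fwd, hx]
        simpa using ha
      rw [hx1] at hx'
      simp only [Bool.true_and, Bool.not_eq_false'] at hx'
      have := han _ _ hx'
      rw [show x - 1 - 1 = x - 2 by ring] at this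
      exact ⟨x - 2, Or.inr rfl, this, one (hA _) this⟩
  · intro x hx
    rw [lastAntiRound_bwd] at hx
    simp only [Bool.and_eq_true, Bool.not_eq_true'] at hx
    refine ⟨hbw _ x (hbw _ x hx.1), ?_⟩
    rw [lastAntiRound_anti, hx.2]
    rfl

end Anti

end SignalRule

namespace SignalRule

/-! #### The whole time step -/

section Step

variable {u : Config ℤ} {h : ℤ → ℤ}

theorem hit_kept {x : ℤ} (hx : hit u x) : kept u.defect x = true := by
  simp only [hit, Bool.and_eq_true] at hx
  exact hx.1

theorem hit_sent {x : ℤ} (hx : hit u x) : sent u (x - 1) = true := by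
  simp only [hit, Bool.and_eq_true] at hx
  exact hx.2

theorem hit_defect {x : ℤ} (hx : hit u x) : u.defect x = true := kept_defect (hit_kept hx)

theorem stays_kept {x : ℤ} (hx : stays u x) : kept u.defect x = true := by
  simp only [stays, Bool.and_eq_true] at hx
  exact hx.1

theorem stays_defect {x : ℤ} (hx : stays u x) : u.defect x = true := kept_defect (stays_kept hx)

theorem stays_sent {x : ℤ} (hx : stays u x) : sent u (x - 1) = false := by
  simp only [stays, hit, Bool.and_eq_true, Bool.not_eq_true'] at hx
  simpa [hx.1] using hx.2

theorem stays_hit {x : ℤ} (hx : stays u x) : hit u x = false := by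
  simp only [stays, Bool.and_eq_true, Bool.not_eq_true'] at hx
  exact hx.2

theorem stays_of_kept {x : ℤ} (hk : kept u.defect x) (hx : hit u x = false) : stays u x = true := by
  simp [stays, hk, hx]

theorem emits_kept {D : ℤ → Bool} {x : ℤ} (hx : emits D x) : kept D x = true := by
  simp only [emits, Bool.and_eq_true] at hx
  exact hx.1

theorem hit_false_of_hit_succ (hF : ∀ x, u.defect x → u.fwd x = false) {x : ℤ}
    (hx : hit u (x + 1)) : hit u x = false := by
  simp [hit, kept_false_of_hit_succ hF hx]

theorem iteration_eq (u : Config ℤ) : iteration 3 3 u =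
    lastAntiRound (antiRound^[3 - 1] (sendAnti (backwardRound^[3] (reflected u)))) := rfl

theorem iteration_cor (hu : Inv u h) (x : ℤ) :
    (iteration 3 3 u).cor x = (pairStart u.defect x || hit u (x + 1)) :=
  reflected_cor hu x

/-- The height is handed through the three phases, and the room estimates keep it nonnegative
through the drops. Most facts follow by comparing an intermediate height with the zero in front of a
defect. -/
theorem exists_step (hu : Inv u h) :
    ∃ h', Inv (iteration 3 3 u).toConfig h' ∧ StepFacts u h (iteration 3 3 u).toConfig h' := by
  rw [iteration_eq]
  obtain ⟨k, kb, kf, kh, ks, ka, kB, kc⟩ :=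
    backward_phase (reflected_balanced hu) (reflected_room hu)
  have eD : (backwardRound^[3] (reflected u)).defect = (reflected u).defect := rfl
  have eF : (backwardRound^[3] (reflected u)).fwd = (reflected u).fwd := rfl
  generalize backwardRound^[3] (reflected u) = w at *
  have k0 : ∀ x, 0 ≤ k x := fun x => (bit_nonneg _).trans (kf x)
  have kle : ∀ x, k x ≤ h x + bit (sent u x) := fun x => by
    have := kh x
    have := bit_nonneg ((reflected u).bwd (x + 1))
    omega
  have kx : ∀ x, w.stack x + bit (w.anti x) - bit (w.bwd x) ≤ k x := fun x => by
    have h1 := kb x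
    have h2 := kf (x - 1)
    simp only [charge, eF] at h1
    rw [sub_add_cancel] at h2
    omega
  have hA : ∀ x, bit ((sendAnti w).anti x) ≤ k x := fun x => by
    by_cases hx : (sendAnti w).anti x
    · have h1 := kx x
      rw [hx]
      rw [sendAnti_anti] at hx
      have hb : w.bwd x = false := by
        by_contra hb
        rw [Bool.not_eq_false] at hb
        simp [kc x hb] at hx
      rw [hb] at h1
      by_cases ha : w.anti x
      · simp [ha] at h1 ⊢
        omega
      · simp only [ha, Bool.false_or, Bool.and_eq_true, decide_eq_true_eq] at hx
        simp [ha] at h1 ⊢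
        omega
    · simp only [Bool.not_eq_true] at hx
      rw [hx]
      exact k0 x
  obtain ⟨m, mb, m0, mk, ma, mf, mx, md, mB⟩ := anti_phase (sendAnti_balanced kb) hA
  have fD : (lastAntiRound (antiRound^[3 - 1] (sendAnti w))).defect = (reflected u).defect := eD
  have fS : (lastAntiRound (antiRound^[3 - 1] (sendAnti w))).stack = (sendAnti w).stack := rfl
  have eF' : (sendAnti w).fwd = (reflected u).fwd := eF
  have eB' : (sendAnti w).bwd = w.bwd := rfl
  generalize lastAntiRound (antiRound^[3 - 1] (sendAnti w)) = v at *
  have sS : ∀ x, (sendAnti w).stack x ≤ w.stack x := fun x => by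
    rw [sendAnti_stack]
    split <;> omega
  have launch : ∀ y, (sendAnti w).anti y → Launch u v.toConfig y := by
    intro y hy
    rw [sendAnti_anti] at hy
    simp only [Bool.or_eq_true, Bool.and_eq_true, Bool.not_eq_true', decide_eq_true_eq] at hy
    rcases hy with hy | ⟨hy, hy'⟩
    · exact Or.inl (ka y hy)
    · refine Or.inr ⟨?_, by rw [fD, ← eD]; exact hy⟩
      have := ks y
      rw [reflected_stack hu] at this
      by_cases he : emits u.defect y
      · exact Or.inr he
      · simp only [he] at this
        exact Or.inl (by simp at this; omega)
  -- The signal striking `x + 1` raised the height at `x` from 0 to 1, and its reflection lowers it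
  -- back to 0. With no negative charge left at `x`, the stack there and the height at `x - 1`
  -- vanish as well.
  have arrive : ∀ x, hit u (x + 1) → k x = 0 ∧ k (x - 1) = 0 ∧ w.stack x = 0 := by
    intro x hx
    have h1 : h x = 0 := by simpa using hu.defect_height _ (hit_defect hx)
    have h2 : sent u x = true := by simpa using hit_sent hx
    have h3 : (reflected u).bwd (x + 1) = true := by
      simp [reflected_bwd hu, hx, h2]
    have h4 := kh x
    have h5 := k0 x
    simp only [h1, h2, h3, bit_true] at h4
    have h6 : w.bwd x = false := by
      by_contra hb
      rw [Bool.not_eq_false] at hb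
      have := (kB x hb).2.2.2
      simp [h1, h2, h3] at this
    have h7 : (reflected u).fwd x = false := by simp [reflected_fwd hu, hx]
    have h8 := kb x
    have h9 := k0 (x - 1)
    have h10 := bit_nonneg (w.anti x)
    simp only [charge, h6, eF, h7, bit_false] at h8
    omega
  have dk : ∀ x, v.defect x → k (x - 1) = 0 := by
    intro x hx
    rw [fD, reflected_defect hu, Bool.or_eq_true] at hx
    rcases hx with hx | hx
    · have h1 := kle (x - 1)
      rw [hu.defect_height x (stays_defect hx), stays_sent hx, bit_false] at h1
      exact le_antisymm h1 (k0 _)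
    · exact (arrive x hx).2.1
  have mle : ∀ x, m x ≤ k x := fun x => by
    have := mk x
    have := bit_nonneg ((sendAnti w).anti x)
    omega
  have inv : Inv v.toConfig m := by
    refine ⟨mb, m0, ?_, ?_, ?_, ?_, ?_, ?_, ?_⟩
    · intro x hx
      have := mle (x - 1)
      rw [dk x hx] at this
      exact le_antisymm this (m0 _)
    · intro x hx
      rw [fD, reflected_defect hu, Bool.or_eq_true] at hx
      by_contra hf
      rw [Bool.not_eq_false] at hf
      have := mf x hf
      rw [eF', reflected_fwd hu] at this
      rcases hx with hx | hx
      · simp [stays_sent hx] at this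
      · simp [hx] at this
    · intro x hx
      by_contra ha
      rw [Bool.not_eq_false] at ha
      have := (ma x ha).2.2.2
      rw [dk x hx] at this
      omega
    · intro x hb
      by_contra hx
      rw [Bool.not_eq_false] at hx
      have h1 := mb x
      have h2 := mle (x - 1)
      rw [dk x hx] at h2
      have h3 := m0 x
      have h4 := (kc x (mB x hb).1).1
      have h5 := sS x
      have h6 := bit_nonneg (v.fwd x)
      simp only [charge, hb, (mB x hb).2, fS, bit_true, bit_false] at h1
      omega
    · intro x hb
      by_contra hx
      rw [Bool.not_eq_false] at hx
      have hB := kB x (mB x hb).1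
      rw [fD, reflected_defect hu, Bool.or_eq_true] at hx
      rcases hx with hx | hx
      · have h1 := hu.defect_height _ (stays_defect hx)
        have h2 := stays_sent hx
        rw [add_sub_cancel_right] at h1 h2
        have h3 := hB.2.2.2
        have h4 := bit_nonneg ((reflected u).bwd (x + 1))
        simp only [h1, h2, bit_false] at h3
        omega
      · have h1 := hu.defect_height _ (hit_defect hx)
        have h2 := hit_sent hx
        rw [add_sub_cancel_right] at h1 h2
        have h3 : (reflected u).bwd (x + 2) = true := by
          rw [show x + 2 = x + 1 + 1 by ring]
          simp [reflected_bwd hu, hx, h2]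
        have h4 := hB.2.2.1
        simp [h1, h2, h3] at h4
    · intro x hb
      have h4 := (kc x (mB x hb).1).1
      have h5 := sS x
      rw [fS]
      omega
    · exact fun x hb => (mB x hb).2
  refine ⟨m, inv, ?_⟩
  have send : ∀ x, v.defect x = false → 0 < w.stack x → (sendAnti w).anti x = true := by
    intro x hx hs
    rw [fD, ← eD] at hx
    simp [sendAnti_anti, hx, hs]
  have send' : ∀ x, v.defect x = false → 0 < v.stack x → (sendAnti w).anti x = true := by
    intro x hx hs
    rw [fS] at hs
    exact send x hx (hs.trans_le (sS x))
  refine ⟨?_, ?_, ?_, ?_, ?_, ?_, ?_, ?_, ?_, ?_, ?_, ?_, ?_⟩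
  · intro x
    rw [fD, reflected_defect hu]
  · intro x hx
    have := mf x hx
    rw [eF', reflected_fwd hu] at this
    simpa [and_assoc] using this
  · intro x hx
    have := mf x hx
    have h0 := this
    rw [eF', reflected_fwd hu] at this
    simp only [Bool.and_eq_true, Bool.not_eq_true'] at this
    obtain ⟨⟨h1, h2⟩, h3⟩ := this
    -- The case to exclude is a defect that emits and is struck in the same step. It leaves behind a
    -- positive charge at `x - 1`, which becomes an anti-signal and kills the fresh forward-signal
    -- in the first round.
    by_contra hcon
    simp only [not_or, Bool.not_eq_true] at hcon
    have he : emits u.defect (x - 1) = true := by simpa [sent, hcon.1] using h1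
    have hh : hit u (x - 1) = true := by
      have := hcon.2
      simpa [stays, emits_kept he] using this
    have hd : v.defect (x - 1) = false := by
      rw [fD, reflected_defect hu, hcon.2, sub_add_cancel, h2]
      rfl
    have ha := arrive (x - 1 - 1) (by simpa using hh)
    have hk1 := kf (x - 1)
    rw [sub_add_cancel, ← eF', h0, bit_true] at hk1
    have hk2 := kb (x - 1)
    have hf1 : w.fwd (x - 1) = false := by rw [eF, reflected_fwd hu]; simp [hh]
    simp only [charge, ha.1, hf1, bit_false] at hk2
    have hk3 := bit_nonneg (w.bwd (x - 1))
    have hA5 : (sendAnti w).anti (x - 1) = true := by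
      rw [sendAnti_anti]
      by_cases hw : w.anti (x - 1)
      · simp [hw]
      · simp only [hw, bit_false] at hk2
        have : 0 < w.stack (x - 1) := by omega
        have hd' : w.defect (x - 1) = false := by rw [eD, ← fD]; exact hd
        simp [hd', this]
    have := mx _ hA5
    rw [sub_add_cancel, hx] at this
    simp at this
  · intro x h1 h2 h3 h4
    obtain ⟨y, hy, hy1, hy2⟩ := md x (by rw [eF', reflected_fwd hu]; simp [h1, h2, h3]) h4
    exact ⟨y, hy, launch y hy1, hy2.trans (kle y)⟩
  · intro x hx
    obtain ⟨h1, h2, h3, h4⟩ := ma x hx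
    exact ⟨launch _ h1, h2.trans (kle _), h3.trans (kle _), h4.trans (kle _)⟩
  · intro x
    have h1 := ks x
    have h2 := sS x
    rw [reflected_stack hu] at h1
    rw [fS]
    cases he : emits u.defect x <;> simp [he] at h1 ⊢ <;> omega
  · intro x hx
    have h1 := ks x
    rw [reflected_stack hu] at h1
    have hd : w.defect x = false := by
      rw [eD, reflected_defect hu]
      have h2 : hit u (x + 1) = false := by
        by_contra hc
        rw [Bool.not_eq_false] at hc
        rw [hit_false_of_hit_succ hu.defect_fwd hc] at hx
        simp at hx
      simp [stays, hx, h2]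
    have ha : w.anti x = false := by
      by_contra hc
      rw [Bool.not_eq_false] at hc
      have h2 := hu.defect_anti x (hit_defect hx)
      have h3 : u.anti x = true := ka x hc
      simp [h3] at h2
    rw [fS, sendAnti_stack]
    simp only [hd, ha, Bool.not_false, Bool.and_self, if_true]
    split at h1 <;> omega
  · intro x hx
    have h1 := sS x
    have h2 := (arrive x hx).2.2
    rw [fS]
    omega
  · intro x hx hd ha
    have h1 := ks x
    have he : emits u.defect x = false := by simp [emits, kept, hd]
    have hw : w.anti x = false := by
      by_contra hc
      rw [Bool.not_eq_false] at hc
      have h3 : u.anti x = true := ka x hc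
      simp [h3] at ha
    rw [fD, ← eD] at hx
    rw [reflected_stack hu, he] at h1
    rw [fS, sendAnti_stack]
    simp only [hx, hw, Bool.not_false, Bool.and_self, if_true]
    simp at h1
    omega
  · exact fun x hx hs => mx x (send' x hx hs)
  · intro x hx
    obtain ⟨h1, h2, h3, h4⟩ := kB x (mB x hx).1
    have h5 := bit_nonneg ((reflected u).bwd (x + 1))
    have h6 := bit_nonneg ((reflected u).bwd (x + 2))
    refine ⟨?_, by omega, by omega, by omega⟩
    rw [reflected_bwd hu, show x + 3 - 1 = x + 2 by ring, show x + 3 + 1 = x + 4 by ring] at h1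
    simpa using h1
  · exact fun x => (mle x).trans (kle x)
  · intro x hx hs
    have h1 := mk x
    rw [send' x hx hs, bit_true] at h1
    have := kle x
    omega

end Step

end SignalRule

namespace SignalRule

/-! ### Evolutions -/

/-- A sequence of configurations following the rule, with their heights. -/
structure Evolution (u : ℕ → Config ℤ) (H : ℕ → ℤ → ℤ) : Prop where
  fwd_zero : ∀ x, (u 0).fwd x = false
  bwd_zero : ∀ x, (u 0).bwd x = false
  anti_zero : ∀ x, (u 0).anti x = false
  stack_zero : ∀ x, (u 0).stack x = 0
  height_zero : ∀ x, H 0 x = 0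
  inv : ∀ t, Inv (u t) (H t)
  facts : ∀ t, StepFacts (u t) (H t) (u (t + 1)) (H (t + 1))

theorem run_zero {V : Type*} [AddGroupWithOne V] (ka kb : ℕ) (E : V → Bool) :
    run ka kb E 0 = (initial E, E) := rfl

theorem run_succ {V : Type*} [AddGroupWithOne V] (ka kb : ℕ) (E : V → Bool) (t : ℕ) :
    run ka kb E (t + 1) = step ka kb (run ka kb E t) :=
  Function.iterate_succ_apply' _ _ _

theorem inv_initial (E : ℤ → Bool) : Inv (initial E) fun _ => 0 := by
  refine ⟨?_, ?_, ?_, ?_, ?_, ?_, ?_, ?_, ?_⟩ <;>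
    simp [Balanced, charge, initial, Config.zero]

theorem exists_evolution (E : ℤ → Bool) :
    ∃ H, Evolution (fun t => (run 3 3 E t).1) H := by
  have hs : ∀ t, ∀ h : {h // Inv (run 3 3 E t).1 h},
      ∃ h' : {h // Inv (run 3 3 E (t + 1)).1 h},
        StepFacts (run 3 3 E t).1 h.1 (run 3 3 E (t + 1)).1 h'.1 := by
    intro t h
    obtain ⟨h', h1, h2⟩ := exists_step h.2
    rw [run_succ]
    exact ⟨⟨h', h1⟩, h2⟩
  choose next hnext using hs
  let G : ∀ t, {h // Inv (run 3 3 E t).1 h} := fun t =>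
    Nat.rec (⟨fun _ => 0, inv_initial E⟩ : {h // Inv (run 3 3 E 0).1 h}) (fun t h => next t h) t
  refine ⟨fun t => (G t).1, fun _ => rfl, fun _ => rfl, fun _ => rfl, fun _ => rfl, fun _ => rfl,
    fun t => (G t).2, fun t => hnext t (G t)⟩

/-- All registers and the height vanish at `x`. -/
structure Clear (u : Config ℤ) (h : ℤ → ℤ) (x : ℤ) : Prop where
  defect : u.defect x = false
  fwd : u.fwd x = false
  bwd : u.bwd x = false
  anti : u.anti x = false
  stack : u.stack x = 0
  height : h x = 0

theorem Clear.kept {u : Config ℤ} {h : ℤ → ℤ} {x : ℤ} (hx : Clear u h x) :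
    kept u.defect x = false := by
  simp [SignalRule.kept, hx.defect]

theorem Clear.sent {u : Config ℤ} {h : ℤ → ℤ} {x : ℤ} (hx : Clear u h x) : sent u x = false := by
  simp [SignalRule.sent, hx.fwd, emits, hx.kept]

theorem Clear.hit_succ {u : Config ℤ} {h : ℤ → ℤ} {x : ℤ} (hx : Clear u h x) :
    hit u (x + 1) = false := by
  simp [hit, hx.sent]

namespace Evolution

variable {u : ℕ → Config ℤ} {H : ℕ → ℤ → ℤ} (ev : Evolution u H)
include ev

theorem clear_of_eq {t : ℕ} {x : ℤ} (hd : (u t).defect x = false) (hf : (u t).fwd x = false)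
    (hs : (u t).stack x = 0) (h0 : H t x = 0) (h1 : H t (x - 1) = 0) : Clear (u t) (H t) x := by
  have hb := (ev.inv t).balanced x
  have ha := (ev.inv t).bwd_anti x
  simp only [charge, hf, hs, h0, h1, bit_false] at hb
  have : (u t).bwd x = false := by
    by_contra hc
    rw [Bool.not_eq_false] at hc
    rw [ha hc, hc] at hb
    simp at hb
  refine ⟨hd, hf, this, ?_, hs, h0⟩
  rw [this] at hb
  by_contra hc
  rw [Bool.not_eq_false] at hc
  rw [hc] at hb
  simp at hb

/-- With height zero and nothing sent, the height stays zero, and two consecutive zeros exclude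
backward- and anti-signals. A defect moves left only if a signal from its left strikes it, so the
right end of the window does not erode. -/
theorem clear_step {t : ℕ} {p q : ℤ} (hc : ∀ x, p ≤ x → x ≤ q → Clear (u t) (H t) x) {x : ℤ}
    (hp : p + 1 ≤ x) (hq : x ≤ q) : Clear (u (t + 1)) (H (t + 1)) x := by
  have hh : ∀ y, p ≤ y → y ≤ q → H (t + 1) y = 0 := by
    intro y h1 h2
    have h3 := (ev.facts t).height_le y
    have h4 := (ev.inv (t + 1)).nonneg y
    rw [(hc y h1 h2).height, (hc y h1 h2).sent] at h3
    exact le_antisymm h3 h4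
  have cx := hc x (by omega) hq
  have cx1 := hc (x - 1) (by omega) (by omega)
  refine ev.clear_of_eq ?_ ?_ ?_ (hh x (by omega) hq) (hh (x - 1) (by omega) (by omega))
  · rw [(ev.facts t).defect_eq, cx.hit_succ]
    simp [stays, cx.kept]
  · by_contra hf
    rw [Bool.not_eq_false] at hf
    have := ((ev.facts t).fwd_sent x hf).1
    rw [cx1.sent] at this
    simp at this
  · have := (ev.facts t).stack_le x
    rw [cx.stack] at this
    simp only [emits, cx.kept, Bool.false_and, bit_false] at this
    omega

theorem clear_window {p q : ℤ} (h0 : ∀ x, p ≤ x → x ≤ q → (u 0).defect x = false) (t : ℕ) :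
    ∀ x, p + t ≤ x → x ≤ q → Clear (u t) (H t) x := by
  induction t with
  | zero =>
    intro x h1 h2
    exact ⟨h0 x (by simpa using h1) h2, ev.fwd_zero x, ev.bwd_zero x, ev.anti_zero x,
      ev.stack_zero x, ev.height_zero x⟩
  | succ t ih =>
    intro x h1 h2
    push_cast at h1
    exact ev.clear_step ih (by omega) h2

end Evolution

/-- All registers vanish at `x` and the edge `x` carries no error. -/
structure Quiet (s : Config ℤ × (ℤ → Bool)) (x : ℤ) : Prop where
  defect : s.1.defect x = false
  fwd : s.1.fwd x = false
  bwd : s.1.bwd x = false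
  anti : s.1.anti x = false
  stack : s.1.stack x = 0
  error : s.2 x = false

theorem step_error {s : Config ℤ × (ℤ → Bool)} {h : ℤ → ℤ} (hs : Inv s.1 h) (x : ℤ) :
    (step 3 3 s).2 x = xor (s.2 x) (pairStart s.1.defect x || hit s.1 (x + 1)) := by
  simp only [step, iteration_cor hs]

/-- Signals and defects enter an error-free window at most at unit speed, and only from the
left. -/
theorem quiet_window (E : ℤ → Bool) {p q : ℤ} (hE : ∀ x, p ≤ x → x ≤ q → E x = false) (t : ℕ)
    {x : ℤ} (hp : p + 1 + t ≤ x) (hq : x ≤ q) : Quiet (run 3 3 E t) x := by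
  obtain ⟨H, ev⟩ := exists_evolution E
  have hc := ev.clear_window (p := p + 1) (q := q) (by
    intro x h1 h2
    change syndrome E x = false
    simp [syndrome, hE x (by omega) h2, hE (x - 1) (by omega) (by omega)])
  have he : ∀ t : ℕ, ∀ x, p + 1 + t ≤ x → x ≤ q → (run 3 3 E t).2 x = false := by
    intro t
    induction t with
    | zero =>
      intro x h1 h2
      exact hE x (by push_cast at h1; omega) h2
    | succ t ih =>
      intro x h1 h2
      push_cast at h1
      have h3 := hc t x (by omega) h2
      rw [run_succ, step_error (ev.inv t), ih x (by omega) h2, h3.hit_succ]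
      have : (run 3 3 E t).1.defect x = false := h3.defect
      simp [pairStart, this]
  have h := hc t x hp hq
  exact ⟨h.defect, h.fwd, h.bwd, h.anti, h.stack, he t x hp hq⟩

/-- The defects are always the syndrome of the remaining error. -/
theorem defect_eq_syndrome (E : ℤ → Bool) (t : ℕ) :
    (run 3 3 E t).1.defect = syndrome (run 3 3 E t).2 := by
  obtain ⟨H, ev⟩ := exists_evolution E
  induction t with
  | zero => rfl
  | succ t ih =>
    funext x
    have h1 := (ev.facts t).defect_eq x
    have e1 : ∀ y, (run 3 3 E (t + 1)).2 y = xor ((run 3 3 E t).2 y)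
        (pairStart (run 3 3 E t).1.defect y || hit (run 3 3 E t).1 (y + 1)) := fun y => by
      rw [run_succ]; exact step_error (ev.inv t) y
    have hx := congrFun ih x
    rw [h1]
    simp only [syndrome, e1, sub_add_cancel] at hx ⊢
    have k1 : hit (run 3 3 E t).1 x → kept (run 3 3 E t).1.defect x = true := hit_kept
    have k2 : hit (run 3 3 E t).1 (x + 1) → kept (run 3 3 E t).1.defect (x + 1) = true := hit_kept
    have k3 := @kept_false_of_hit_succ _ (ev.inv t).defect_fwd x
    clear h1 e1 ih ev
    simp only [stays]
    simp only [kept, pairStart, sub_add_cancel, add_sub_cancel_right] at *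
    -- What remains is an identity in finitely many bits, with the dynamics entering only through
    -- `k1`, `k2` and `k3`.
    generalize (run 3 3 E t).1.defect (x - 1 - 1) = d₁ at *
    generalize (run 3 3 E t).1.defect (x - 1) = d₂ at *
    generalize (run 3 3 E t).1.defect x = d₃ at *
    generalize (run 3 3 E t).1.defect (x + 1) = d₄ at *
    generalize (run 3 3 E t).1.defect (x + 1 + 1) = d₅ at *
    generalize hit (run 3 3 E t).1 x = b₁ at *
    generalize hit (run 3 3 E t).1 (x + 1) = b₂ at *
    generalize (run 3 3 E t).2 (x - 1) = e₁ at *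
    generalize (run 3 3 E t).2 x = e₂ at *
    subst hx
    clear H
    revert d₁ d₂ d₄ d₅ b₁ b₂ e₁ e₂
    decide

end SignalRule

namespace SignalRule

/-! ### Defects come to rest after a time linear in the distance to the leftmost defect -/

theorem kept_false_of_pairStart {D : ℤ → Bool} {x : ℤ} (hx : pairStart D x) :
    kept D x = false ∧ kept D (x + 1) = false := by
  simp [kept, hx]

theorem kept_or_pairStart {D : ℤ → Bool} {x : ℤ} (hx : D x) :
    kept D x = true ∨ pairStart D x = true ∨ pairStart D (x - 1) = true := by
  simp only [kept, hx]
  cases pairStart D x <;> cases pairStart D (x - 1) <;> simp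

theorem kept_pairStart {D : ℤ → Bool} {x : ℤ} (hx : kept D x) :
    pairStart D x = false ∧ pairStart D (x - 1) = false := by
  simp only [kept, Bool.and_eq_true, Bool.not_eq_true'] at hx
  exact ⟨hx.1.2, hx.2⟩

theorem defect_of_kept_of_kept {D : ℤ → Bool} {x : ℤ} (hx : kept D x) (hy : kept D (x + 1)) :
    D (x - 1) = true ∧ D (x - 2) = true := by
  have h1 := kept_defect hx
  have h2 := kept_defect hy
  obtain ⟨h3, h4⟩ := kept_pairStart hx
  have h5 : D (x - 1) = true := by simpa [pairStart, h1, h2] using h3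
  refine ⟨h5, ?_⟩
  rw [show x - 2 = x - 1 - 1 by ring]
  simpa [pairStart, h1, h5] using h4

theorem sent_of_not_defect {u : Config ℤ} {x : ℤ} (hx : u.defect x = false) :
    sent u x = u.fwd x := by
  simp [sent, emits, kept, hx]

theorem stays_of_defect_false {u : Config ℤ} {x : ℤ} (hx : u.defect x = false) :
    stays u x = false := by
  simp [stays, kept, hx]

theorem hit_of_defect_false {u : Config ℤ} {x : ℤ} (hx : u.defect x = false) :
    hit u x = false := by
  simp [hit, kept, hx]

theorem emits_of_defect_false {u : Config ℤ} {x : ℤ} (hx : u.defect x = false) :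
    emits u.defect x = false := by
  simp [emits, kept, hx]

theorem hit_fwd {u : Config ℤ} {x : ℤ} (hx : hit u x) : u.fwd (x - 1) = true := by
  have h1 := hit_sent hx
  have h2 := hit_kept hx
  simpa [sent, emits, h2] using h1

/-- The defect at `x` rests at time `t`, and arrives there or departs from there at the adjacent
time step. -/
def Settles (u : ℕ → Config ℤ) (x : ℤ) (t : ℕ) : Prop :=
  stays (u t) x = true ∧ (hit (u (t + 1)) x = true ∨ ∃ s, t = s + 1 ∧ hit (u s) (x + 1) = true)

/-- Defects settle at `x` only in a time linear in the distance to `a`. -/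
def SettlesEarly (u : ℕ → Config ℤ) (a x : ℤ) : Prop :=
  ∀ t : ℕ, Settles u x t → (t : ℤ) ≤ 3 * (x - a)

theorem le_of_defect {u : ℕ → Config ℤ} {H : ℕ → ℤ → ℤ} {a : ℤ}
    (hl : ∀ t x, x < a → Clear (u t) (H t) x) {t : ℕ} {x : ℤ} (hx : (u t).defect x) : a ≤ x := by
  by_contra hc
  rw [(hl t x (by omega)).defect] at hx
  simp at hx

namespace Evolution

variable {u : ℕ → Config ℤ} {H : ℕ → ℤ → ℤ} (ev : Evolution u H)
include ev

theorem defect_succ {t : ℕ} {x : ℤ} (hx : (u (t + 1)).defect x) :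
    stays (u t) x = true ∨ hit (u t) (x + 1) = true := by
  rw [(ev.facts t).defect_eq] at hx
  simpa using hx

theorem defect_succ_eq_false {t : ℕ} {x : ℤ} (h1 : stays (u t) x = false)
    (h2 : hit (u t) (x + 1) = false) : (u (t + 1)).defect x = false := by
  rw [(ev.facts t).defect_eq, h1, h2]; rfl

theorem defect_of_stays {t : ℕ} {x : ℤ} (h1 : stays (u t) x) : (u (t + 1)).defect x = true := by
  rw [(ev.facts t).defect_eq, h1]; rfl

theorem defect_of_hit {t : ℕ} {x : ℤ} (h1 : hit (u t) (x + 1)) :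
    (u (t + 1)).defect x = true := by
  rw [(ev.facts t).defect_eq, h1]; simp

theorem not_defect_of_hit {t : ℕ} {x : ℤ} (hx : hit (u t) x) : (u (t + 1)).defect x = false := by
  refine ev.defect_succ_eq_false (by simp [stays, hx]) ?_
  by_contra hc
  rw [Bool.not_eq_false] at hc
  have := kept_false_of_hit_succ (ev.inv t).defect_fwd hc
  rw [hit_kept hx] at this
  simp at this

theorem not_defect_of_fwd {t : ℕ} {x : ℤ} (hx : (u t).fwd x) : (u t).defect x = false := by
  by_contra hc
  rw [Bool.not_eq_false] at hc
  rw [(ev.inv t).defect_fwd x hc] at hx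
  simp at hx

/-- A forward-signal can be traced back to the defect that emitted it. -/
theorem fwd_trace {t : ℕ} {x : ℤ} (hx : (u t).fwd x) : ∃ n w : ℕ, t = w + n ∧ 1 ≤ n ∧
    stays (u w) (x - n) = true ∧
    ∀ j : ℕ, 1 ≤ j → j ≤ n → (u (w + j)).fwd (x - n + j) = true := by
  induction t generalizing x with
  | zero => rw [ev.fwd_zero] at hx; simp at hx
  | succ t ih =>
    rcases (ev.facts t).fwd_source x hx with h | h
    · obtain ⟨n, w, h1, h2, h3, h4⟩ := ih h
      have e : x - ((n + 1 : ℕ) : ℤ) = x - 1 - n := by push_cast; ring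
      refine ⟨n + 1, w, by omega, by omega, by rw [e]; exact h3, ?_⟩
      intro j hj hj'
      rw [e]
      rcases Nat.lt_or_ge n j with hn | hn
      · obtain rfl : j = n + 1 := by omega
        rw [show w + (n + 1) = t + 1 by omega, show x - 1 - n + ((n + 1 : ℕ) : ℤ) = x by
          push_cast; ring]
        exact hx
      · exact h4 j hj hn
    · refine ⟨1, t, rfl, le_rfl, by simpa using h, ?_⟩
      intro j hj hj'
      obtain rfl : j = 1 := by omega
      simpa using hx

theorem stays_pred {a x : ℤ} {t : ℕ} (he : SettlesEarly u a x) (ht : 3 * (x - a) ≤ t)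
    (hx : stays (u (t + 1)) x) : stays (u t) x = true := by
  refine (ev.defect_succ (stays_defect hx)).resolve_right fun hc => ?_
  have := he (t + 1) ⟨hx, Or.inr ⟨t, rfl, hc⟩⟩
  push_cast at this
  omega

section Left

variable {a : ℤ} (hl : ∀ t x, x < a → Clear (u t) (H t) x)
include hl

/-- Matching eats a run of defects from its left end. Four consecutive defects one step later force
four consecutive ones now, shifted left by one, so tracing back moves the run by one site per step
and it may not cross `a`. -/
theorem le_of_four_defects (t : ℕ) : ∀ x, (u t).defect x → (u t).defect (x + 1) →
    (u t).defect (x + 2) → (u t).defect (x + 3) → a + t ≤ x := by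
  induction t with
  | zero =>
    intro x h0 _ _ _
    simpa using le_of_defect hl h0
  | succ t ih =>
    intro x h0 h1 h2 h3
    have key : ∀ y, (u (t + 1)).defect y → (u (t + 1)).defect (y + 1) → stays (u t) y = true := by
      intro y hy hy'
      refine (ev.defect_succ hy).resolve_right fun hc => ?_
      rw [ev.not_defect_of_hit hc] at hy'
      simp at hy'
    have k0 := stays_kept (key x h0 h1)
    have k1 := stays_kept (key (x + 1) h1 (by rwa [show x + 1 + 1 = x + 2 by ring]))
    have k2 := stays_kept (key (x + 2) h2 (by rwa [show x + 2 + 1 = x + 3 by ring]))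
    have := ih (x - 1) (defect_of_kept_of_kept k0 k1).1 (by simpa using kept_defect k0)
      (by rw [show x - 1 + 2 = x + 1 by ring]; exact kept_defect k1)
      (by rw [show x - 1 + 3 = x + 2 by ring]; exact kept_defect k2)
    push_cast
    omega

/-- Neighbouring defects both survive only in a long run of defects. -/
theorem le_of_kept_of_kept {t : ℕ} {x : ℤ} (hx : kept (u t).defect x)
    (hy : kept (u t).defect (x + 1)) : a + t + 2 ≤ x := by
  obtain ⟨h1, h2⟩ := defect_of_kept_of_kept hx hy
  have := ev.le_of_four_defects hl t (x - 2) h2 (by rwa [show x - 2 + 1 = x - 1 by ring])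
    (by simpa using kept_defect hx) (by rw [show x - 2 + 3 = x + 1 by ring]; exact kept_defect hy)
  omega

/-- A resting defect keeps resting as long as no defect appears on its right. -/
theorem stays_succ {t : ℕ} {x : ℤ} (he : SettlesEarly u a x) (ht : 3 * (x - a) < t)
    (hx : stays (u t) x) (hy : (u (t + 1)).defect (x + 1) = false) :
    stays (u (t + 1)) x = true := by
  have hd := ev.defect_of_stays hx
  have ha := le_of_defect hl hd
  have hk : kept (u (t + 1)).defect x = true := by
    rcases kept_or_pairStart hd with h | h | h
    · exact h
    · simp [pairStart, hy] at h
    · exfalso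
      have h1 : (u (t + 1)).defect (x - 1) = true := by
        simp only [pairStart, Bool.and_eq_true] at h
        exact h.1.2
      rcases ev.defect_succ h1 with h2 | h2
      · have := ev.le_of_kept_of_kept hl (stays_kept h2)
          (by rw [sub_add_cancel]; exact stays_kept hx)
        omega
      · rw [sub_add_cancel, stays_hit hx] at h2
        simp at h2
  refine stays_of_kept hk ?_
  by_contra hc
  rw [Bool.not_eq_false] at hc
  have := he t ⟨hx, Or.inl hc⟩
  omega

/-- The forward-signals emitted by a resting defect advance unless they meet a moving defect or a
site with a nonempty stack. -/
theorem ray {s : ℤ} {v : ℕ} (he : SettlesEarly u a s) (hv : 3 * (s - a) < v)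
    (hs : stays (u v) s) (N : ℕ)
    (hN : ∀ i < N, hit (u (v + i)) (s + i + 1) = false ∧ hit (u (v + i)) (s + i + 2) = false) :
    (∃ i, 1 ≤ i ∧ i ≤ N ∧ 0 < (u (v + i)).stack (s + i) ∧ (u (v + i)).defect (s + i) = false) ∨
    (stays (u (v + N)) s = true ∧ sent (u (v + N)) (s + N) = true ∧
      ∀ x, s < x → x ≤ s + N → (u (v + N)).defect x = false ∧ (u (v + N)).stack x = 0 ∧
        (u (v + N)).anti x = false) := by
  have ha := le_of_defect hl (stays_defect hs)
  induction N with
  | zero =>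
    refine Or.inr ⟨hs, ?_, fun x h1 h2 => ?_⟩
    · have hk := stays_kept hs
      have : kept (u v).defect (s + 1) = false := by
        by_contra hc
        rw [Bool.not_eq_false] at hc
        have := ev.le_of_kept_of_kept hl hk hc
        omega
      simp [sent, emits, hk, this]
    · push_cast at h2
      omega
  | succ N ih =>
    rcases ih (fun i hi => hN i (by omega)) with ⟨i, h1, h2, h3⟩ | ⟨hst, hse, hcl⟩
    · exact Or.inl ⟨i, h1, by omega, h3⟩
    obtain ⟨n1, n2⟩ := hN N (by omega)
    have hf := ev.facts (v + N)
    have hH : H (v + N) (s - 1) = 0 := (ev.inv _).defect_height s (stays_defect hst)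
    have hS : sent (u (v + N)) (s - 1) = false := stays_sent hst
    have hk : kept (u (v + N)).defect (s + N + 1) = false := by
      by_contra hc
      rw [Bool.not_eq_false] at hc
      simp [hit, hc, hse] at n1
    have hD : ∀ x, s < x → x ≤ s + N + 1 → (u (v + N + 1)).defect x = false := by
      intro x h1 h2
      apply ev.defect_succ_eq_false
      · rcases eq_or_lt_of_le h2 with rfl | h2
        · simp [stays, hk]
        · exact stays_of_defect_false (hcl x h1 (by omega)).1
      · rcases eq_or_lt_of_le h2 with rfl | h2
        · rw [show s + N + 1 + 1 = s + N + 2 by ring]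
          exact n2
        · rcases eq_or_lt_of_le (Int.le_of_lt_add_one h2) with rfl | h2
          · exact n1
          · exact hit_of_defect_false (hcl (x + 1) (by omega) (by omega)).1
    have hst' : stays (u (v + N + 1)) s = true :=
      ev.stays_succ hl he (by push_cast; omega) hst (hD _ (by omega) (by omega))
    -- Nothing can chase the ray: the resting defect sends no anti-signal and the sites passed hold
    -- neither stack nor anti-signal. Launches from further left are excluded by the zero height at
    -- `s - 1`.
    have hL : ∀ y, s ≤ y → y ≤ s + N → ¬ Launch (u (v + N)) (u (v + N + 1)) y := by
      intro y h1 h2 hy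
      rcases eq_or_lt_of_le h1 with rfl | h1
      · rcases hy with h | ⟨_, h⟩
        · rw [(ev.inv _).defect_anti _ (stays_defect hst)] at h
          simp at h
        · rw [stays_defect hst'] at h
          simp at h
      · obtain ⟨c1, c2, c3⟩ := hcl y h1 h2
        rcases hy with h | ⟨h | h, _⟩
        · simp [c3] at h
        · omega
        · simp [emits_of_defect_false c1] at h
    by_cases hz : 0 < (u (v + N + 1)).stack (s + N + 1)
    · refine Or.inl ⟨N + 1, by omega, le_rfl, ?_⟩
      push_cast
      rw [← add_assoc, ← add_assoc]
      exact ⟨hz, hD _ (by omega) le_rfl⟩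
    refine Or.inr ?_
    push_cast
    rw [← add_assoc, ← add_assoc]
    refine ⟨hst', ?_, fun x h1 h2 => ⟨hD x h1 h2, ?_, ?_⟩⟩
    · rw [sent_of_not_defect (hD _ (by omega) le_rfl)]
      by_contra hc
      rw [Bool.not_eq_true] at hc
      obtain ⟨y, hy, h1, h2⟩ := hf.fwd_kill (s + N + 1) (by rwa [add_sub_cancel_right]) n1
        (by rwa [show s + N + 1 + 1 = s + N + 2 by ring]) hc
      by_cases hys : y = s - 1
      · rw [hys, hH, hS] at h2
        simp at h2
      · exact hL y (by omega) (by omega) h1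
    · rcases eq_or_lt_of_le h2 with rfl | h2
      · omega
      · have h3 := hf.stack_le x
        obtain ⟨c1, c2, _⟩ := hcl x h1 (by omega)
        rw [emits_of_defect_false c1, c2] at h3
        simp only [bit_false, Nat.cast_zero, add_zero] at h3
        omega
    · by_contra hc
      rw [Bool.not_eq_false] at hc
      obtain ⟨h3, h4, h5, h6⟩ := hf.anti_source x hc
      have g : ∀ y, 1 ≤ H (v + N) y + bit (sent (u (v + N)) y) → y ≠ s - 1 := by
        rintro y hy rfl
        rw [hH, hS] at hy
        simp at hy
      have g1 := g _ h4
      have g2 := g _ h5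
      have g3 := g _ h6
      exact hL (x - 3) (by omega) (by omega) h3

/-- A stack at a site without defect has been there, without defect, since a time linear in the
distance to `a`. -/
theorem stack_pos_of_stack_pos {z : ℤ} (he : SettlesEarly u a z) {t : ℕ}
    (hS : 0 < (u t).stack z) (hD : (u t).defect z = false) (j : ℕ)
    (hj : 3 * (z - a) + 2 + j ≤ t) (ha : a ≤ z) :
    0 < (u (t - j)).stack z ∧ (u (t - j)).defect z = false := by
  induction j with
  | zero => exact ⟨hS, hD⟩
  | succ j ih =>
    obtain ⟨h1, h2⟩ := ih (by push_cast at hj; omega)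
    push_cast at hj
    obtain ⟨r, hr⟩ : ∃ r, t - j = r + 1 + 1 := ⟨t - j - 2, by omega⟩
    have hr' : t - (j + 1) = r + 1 := by omega
    rw [hr] at h1 h2
    rw [hr']
    have hrl : 3 * (z - a) + 1 ≤ r := by omega
    have hle := (ev.facts (r + 1)).stack_le z
    -- A defect here would have to vanish in this very step. Struck after resting, it departs late;
    -- matched to the right, it has zero height on both sides and hence an empty stack; matched to
    -- the left, it belongs to a late run; just arrived, it found the stack empty. None leaves a
    -- stack.
    have hd : (u (r + 1)).defect z = false := by
      by_contra hd
      rw [Bool.not_eq_false] at hd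
      have hns : stays (u (r + 1)) z = false := by
        by_contra hc
        rw [Bool.not_eq_false] at hc
        have := ev.defect_of_stays hc
        simp [h2] at this
      rcases ev.defect_succ hd with h3 | h3
      · rcases kept_or_pairStart hd with h4 | h4 | h4
        · have h5 : hit (u (r + 1)) z = true := by simpa [stays, h4] using hns
          have := he r ⟨h3, Or.inl h5⟩
          omega
        · have e0 := (ev.inv (r + 1)).defect_height z hd
          have e1 := (ev.inv (r + 1)).defect_height (z + 1) (by
            simp only [pairStart, Bool.and_eq_true] at h4
            exact h4.2)
          have e2 := (ev.inv (r + 1)).balanced z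
          have e3 : (u (r + 1)).bwd z = false := by
            by_contra hc
            rw [Bool.not_eq_false] at hc
            simp [(ev.inv (r + 1)).bwd_defect z hc] at hd
          rw [add_sub_cancel_right] at e1
          simp only [charge, (ev.inv (r + 1)).defect_fwd z hd, (ev.inv (r + 1)).defect_anti z hd,
            e3, bit_false, e0, e1] at e2
          rw [emits, (kept_false_of_pairStart h4).1] at hle
          simp only [Bool.false_and, bit_false] at hle
          omega
        · have h5 : (u (r + 1)).defect (z - 1) = true := by
            simp only [pairStart, Bool.and_eq_true] at h4
            exact h4.1.2
          rcases ev.defect_succ h5 with h6 | h6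
          · have := ev.le_of_kept_of_kept hl (stays_kept h6)
              (by rw [sub_add_cancel]; exact stays_kept h3)
            omega
          · rw [sub_add_cancel, stays_hit h3] at h6
            simp at h6
      · have h4 := (ev.facts r).stack_arrive z h3
        rw [h4] at hle
        by_cases hk : kept (u (r + 1)).defect z
        · have h5 : hit (u (r + 1)) z = true := by simpa [stays, hk] using hns
          have := (ev.facts (r + 1)).stack_hit z h5
          omega
        · rw [Bool.not_eq_true] at hk
          simp only [emits, hk, Bool.false_and, bit_false] at hle
          omega
    refine ⟨?_, hd⟩
    rw [emits_of_defect_false hd] at hle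
    simp only [bit_false] at hle
    omega

end Left

end Evolution

end SignalRule

/-! ### Walls, and the drainage of the sites behind a blocking stack -/

namespace SignalRule

theorem exists_least_defect {D : ℤ → Bool} {z y : ℤ} (hz : z < y) (hy : D y) :
    ∃ y₀, z < y₀ ∧ y₀ ≤ y ∧ D y₀ = true ∧ ∀ x, z < x → x < y₀ → D x = false := by
  obtain ⟨y₀, ⟨h1, h2⟩, h3⟩ := Int.exists_least_of_bdd (P := fun x => z < x ∧ D x = true)
    ⟨z, fun x hx => hx.1.le⟩ ⟨y, hz, hy⟩
  refine ⟨y₀, h1, h3 y ⟨hz, hy⟩, h2, fun x h4 h5 => ?_⟩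
  by_contra hc
  rw [Bool.not_eq_false] at hc
  have := h3 x ⟨h4, hc⟩
  omega

/-- No defects and no forward-signals lie between `z` and `w`, and no signals pass `w`. -/
structure Wall (u : Config ℤ) (h : ℤ → ℤ) (z w : ℤ) : Prop where
  lt : z < w
  height : h w = 0
  defect : ∀ x, z < x → x ≤ w → u.defect x = false
  fwd : ∀ x, z < x → x ≤ w → u.fwd x = false

theorem Wall.sent {u : Config ℤ} {h : ℤ → ℤ} {z w : ℤ} (hw : Wall u h z w) :
    sent u w = false := by
  rw [sent_of_not_defect (hw.defect w hw.lt le_rfl), hw.fwd w hw.lt le_rfl]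

namespace Evolution

variable {u : ℕ → Config ℤ} {H : ℕ → ℤ → ℤ} (ev : Evolution u H)
include ev

theorem wall_succ {t : ℕ} {z w : ℤ} (hw : Wall (u t) (H t) z w)
    (hb : (u (t + 1)).fwd (z + 1) = false) : Wall (u (t + 1)) (H (t + 1)) z w := by
  have hs := hw.sent
  refine ⟨hw.lt, ?_, fun x h1 h2 => ?_, fun x h1 h2 => ?_⟩
  · have := (ev.facts t).height_le w
    rw [hw.height, hs] at this
    exact le_antisymm this ((ev.inv (t + 1)).nonneg w)
  · refine ev.defect_succ_eq_false (stays_of_defect_false (hw.defect x h1 h2)) ?_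
    rcases eq_or_lt_of_le h2 with rfl | h2
    · simp [hit, hs]
    · exact hit_of_defect_false (hw.defect (x + 1) (by omega) (by omega))
  · by_contra hc
    rw [Bool.not_eq_false] at hc
    by_cases hx : x = z + 1
    · rw [hx, hb] at hc
      simp at hc
    rcases (ev.facts t).fwd_source x hc with h | h
    · rw [hw.fwd (x - 1) (by omega) (by omega)] at h
      simp at h
    · rw [stays_of_defect_false (hw.defect (x - 1) (by omega) (by omega))] at h
      simp at h

/-- Without defects there is no reflection between `z` and `w`, and the zero height at `w` stops
whatever would enter across it. So each backward-signal was three sites further right, inside the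
region. -/
theorem wall_bwd {t : ℕ} {z w : ℤ} (hw : Wall (u t) (H t) z w) {x : ℤ} (hx : z < x) (hxw : x ≤ w)
    (hb : (u (t + 1)).bwd x) : x + 3 ≤ w ∧ (u t).bwd (x + 3) = true := by
  obtain ⟨h1, h2, h3, h4⟩ := (ev.facts t).bwd_source x hb
  have g : ∀ y, 1 ≤ H t y + bit (sent (u t) y) → y ≠ w := by
    rintro y hy rfl
    rw [hw.height, hw.sent] at hy
    simp at hy
  have g1 := g _ h2
  have g2 := g _ h3
  have g3 := g _ h4
  refine ⟨by omega, h1.resolve_right ?_⟩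
  rintro ⟨_, h | h⟩
  · rw [hit_of_defect_false (hw.defect (x + 3) (by omega) (by omega))] at h
    simp at h
  · by_cases hw' : x + 3 = w
    · rw [show x + 4 = w + 1 by omega] at h
      simp [hit, hw.sent] at h
    · rw [hit_of_defect_false (hw.defect (x + 4) (by omega) (by omega))] at h
      simp at h

theorem height_mono_of_no_signals {t : ℕ} {z w : ℤ} (hzw : z ≤ w)
    (hF : ∀ x, z < x → x ≤ w → (u t).fwd x = false)
    (hB : ∀ x, z < x → x ≤ w → (u t).bwd x = false) : H t z ≤ H t w := by
  obtain ⟨n, rfl⟩ := Int.le.dest hzw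
  induction n with
  | zero => simp
  | succ n ih =>
    have h1 := ih (by omega) (fun x h1 h2 => hF x h1 (by push_cast; omega))
      (fun x h1 h2 => hB x h1 (by push_cast; omega))
    have h2 := (ev.inv t).balanced (z + (n + 1 : ℕ))
    simp only [charge, hF _ (show z < z + (n + 1 : ℕ) by push_cast; omega) le_rfl,
      hB _ (show z < z + (n + 1 : ℕ) by push_cast; omega) le_rfl, bit_false] at h2
    rw [show z + ((n + 1 : ℕ) : ℤ) - 1 = z + n by push_cast; ring] at h2
    have := bit_nonneg ((u t).anti (z + (n + 1 : ℕ)))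
    omega

section Blocked

variable {z : ℤ} {T₀ T : ℕ} (h0 : 1 ≤ T₀)
  (hb : ∀ t, T₀ ≤ t → t ≤ T → 0 < (u t).stack z ∧ (u t).defect z = false)
include hb

/-- At height zero a nonempty stack can only be balanced by one forward-signal: it holds one entry
and there is no anti-signal. That entry is then sent off, so the stack is empty at the next time. -/
theorem not_height_le_zero_of_blocked {t : ℕ} (h1 : T₀ ≤ t) (h2 : t + 1 ≤ T)
    (h3 : H t z ≤ 0) : False := by
  have e := (ev.inv t).balanced z
  have e0 := (ev.inv t).nonneg (z - 1)
  obtain ⟨b1, b2⟩ := hb t h1 (by omega)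
  obtain ⟨b3, b4⟩ := hb (t + 1) (by omega) h2
  have e1 : (u t).bwd z = false := by
    by_contra hc
    rw [Bool.not_eq_false] at hc
    have := (ev.inv t).bwd_stack z hc
    omega
  have e2 : bit ((u t).fwd z) ≤ 1 := by cases (u t).fwd z <;> simp
  have e3 : (u t).anti z = false := by
    by_contra hc
    rw [Bool.not_eq_false] at hc
    simp only [charge, e1, hc, bit_false, bit_true] at e
    omega
  simp only [charge, e1, e3, bit_false] at e
  have := (ev.facts t).stack_send z b4 b2 e3
  omega

include h0

theorem fwd_of_blocked {t : ℕ} (h1 : T₀ ≤ t) (h2 : t ≤ T) : (u t).fwd (z + 1) = false := by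
  obtain ⟨r, rfl⟩ : ∃ r, t = r + 1 := ⟨t - 1, by omega⟩
  obtain ⟨b1, b2⟩ := hb (r + 1) h1 h2
  exact (ev.facts r).block z b2 b1

/-- In `k` steps the backward-signals move `3 * k` sites left and vacate the region. With no
negative charges left between `z` and `w`, the height at `z` is at most that at `w`, which is zero.
-/
theorem false_of_wall {t k : ℕ} {w : ℤ} (h1 : T₀ ≤ t) (h2 : t + k + 1 ≤ T)
    (hw : Wall (u t) (H t) z w) (hk : w - z ≤ 3 * k) : False := by
  have key : ∀ j, t + j ≤ T → Wall (u (t + j)) (H (t + j)) z w ∧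
      ∀ x, z < x → x ≤ w → (u (t + j)).bwd x → x + 3 * j ≤ w := by
    intro j
    induction j with
    | zero => intro _; exact ⟨hw, fun x _ h2 _ => by simpa using h2⟩
    | succ j ih =>
      intro hj
      obtain ⟨i1, i2⟩ := ih (by omega)
      refine ⟨ev.wall_succ i1 (ev.fwd_of_blocked h0 hb (t := t + (j + 1)) (by omega) hj), fun x hx hxw hB => ?_⟩
      obtain ⟨h3, h4⟩ := ev.wall_bwd i1 hx hxw hB
      have := i2 (x + 3) (by omega) h3 h4
      push_cast
      omega
  obtain ⟨k1, k2⟩ := key k (by omega)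
  refine ev.not_height_le_zero_of_blocked hb (t := t + k) (by omega) (by omega) ?_
  rw [← k1.height]
  refine ev.height_mono_of_no_signals k1.lt.le k1.fwd fun x hx hxw => ?_
  by_contra hc
  rw [Bool.not_eq_false] at hc
  have := k2 x hx hxw hc
  omega

/-- As long as a site with a nonempty stack blocks all forward-signals, the region where every
forward-signal is behind a defect grows, unless a wall appears. -/
theorem front_or_wall (j : ℕ) (hj : T₀ + j ≤ T) :
    (∃ i : ℕ, ∃ w, i ≤ j ∧ Wall (u (T₀ + i)) (H (T₀ + i)) z w ∧ w < z + i) ∨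
    ∀ x, z < x → x ≤ z + j → (u (T₀ + j)).fwd x →
      ∃ y, z < y ∧ y < x ∧ (u (T₀ + j)).defect y = true := by
  induction j with
  | zero =>
    refine Or.inr fun x h1 h2 => ?_
    push_cast at h2
    omega
  | succ j ih =>
    rcases ih (by omega) with ⟨i, w, h1, h2⟩ | hF
    · exact Or.inl ⟨i, w, by omega, h2⟩
    by_cases hex : ∃ y, z < y ∧ y ≤ z + j ∧ (u (T₀ + j)).defect y = true
    · obtain ⟨y, hy1, hy2, hy3⟩ := hex
      obtain ⟨y₀, h1, h2, h3, h4⟩ := exists_least_defect hy1 hy3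
      have hFy : ∀ x, z < x → x ≤ y₀ → (u (T₀ + j)).fwd x = false := by
        intro x hx hxy
        by_contra hc
        rw [Bool.not_eq_false] at hc
        obtain ⟨y', h5, h6, h7⟩ := hF x hx (by omega) hc
        rw [h4 y' h5 (by omega)] at h7
        simp at h7
      have hz := (hb (T₀ + j) (by omega) (by omega)).2
      have hz' := (hb (T₀ + j + 1) (by omega) hj).2
      have hpre : (u (T₀ + j)).defect (y₀ - 1) = false := by
        by_cases h5 : y₀ - 1 = z
        · rw [h5]; exact hz
        · exact h4 _ (by omega) (by omega)
      have hnh : hit (u (T₀ + j)) y₀ = false := by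
        by_contra hc
        rw [Bool.not_eq_false] at hc
        by_cases h5 : y₀ - 1 = z
        · have := ev.defect_of_hit (x := z) (by rw [← h5, sub_add_cancel]; exact hc)
          rw [hz'] at this
          simp at this
        · have := hit_fwd hc
          rw [hFy _ (by omega) (by omega)] at this
          simp at this
      by_cases hk : kept (u (T₀ + j)).defect y₀
      · by_cases hle : y₀ ≤ z + j
        · refine Or.inr fun x hx hxj hf => ⟨y₀, h1, ?_, ev.defect_of_stays (stays_of_kept hk hnh)⟩
          by_contra hxy
          by_cases hx1 : x = z + 1
          · rw [hx1, ev.fwd_of_blocked h0 hb (t := T₀ + (j + 1)) (by omega) hj] at hf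
            simp at hf
          rcases (ev.facts (T₀ + j)).fwd_source x hf with h5 | h5
          · rw [hFy _ (by omega) (by omega)] at h5
            simp at h5
          · rw [stays_of_defect_false (h4 _ (by omega) (by omega))] at h5
            simp at h5
        · omega
      · rw [Bool.not_eq_true] at hk
        -- The first defect disappears only by being matched with its right neighbour. The height
        -- between the two is zero, so the vanished pair leaves a wall at `y₀`.
        have hp : pairStart (u (T₀ + j)).defect y₀ = true := by
          rcases kept_or_pairStart h3 with h5 | h5 | h5
          · simp [hk] at h5
          · exact h5
          · simp [pairStart, hpre] at h5
        have hsy : sent (u (T₀ + j)) y₀ = false := by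
          simp [sent, emits, hk, hFy y₀ h1 le_rfl]
        have hH : H (T₀ + j) y₀ = 0 := by
          have := (ev.inv (T₀ + j)).defect_height (y₀ + 1) (by
            simp only [pairStart, Bool.and_eq_true] at hp
            exact hp.2)
          rwa [add_sub_cancel_right] at this
        refine Or.inl ⟨j + 1, y₀, le_rfl, ⟨h1, ?_, fun x hx hxy => ?_, fun x hx hxy => ?_⟩, by
          push_cast; omega⟩
        · have := (ev.facts (T₀ + j)).height_le y₀
          rw [hH, hsy] at this
          exact le_antisymm this ((ev.inv _).nonneg y₀)
        · rcases eq_or_lt_of_le hxy with rfl | hxy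
          · exact ev.defect_succ_eq_false (by simp [stays, hk]) (by simp [hit, hsy])
          · refine ev.defect_succ_eq_false (stays_of_defect_false (h4 x hx hxy)) ?_
            rcases eq_or_lt_of_le (Int.add_one_le_of_lt hxy) with h5 | h5
            · rw [h5]; exact hnh
            · exact hit_of_defect_false (h4 _ (by omega) h5)
        · by_contra hf
          rw [Bool.not_eq_false] at hf
          by_cases hx1 : x = z + 1
          · rw [hx1, ev.fwd_of_blocked h0 hb (t := T₀ + (j + 1)) (by omega) hj] at hf
            simp at hf
          rcases (ev.facts (T₀ + j)).fwd_source x hf with h5 | h5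
          · rw [hFy _ (by omega) (by omega)] at h5
            simp at h5
          · rw [stays_of_defect_false (h4 _ (by omega) (by omega))] at h5
            simp at h5
    · refine Or.inr fun x hx hxj hf => ?_
      push_cast at hxj
      by_cases hx1 : x = z + 1
      · rw [hx1, ev.fwd_of_blocked h0 hb (t := T₀ + (j + 1)) (by omega) hj] at hf
        simp at hf
      exfalso
      rcases (ev.facts (T₀ + j)).fwd_source x hf with h5 | h5
      · obtain ⟨y, h6, h7, h8⟩ := hF (x - 1) (by omega) (by omega) h5
        exact hex ⟨y, h6, by omega, h8⟩
      · exact hex ⟨x - 1, by omega, by omega, stays_defect h5⟩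

/-- A defect on the right of a blocking site cannot outlive the block for long. -/
theorem false_of_blocked {m : ℕ} (hm : 2 ≤ m) (hT : T₀ + 2 * m ≤ T)
    (hq : (u (T + (m - 1))).defect (z + m)) : False := by
  -- The block lasts `2 * m` steps: up to `m` for the front to cross the `m` sites, and the rest, at
  -- least `m - 1` for speed 3 and one for the stack to empty, to drain behind a wall.
  rcases ev.front_or_wall h0 hb m (by omega) with ⟨i, w, h1, h2, h3⟩ | hF
  · exact ev.false_of_wall h0 hb (t := T₀ + i) (k := m - 1) (by omega) (by omega) h2 (by omega)
  by_cases hex : ∃ y, z < y ∧ y ≤ z + m ∧ (u (T₀ + m)).defect y = true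
  · obtain ⟨y, hy1, hy2, hy3⟩ := hex
    obtain ⟨y₀, h1, h2, h3, h4⟩ := exists_least_defect hy1 hy3
    have hH := (ev.inv (T₀ + m)).defect_height y₀ h3
    by_cases h5 : y₀ - 1 = z
    · rw [h5] at hH
      exact ev.not_height_le_zero_of_blocked hb (t := T₀ + m) (by omega) (by omega) hH.le
    · refine ev.false_of_wall h0 hb (t := T₀ + m) (k := m - 1) (w := y₀ - 1) (by omega)
        (by omega) ⟨by omega, hH, fun x hx hxy => h4 x hx (by omega), fun x hx hxy => ?_⟩ (by omega)
      by_contra hc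
      rw [Bool.not_eq_false] at hc
      obtain ⟨y', h5, h6, h7⟩ := hF x hx (by omega) hc
      rw [h4 y' h5 (by omega)] at h7
      simp at h7
  -- The region now holds neither defects nor forward-signals. It stays so during the block and
  -- afterwards erodes from the left by one site per step, which is too slow for a defect at `z + m`
  -- at time `T + (m - 1)`.
  · have hcl : ∀ j : ℕ, ∀ x, z < x → z + j - (T - (T₀ + m) : ℕ) < x → x ≤ z + m →
        (u (T₀ + m + j)).defect x = false ∧ (u (T₀ + m + j)).fwd x = false := by
      intro j
      induction j with
      | zero =>
        intro x hx _ hxq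
        refine ⟨?_, ?_⟩
        · by_contra hc
          rw [Bool.not_eq_false] at hc
          exact hex ⟨x, hx, hxq, hc⟩
        · by_contra hc
          rw [Bool.not_eq_false] at hc
          obtain ⟨y', h5, h6, h7⟩ := hF x hx hxq hc
          exact hex ⟨y', h5, by omega, h7⟩
      | succ j ih =>
        intro x hx hxj hxq
        push_cast at hxj
        refine ⟨?_, ?_⟩
        · refine ev.defect_succ_eq_false
            (stays_of_defect_false (ih x hx (by omega) hxq).1) ?_
          rcases eq_or_lt_of_le hxq with rfl | hxq
          · obtain ⟨i1, i2⟩ := ih (z + m) hx (by omega) le_rfl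
            simp [hit, sent_of_not_defect i1, i2]
          · exact hit_of_defect_false (ih (x + 1) (by omega) (by omega) (by omega)).1
        · by_contra hf
          rw [Bool.not_eq_false] at hf
          have hxz : z < x - 1 := by
            by_contra hc
            obtain rfl : x = z + 1 := by omega
            rw [ev.fwd_of_blocked h0 hb (by omega) (by omega)] at hf
            simp at hf
          obtain ⟨i1, i2⟩ := ih (x - 1) hxz (by omega) (by omega)
          rcases (ev.facts (T₀ + m + j)).fwd_source x hf with h5 | h5
          · simp [i2] at h5
          · simp [stays_of_defect_false i1] at h5
    have := (hcl (T - (T₀ + m) + (m - 1)) (z + m) (by omega) (by omega) le_rfl).1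
    rw [show T₀ + m + (T - (T₀ + m) + (m - 1)) = T + (m - 1) by omega, hq] at this
    simp at this

end Blocked

end Evolution

end SignalRule

/-! ### Induction on the distance to the left end: no late arrivals or departures -/

namespace SignalRule

namespace Evolution

variable {u : ℕ → Config ℤ} {H : ℕ → ℤ → ℤ} (ev : Evolution u H)
variable {a : ℤ} (hl : ∀ t x, x < a → Clear (u t) (H t) x)
include ev hl

/-- Two resting defects with no moving defects on the way between them cannot persist. -/
theorem false_of_two_stays {s q : ℤ} {v N : ℕ} (ih : ∀ z < q, SettlesEarly u a z)
    (hsq : q = s + N + 1) (hs : stays (u v) s) (hv : 3 * (s - a) < v) (hq : stays (u (v + N)) q)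
    (hlate : 3 * (q - a) < v + N)
    (hN : ∀ i < N, hit (u (v + i)) (s + i + 1) = false ∧ hit (u (v + i)) (s + i + 2) = false) :
    False := by
  have ha := le_of_defect hl (stays_defect hs)
  have hse := stays_sent hq
  rw [show q - 1 = s + N by omega] at hse
  rcases ev.ray hl (ih s (by omega)) hv hs N hN with ⟨i, h1, h2, h3, h4⟩ | ⟨_, h, _⟩
  -- Right next to `q` the height is zero, which leaves no negative charge to balance the stack that
  -- stopped the ray.
  · by_cases hi : i = N
    · subst hi
      have e := (ev.inv (v + i)).balanced (s + i)
      have e0 := (ev.inv (v + i)).nonneg (s + i - 1)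
      have e1 := (ev.inv (v + i)).defect_height q (stays_defect hq)
      rw [show q - 1 = s + i by omega] at e1
      rw [sent_of_not_defect h4] at hse
      have e2 : (u (v + i)).bwd (s + i) = false := by
        by_contra hc
        rw [Bool.not_eq_false] at hc
        have := (ev.inv (v + i)).bwd_stack _ hc
        omega
      simp only [charge, e1, e2, hse, bit_false] at e
      have := bit_nonneg ((u (v + i)).anti (s + i))
      omega
    -- The stack has been there since time `3 * (k + i) + 2`. The requirement that the block last `2
    -- * m` steps then rearranges to exactly `3 * (q - a) < v + N`; this is where the slope 3 comes
    -- from.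
    · obtain ⟨k, hk⟩ := Int.le.dest ha
      refine ev.false_of_blocked (z := s + i) (T₀ := 3 * (k + i) + 2) (T := v + i)
        (m := N + 1 - i) (by omega) (fun t ht1 ht2 => ?_) (by omega) (by omega) ?_
      · have := ev.stack_pos_of_stack_pos hl (ih (s + i) (by omega)) h3 h4 (v + i - t) (by omega)
          (by omega)
        rwa [show v + i - (v + i - t) = t by omega] at this
      · rw [show v + i + (N + 1 - i - 1) = v + N by omega,
          show s + i + ((N + 1 - i : ℕ) : ℤ) = q by omega]
        exact stays_defect hq
  · rw [h] at hse
    simp at hse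

theorem not_late_departure {q : ℤ} (ih : ∀ z < q, SettlesEarly u a z) {t : ℕ}
    (ht : 3 * (q - a) < t) (hs : stays (u t) q) (hh : hit (u (t + 1)) q) : False := by
  obtain ⟨n, w, h1, h2, h3, h4⟩ := ev.fwd_trace (hit_fwd hh)
  have ha := le_of_defect hl (stays_defect h3)
  generalize hsq : q - 1 - n = s at *
  obtain ⟨v, rfl⟩ : ∃ v, w = v + 1 := ⟨w - 1, by omega⟩
  -- The emitter already rested one step earlier, so a ray emitted at `v` runs one step ahead of the
  -- signal that strikes `q` and reaches `q - 1` while `q` still rests. A defect moving onto that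
  -- ray would have obstructed the traced signal.
  have hv : stays (u v) s = true := ev.stays_pred (ih s (by omega)) (by omega) h3
  refine ev.false_of_two_stays hl (s := s) (v := v) (N := n) ih (by omega) hv (by omega)
    (by rw [show v + n = t by omega]; exact hs) (by omega) fun i hi => ⟨?_, ?_⟩
  · by_contra hc
    rw [Bool.not_eq_false] at hc
    rcases Nat.eq_zero_or_pos i with rfl | hi'
    · have := kept_false_of_hit_succ (ev.inv _).defect_fwd hc
      simp [stays_kept hv] at this
    · have e1 := ev.defect_of_hit hc
      have e2 := ev.not_defect_of_fwd (h4 i hi' hi.le)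
      rw [show v + 1 + i = v + i + 1 by omega, e1] at e2
      simp at e2
  · by_contra hc
    rw [Bool.not_eq_false] at hc
    rw [show s + i + 2 = s + i + 1 + 1 by ring] at hc
    have e1 := ev.defect_of_hit hc
    have e2 := ev.not_defect_of_hit hc
    have e3 := h4 (i + 1) (by omega) hi
    rw [show v + 1 + (i + 1) = v + i + 1 + 1 by omega,
      show s + ((i + 1 : ℕ) : ℤ) = s + i + 1 by push_cast; ring] at e3
    obtain ⟨e4, e5, -⟩ := (ev.facts (v + i + 1)).fwd_sent _ e3
    have hp : pairStart (u (v + i + 1)).defect (s + i) = false := by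
      rcases Nat.eq_zero_or_pos i with rfl | hi'
      · simpa using (kept_pairStart (stays_kept h3)).1
      · have := ev.not_defect_of_fwd (h4 i hi' hi.le)
        rw [show v + 1 + i = v + i + 1 by omega] at this
        simp [pairStart, this]
    rcases kept_or_pairStart e1 with h | h | h
    · rw [hit, h, e4] at e5
      simp at e5
    · simp [pairStart, e2] at h
    · simp [hp] at h

/-- The signal that pulled the defect to `q` left a defect-free trail. Its emitter therefore goes on
resting, and a ray emitted two steps later runs along the trail and reaches `q - 1` just when `q` is
at rest. -/
theorem not_late_arrival {q : ℤ} (ih : ∀ z < q, SettlesEarly u a z) {t : ℕ}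
    (ht : 3 * (q - a) < t + 1) (hs : stays (u (t + 1)) q) (hh : hit (u t) (q + 1)) : False := by
  have hF := hit_fwd hh
  rw [add_sub_cancel_right] at hF
  obtain ⟨n, w, h1, h2, h3, h4⟩ := ev.fwd_trace hF
  have ha := le_of_defect hl (stays_defect h3)
  generalize hsq : q - n = s at *
  have he := ih s (by omega)
  have hD : ∀ j : ℕ, 1 ≤ j → j ≤ n → ∀ x, s < x → x ≤ s + j →
      (u (w + j)).defect x = false := by
    intro j hj
    induction j, hj using Nat.le_induction with
    | base =>
      intro hn x hx hx'
      obtain rfl : x = s + (1 : ℕ) := by push_cast at *; omega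
      exact ev.not_defect_of_fwd (h4 1 le_rfl hn)
    | succ j hj ihj =>
      intro hn x hx hx'
      push_cast at hx'
      have hf := h4 (j + 1) (by omega) hn
      rcases eq_or_lt_of_le hx' with rfl | hx'
      · have := ev.not_defect_of_fwd hf
        rwa [show s + ((j + 1 : ℕ) : ℤ) = s + (j + 1) by push_cast; ring] at this
      refine ev.defect_succ_eq_false (stays_of_defect_false (ihj (by omega) x hx (by omega))) ?_
      rcases eq_or_lt_of_le (Int.add_one_le_of_lt hx') with h5 | h5
      · have := ((ev.facts (w + j)).fwd_sent _ hf).2.1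
        rw [h5]
        rwa [show s + ((j + 1 : ℕ) : ℤ) = s + (j + 1) by push_cast; ring] at this
      · exact hit_of_defect_false (ihj (by omega) _ (by omega) (by omega))
  have hs1 : stays (u (w + 1)) s = true :=
    ev.stays_succ hl he (by omega) h3 (hD 1 le_rfl h2 _ (by omega) (by push_cast; omega))
  -- Here emitter and arrival are neighbours. They escape matching only as part of a longer run, and
  -- no such run exists this late.
  by_cases hn : n = 1
  · subst hn
    have hq : s = q - 1 := by push_cast at hsq; omega
    have hp := (kept_pairStart (stays_kept hs)).2
    have hd : (u (t + 1)).defect (q - 1) = true := by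
      rw [← hq, h1]
      exact ev.defect_of_stays hs1
    have hd' : (u (t + 1)).defect (q - 1 - 1) = true := by
      simpa [pairStart, hd, stays_defect hs] using hp
    rcases ev.defect_succ hd' with h5 | h5
    · have := ev.le_of_kept_of_kept hl (stays_kept h5)
        (by rw [sub_add_cancel, ← hq, h1]; exact stays_kept hs1)
      omega
    · rw [sub_add_cancel, ← hq, h1, stays_hit hs1] at h5
      simp at h5
  · have hs2 : stays (u (w + 2)) s = true :=
      ev.stays_succ hl he (by push_cast; omega) hs1
        (hD 2 (by omega) (by omega) _ (by omega) (by push_cast; omega))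
    refine ev.false_of_two_stays hl (s := s) (v := w + 2) (N := n - 1) ih (by omega) hs2
      (by push_cast; omega) (by rw [show w + 2 + (n - 1) = t + 1 by omega]; exact hs)
      (by push_cast; omega) fun i hi => ⟨?_, ?_⟩
    · have := hD (2 + i) (by omega) (by omega) (s + i + 1) (by omega) (by push_cast; omega)
      rw [← add_assoc] at this
      exact hit_of_defect_false this
    · have := hD (2 + i) (by omega) (by omega) (s + i + 2) (by omega) (by push_cast; omega)
      rw [← add_assoc] at this
      exact hit_of_defect_false this

theorem settlesEarly (q : ℤ) : SettlesEarly u a q := by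
  have key : ∀ n : ℕ, ∀ q, q < a + n → SettlesEarly u a q := by
    intro n
    induction n with
    | zero =>
      intro q hq t ht
      have := le_of_defect hl (stays_defect ht.1)
      push_cast at hq
      omega
    | succ n ih =>
      intro q hq t ht
      push_cast at hq
      have ihq : ∀ z < q, SettlesEarly u a z := fun z hz => ih z (by omega)
      by_contra hc
      obtain ⟨h1, h2 | ⟨s, rfl, h2⟩⟩ := ht
      · exact ev.not_late_departure hl ihq (by omega) h1 h2
      · exact ev.not_late_arrival hl ihq (by push_cast at hc; omega) h1 h2
  exact key ((q - a).toNat + 1) q (by push_cast; omega)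

end Evolution

end SignalRule

namespace SignalRule

/-! ### Finite errors are corrected in linear time -/

theorem eq_false_of_syndrome {E : ℤ → Bool} {c p : ℤ} (hc : E c = false)
    (hs : ∀ x, c < x → x < p → syndrome E x = false) {x : ℤ} (h1 : c ≤ x) (h2 : x < p) :
    E x = false := by
  obtain ⟨n, rfl⟩ := Int.le.dest h1
  induction n with
  | zero => simpa using hc
  | succ n ih =>
    push_cast at h2
    have h3 := ih (by omega) (by omega)
    have h4 := hs (c + (n + 1 : ℕ)) (by push_cast; omega) (by push_cast; omega)
    rw [syndrome, show c + ((n + 1 : ℕ) : ℤ) - 1 = c + n by push_cast; ring, h3] at h4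
    simpa using h4

theorem Evolution.height_le_time {u : ℕ → Config ℤ} {H : ℕ → ℤ → ℤ} (ev : Evolution u H) (t : ℕ)
    (x : ℤ) : H t x ≤ t := by
  induction t with
  | zero => simp [ev.height_zero]
  | succ t ih =>
    have h1 := (ev.facts t).height_le x
    have h2 : bit (sent (u t) x) ≤ 1 := by cases sent (u t) x <;> simp
    push_cast
    omega

section Finite

variable {E : ℤ → Bool} {a : ℤ} {d : ℕ} (hE : ∀ x, E x → a ≤ x ∧ x < a + d)
include hE

theorem quiet_left {x : ℤ} (hx : x < a) (t : ℕ) : Quiet (run 3 3 E t) x := by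
  refine quiet_window E (p := x - 1 - t) (q := a - 1) (fun y _ h2 => ?_) t (by omega) (by omega)
  by_contra hc
  rw [Bool.not_eq_false] at hc
  have := hE y hc
  omega

theorem quiet_right {x : ℤ} {t : ℕ} (hx : a + d + 1 + t ≤ x) : Quiet (run 3 3 E t) x := by
  refine quiet_window E (p := a + d) (q := x) (fun y h1 _ => ?_) t (by omega) le_rfl
  by_contra hc
  rw [Bool.not_eq_false] at hc
  have := hE y hc
  omega

section Evolution

variable {H : ℕ → ℤ → ℤ} (ev : Evolution (fun t => (run 3 3 E t).1) H)
include ev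

theorem clear_left (t : ℕ) {x : ℤ} (hx : x < a) : Clear (run 3 3 E t).1 (H t) x := by
  refine ev.clear_window (p := x - t) (q := a - 1) (fun y _ h2 => ?_) t x (by omega) (by omega)
  have h : ∀ z, z < a → E z = false := fun z hz => by
    by_contra hc
    rw [Bool.not_eq_false] at hc
    have := hE z hc
    omega
  change syndrome E y = false
  simp [syndrome, h y (by omega), h (y - 1) (by omega)]

/-- Defects, stacks and backward-signals never move to the right. -/
theorem right_bound (t : ℕ) : ∀ x, a + d < x → (run 3 3 E t).1.defect x = false ∧
    (run 3 3 E t).1.bwd x = false ∧ (run 3 3 E t).1.stack x = 0 := by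
  induction t with
  | zero =>
    intro x hx
    have h : ∀ z, a + d ≤ z → E z = false := fun z hz => by
      by_contra hc
      rw [Bool.not_eq_false] at hc
      have := hE z hc
      omega
    refine ⟨?_, rfl, rfl⟩
    change syndrome E x = false
    simp [syndrome, h x (by omega), h (x - 1) (by omega)]
  | succ t ih =>
    intro x hx
    refine ⟨ev.defect_succ_eq_false (stays_of_defect_false (ih x hx).1)
      (hit_of_defect_false (ih (x + 1) (by omega)).1), ?_, ?_⟩
    · by_contra hc
      rw [Bool.not_eq_false] at hc
      rcases ((ev.facts t).bwd_source x hc).1 with h | ⟨-, h | h⟩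
      · have h' : (run 3 3 E t).1.bwd (x + 3) = true := h
        simp [(ih (x + 3) (by omega)).2.1] at h'
      · simp [hit_of_defect_false (ih (x + 3) (by omega)).1] at h
      · simp [hit_of_defect_false (ih (x + 4) (by omega)).1] at h
    · have := (ev.facts t).stack_le x
      rw [emits_of_defect_false (ih x hx).1] at this
      simp only [(ih x hx).2.2, bit_false] at this
      simpa using this

theorem defect_range {t : ℕ} {x : ℤ} (hx : (run 3 3 E t).1.defect x) : a ≤ x ∧ x ≤ a + d := by
  refine ⟨?_, ?_⟩
  · by_contra hc
    rw [(clear_left hE ev t (by omega)).defect] at hx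
    simp at hx
  · by_contra hc
    rw [(right_bound hE ev t x (by omega)).1] at hx
    simp at hx

/-- Trace a struck defect back in time. If it had rested just before, this would be a late
departure, so it was itself arriving from the right. Each step back moves it one site to the right,
and `d + 1` steps leave the range of the defects. -/
theorem not_hit_late {t : ℕ} (ht : 4 * d + 2 ≤ t) (x : ℤ) : hit (run 3 3 E t).1 x = false := by
  by_contra hc
  rw [Bool.not_eq_false] at hc
  have key : ∀ j : ℕ, 3 * d + 1 + j ≤ t → hit (run 3 3 E (t - j)).1 (x + j) = true := by
    intro j
    induction j with
    | zero => intro _; simpa using hc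
    | succ j ih =>
      intro hj
      have h1 := ih (by omega)
      obtain ⟨r, hr⟩ : ∃ r, t - j = r + 1 := ⟨t - j - 1, by omega⟩
      rw [show t - (j + 1) = r by omega]
      rw [hr] at h1
      have hd := defect_range hE ev (hit_defect h1)
      rcases ev.defect_succ (hit_defect h1) with h2 | h2
      · have := ev.settlesEarly (a := a) (fun t x => clear_left hE ev t) _ r ⟨h2, Or.inl h1⟩
        omega
      · rw [show x + ((j + 1 : ℕ) : ℤ) = x + j + 1 by push_cast; ring]
        exact h2
  have h1 := defect_range hE ev (hit_defect (key (d + 1) (by omega)))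
  have h2 := defect_range hE ev (hit_defect hc)
  push_cast at h1
  omega

theorem stays_late {t : ℕ} (ht : 4 * d + 3 ≤ t) {x : ℤ} (hx : (run 3 3 E t).1.defect x) :
    stays (run 3 3 E t).1 x = true := by
  obtain ⟨r, rfl⟩ : ∃ r, t = r + 1 := ⟨t - 1, by omega⟩
  have key : ∀ y, (run 3 3 E (r + 1)).1.defect y → kept (run 3 3 E r).1.defect y = true := by
    intro y hy
    rcases ev.defect_succ hy with h | h
    · exact stays_kept h
    · rw [not_hit_late hE ev (by omega)] at h
      simp at h
  have adj : ∀ y, (run 3 3 E (r + 1)).1.defect y → (run 3 3 E (r + 1)).1.defect (y + 1) →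
      False := by
    intro y h1 h2
    have h3 := ev.le_of_kept_of_kept (a := a) (fun t x => clear_left hE ev t) (key y h1)
      (key (y + 1) h2)
    have h4 := defect_range hE ev h1
    omega
  refine stays_of_kept ?_ (not_hit_late hE ev (by omega) x)
  rcases kept_or_pairStart hx with h | h | h
  · exact h
  · simp only [pairStart, Bool.and_eq_true] at h
    exact (adj x h.1.2 h.2).elim
  · simp only [pairStart, Bool.and_eq_true] at h
    exact (adj (x - 1) h.1.2 h.2).elim

theorem defect_persists {t : ℕ} (ht : 4 * d + 3 ≤ t) {x : ℤ} (hx : (run 3 3 E t).1.defect x)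
    (j : ℕ) : (run 3 3 E (t + j)).1.defect x = true := by
  induction j with
  | zero => exact hx
  | succ j ih => exact ev.defect_of_stays (stays_late hE ev (t := t + j) (by omega) ih)

theorem not_two_defects_late {t : ℕ} (ht : 4 * d + 3 ≤ t) {x y : ℤ} (hxy : x < y)
    (hx : (run 3 3 E t).1.defect x) (hy : (run 3 3 E t).1.defect y) : False := by
  have h1 := defect_range hE ev hx
  have h2 := defect_range hE ev hy
  have hl : ∀ t x, x < a → Clear (run 3 3 E t).1 (H t) x := fun t x => clear_left hE ev t
  refine ev.false_of_two_stays hl (s := x) (q := y) (v := t) (N := (y - x - 1).toNat)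
    (fun z _ => ev.settlesEarly hl z) (by omega) (stays_late hE ev ht hx) (by omega)
    (stays_late hE ev (by omega) (defect_persists hE ev ht hy _)) (by omega) fun i _ =>
    ⟨not_hit_late hE ev (by omega) _, not_hit_late hE ev (by omega) _⟩

/-- Two late defects are excluded, and a lone one would be the boundary of an error extending over
all sites to its right, beyond the light cone. -/
theorem defect_late {t : ℕ} (ht : 4 * d + 3 ≤ t) (x : ℤ) :
    (run 3 3 E t).1.defect x = false := by
  by_contra hx
  rw [Bool.not_eq_false] at hx
  have hr := defect_range hE ev hx
  have huniq : ∀ y, y ≠ x → syndrome (run 3 3 E t).2 y = false := by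
    intro y hy
    rw [← defect_eq_syndrome]
    by_contra hc
    rw [Bool.not_eq_false] at hc
    rcases lt_or_gt_of_ne hy with h | h
    · exact not_two_defects_late hE ev ht h hc hx
    · exact not_two_defects_late hE ev ht h hx hc
  have h1 : (run 3 3 E t).2 (x - 1) = false :=
    eq_false_of_syndrome (quiet_left hE (x := a - 1) (by omega) t).error
      (fun y _ h2 => huniq y h2.ne) (by omega) (by omega : x - 1 < x)
  rw [defect_eq_syndrome, syndrome, h1] at hx
  have h2 : ∀ n : ℕ, (run 3 3 E t).2 (x + n) = true := by
    intro n
    induction n with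
    | zero => simpa using hx
    | succ n ih =>
      have := huniq (x + (n + 1 : ℕ)) (by push_cast; omega)
      rw [syndrome, show x + ((n + 1 : ℕ) : ℤ) - 1 = x + n by push_cast; ring, ih] at this
      simpa using this
  have h3 := h2 (d + 1 + t)
  rw [(quiet_right hE (x := x + (d + 1 + t : ℕ)) (by push_cast; omega)).error] at h3
  simp at h3

theorem error_late {t : ℕ} (ht : 4 * d + 3 ≤ t) (x : ℤ) : (run 3 3 E t).2 x = false := by
  by_cases hx : x < a
  · exact (quiet_left hE hx t).error
  · refine eq_false_of_syndrome (quiet_left hE (x := a - 1) (by omega) t).error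
      (fun y _ _ => ?_) (by omega) (by omega : x < x + 1)
    rw [← defect_eq_syndrome, defect_late hE ev ht]

theorem bwd_late {t : ℕ} (ht : 5 * d + 4 ≤ t) (x : ℤ) : (run 3 3 E t).1.bwd x = false := by
  have key : ∀ j : ℕ, ∀ x, (run 3 3 E (4 * d + 3 + j)).1.bwd x → x + 3 * j ≤ a + d := by
    intro j
    induction j with
    | zero =>
      intro x hx
      by_contra hc
      simp [(right_bound hE ev (4 * d + 3) x (by push_cast at hc; omega)).2.1] at hx
    | succ j ih =>
      intro x hx
      rcases ((ev.facts (4 * d + 3 + j)).bwd_source x hx).1 with h | ⟨-, h | h⟩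
      · have := ih _ h
        push_cast
        omega
      · rw [not_hit_late hE ev (by omega)] at h
        simp at h
      · rw [not_hit_late hE ev (by omega)] at h
        simp at h
  by_contra hc
  rw [Bool.not_eq_false] at hc
  have h1 := key (t - (4 * d + 3)) x (by rwa [show 4 * d + 3 + (t - (4 * d + 3)) = t by omega])
  have h2 : a ≤ x := by
    by_contra h
    rw [(quiet_left hE (by omega) t).bwd] at hc
    simp at hc
  omega

theorem fwd_late {t : ℕ} (ht : 5 * d + 4 ≤ t) {x : ℤ} (hx : (run 3 3 E t).1.fwd x) :
    a + d < x := by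
  have key : ∀ j : ℕ, ∀ x, (run 3 3 E (4 * d + 3 + j)).1.fwd x → a + j ≤ x := by
    intro j
    induction j with
    | zero =>
      intro x hx
      by_contra hc
      simp [(quiet_left hE (x := x) (by push_cast at hc; omega) (4 * d + 3)).fwd] at hx
    | succ j ih =>
      intro x hx
      rcases (ev.facts (4 * d + 3 + j)).fwd_source x hx with h | h
      · have := ih _ h
        push_cast
        omega
      · rw [stays_of_defect_false (defect_late hE ev (by omega) _)] at h
        simp at h
  have h1 := key (t - (4 * d + 3)) x (by rwa [show 4 * d + 3 + (t - (4 * d + 3)) = t by omega])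
  omega

/-- After time `5 * d + 4` no forward-signal raises the height at sites up to `a + d`, while a
nonempty stack lowers it by one each step. The height was at most the elapsed time, so this can go
on only as long again. -/
theorem stack_late {t : ℕ} (ht : 10 * d + 9 ≤ t) (x : ℤ) : (run 3 3 E t).1.stack x = 0 := by
  by_contra hc
  have hx : x ≤ a + d := by
    by_contra h
    exact hc (right_bound hE ev t x (by omega)).2.2
  have key : ∀ j : ℕ, 0 < (run 3 3 E (5 * d + 4 + j)).1.stack x →
      H (5 * d + 4 + j) x + j ≤ 5 * d + 4 := by
    intro j
    induction j with
    | zero =>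
      intro _
      have := ev.height_le_time (5 * d + 4) x
      rw [add_zero]
      push_cast at *
      omega
    | succ j ih =>
      intro hj
      have hd := defect_late hE ev (t := 5 * d + 4 + j) (by omega) x
      have h1 := (ev.facts (5 * d + 4 + j)).stack_le x
      rw [emits_of_defect_false hd] at h1
      simp only [bit_false] at h1
      have h2 := ih (by
        have : 0 < (run 3 3 E (5 * d + 4 + j + 1)).1.stack x := hj
        omega)
      have h3 := (ev.facts (5 * d + 4 + j)).height_block x (defect_late hE ev (by omega) x) hj
      have h4 : sent (run 3 3 E (5 * d + 4 + j)).1 x = false := by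
        rw [sent_of_not_defect hd]
        by_contra hf
        rw [Bool.not_eq_false] at hf
        have := fwd_late hE ev (by omega) hf
        omega
      simp only [h4, bit_false] at h3
      rw [show 5 * d + 4 + (j + 1) = 5 * d + 4 + j + 1 from rfl]
      push_cast
      omega
  have h1 := key (t - (5 * d + 4)) (by
    rw [show 5 * d + 4 + (t - (5 * d + 4)) = t by omega]; omega)
  have h2 := (ev.inv (5 * d + 4 + (t - (5 * d + 4)))).nonneg x
  omega

/-- With no sources left, anti-signals move three sites per step and would overtake the unit-speed
light cone on the right. -/
theorem anti_late {t : ℕ} (ht : 20 * d + 18 ≤ t) (x : ℤ) : (run 3 3 E t).1.anti x = false := by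
  have key : ∀ j : ℕ, ∀ x, (run 3 3 E (10 * d + 9 + j)).1.anti x → a + 3 * j ≤ x := by
    intro j
    induction j with
    | zero =>
      intro x hx
      by_contra hc
      simp [(quiet_left hE (x := x) (by push_cast at hc; omega) (10 * d + 9)).anti] at hx
    | succ j ih =>
      intro x hx
      rcases ((ev.facts (10 * d + 9 + j)).anti_source x hx).1 with h | ⟨h | h, -⟩
      · have := ih _ h
        push_cast
        omega
      · have : (run 3 3 E (10 * d + 9 + j)).1.stack (x - 3) = 0 := stack_late hE ev (by omega) _
        omega
      · rw [emits_of_defect_false (defect_late hE ev (by omega) _)] at h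
        simp at h
  by_contra hc
  rw [Bool.not_eq_false] at hc
  have h1 := key (t - (10 * d + 9)) x (by
    rwa [show 10 * d + 9 + (t - (10 * d + 9)) = t by omega])
  rw [(quiet_right hE (by omega)).anti] at hc
  simp at hc

/-- Only negative charges could remain, but the height starts at zero on the left and may not become
negative. -/
theorem fwd_eventually {t : ℕ} (ht : 20 * d + 18 ≤ t) (x : ℤ) :
    (run 3 3 E t).1.fwd x = false := by
  have hb : ∀ y, H t y = H t (y - 1) - bit ((run 3 3 E t).1.fwd y) := by
    intro y
    rw [(ev.inv t).balanced y]
    simp only [charge, stack_late hE ev (t := t) (by omega) y, anti_late hE ev ht y,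
      bwd_late hE ev (t := t) (by omega) y, bit_false]
    push_cast
    ring
  have key : ∀ n : ℕ, H t (a - 1 + n) ≤ 0 := by
    intro n
    induction n with
    | zero =>
      have := (clear_left hE ev t (x := a - 1) (by omega)).height
      simp [this]
    | succ n ih =>
      rw [hb, show a - 1 + ((n + 1 : ℕ) : ℤ) - 1 = a - 1 + n by push_cast; ring]
      have := bit_nonneg ((run 3 3 E t).1.fwd (a - 1 + (n + 1 : ℕ)))
      omega
  by_cases hx : x < a
  · exact (quiet_left hE hx t).fwd
  · have h1 := key (x - a).toNat
    rw [show a - 1 + ((x - a).toNat : ℤ) = x - 1 by omega] at h1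
    have h2 := (ev.inv t).nonneg x
    rw [hb] at h2
    cases hf : (run 3 3 E t).1.fwd x
    · rfl
    · rw [hf, bit_true] at h2
      omega

end Evolution

/-- An error supported on an interval of length `d` is corrected within `20 d + 18` time steps. -/
theorem run_eq_zero {t : ℕ} (ht : 20 * d + 18 ≤ t) :
    run 3 3 E t = (Config.zero ℤ, fun _ => false) := by
  obtain ⟨H, ev⟩ := exists_evolution E
  refine Prod.ext (Config.ext ?_ ?_ ?_ ?_ ?_) ?_
  · exact funext (defect_late hE ev (by omega))
  · exact funext (fwd_eventually hE ev ht)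
  · exact funext (bwd_late hE ev (by omega))
  · exact funext (anti_late hE ev ht)
  · exact funext (stack_late hE ev (by omega))
  · exact funext (error_late hE ev (by omega))

end Finite

end SignalRule

namespace SignalRule

/-! ### Periodic errors -/

section Pullback

variable {V W : Type*} [AddGroupWithOne V] [AddGroupWithOne W]

/-- A configuration on `W`, seen as a configuration on `V`. -/
def Config.pullback (f : V → W) (u : Config W) : Config V where
  defect := u.defect ∘ f
  fwd := u.fwd ∘ f
  bwd := u.bwd ∘ f
  anti := u.anti ∘ f
  stack := u.stack ∘ f

/-- The registers on `W`, seen as registers on `V`. -/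
def Work.pullback (f : V → W) (w : Work W) : Work V where
  toConfig := w.toConfig.pullback f
  tmp := w.tmp ∘ f
  cor := w.cor ∘ f

variable (f : V →+ W) (hf : f 1 = 1)
include hf

theorem backwardRound_pullback (w : Work W) :
    backwardRound (w.pullback f) = (backwardRound w).pullback f := by
  ext x <;> simp [backwardRound, moveBackward, annihilateBackward, absorbBackward, Work.pullback,
    Config.pullback, hf]

theorem antiRound_pullback (w : Work W) :
    antiRound (w.pullback f) = (antiRound w).pullback f := by
  ext x <;> simp [antiRound, moveAnti, annihilateBackward, annihilateForward, Work.pullback,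
    Config.pullback, hf]

theorem lastAntiRound_pullback (w : Work W) :
    lastAntiRound (w.pullback f) = (lastAntiRound w).pullback f := by
  ext x <;> simp [lastAntiRound, moveAnti, annihilateBackward, Work.pullback,
    Config.pullback, hf]

theorem matching_pullback (u : Config W) : matchRight (matchLeft (start (u.pullback f))) =
    (matchRight (matchLeft (start u))).pullback f := by
  ext x <;> simp [matchRight, matchLeft, start, Work.pullback, Config.pullback, hf]

theorem forward_pullback (w : Work W) : moveForward (sendForward (w.pullback f)) =
    (moveForward (sendForward w)).pullback f := by
  ext x <;> simp [moveForward, sendForward, Work.pullback, Config.pullback, hf]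

theorem reflect_pullback (w : Work W) : reflectLeft (reflectHere (w.pullback f)) =
    (reflectLeft (reflectHere w)).pullback f := by
  ext x <;> simp [reflectLeft, reflectHere, Work.pullback, Config.pullback, hf]

theorem iteration_pullback (ka kb : ℕ) (u : Config W) :
    iteration ka kb (u.pullback f) = (iteration ka kb u).pullback f := by
  have hB : ∀ n, ∀ w : Work W, backwardRound^[n] (w.pullback f) =
      (backwardRound^[n] w).pullback f := fun n w =>
    ((Function.Semiconj.iterate_right (f := Work.pullback f)
      (fun w => (backwardRound_pullback f hf w).symm) n) w).symm
  have hA : ∀ n, ∀ w : Work W, antiRound^[n] (w.pullback f) =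
      (antiRound^[n] w).pullback f := fun n w =>
    ((Function.Semiconj.iterate_right (f := Work.pullback f)
      (fun w => (antiRound_pullback f hf w).symm) n) w).symm
  have hS : ∀ w : Work W, sendAnti (w.pullback f) = (sendAnti w).pullback f := fun w => rfl
  simp only [iteration, matching_pullback f hf, forward_pullback f hf, reflect_pullback f hf, hB,
    hS, hA, lastAntiRound_pullback f hf]

/-- The rule only refers to neighbours, so it commutes with any homomorphism fixing 1. For the
projection of the integers onto the cycle, this lifts a run to a periodic run on the line. -/
theorem run_pullback (ka kb : ℕ) (E : W → Bool) (t : ℕ) : run ka kb (E ∘ f) t =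
    ((run ka kb E t).1.pullback f, (run ka kb E t).2 ∘ f) := by
  induction t with
  | zero =>
    simp only [run_zero, Prod.mk.injEq, and_true]
    ext x <;> simp [initial, Config.zero, Config.pullback, syndrome, hf]
  | succ t ih =>
    rw [run_succ, ih, run_succ]
    simp only [step, iteration_pullback f hf]
    rfl

theorem success_of_pullback (hs : Function.Surjective f) {ka kb t : ℕ} {E : W → Bool}
    (h : Success ka kb (E ∘ f) t) : Success ka kb E t := by
  rw [Success, run_pullback f hf, Prod.ext_iff, Config.ext_iff] at h
  obtain ⟨⟨h1, h2, h3, h4, h5⟩, h6⟩ := h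
  refine Prod.ext (Config.ext ?_ ?_ ?_ ?_ ?_) ?_ <;> funext x <;> obtain ⟨y, rfl⟩ := hs x
  · exact congrFun h1 y
  · exact congrFun h2 y
  · exact congrFun h3 y
  · exact congrFun h4 y
  · exact congrFun h5 y
  · exact congrFun h6 y

end Pullback

/-! ### Locality -/

/-- Two states of the registers agree on the interval from `p` to `q`. -/
structure AgreeOn (w w' : Work ℤ) (p q : ℤ) : Prop where
  defect : ∀ x, p ≤ x → x ≤ q → w.defect x = w'.defect x
  fwd : ∀ x, p ≤ x → x ≤ q → w.fwd x = w'.fwd x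
  bwd : ∀ x, p ≤ x → x ≤ q → w.bwd x = w'.bwd x
  anti : ∀ x, p ≤ x → x ≤ q → w.anti x = w'.anti x
  stack : ∀ x, p ≤ x → x ≤ q → w.stack x = w'.stack x
  tmp : ∀ x, p ≤ x → x ≤ q → w.tmp x = w'.tmp x
  cor : ∀ x, p ≤ x → x ≤ q → w.cor x = w'.cor x

theorem AgreeOn.at {w w' : Work ℤ} {p q x : ℤ} (h : AgreeOn w w' p q) (h1 : p ≤ x) (h2 : x ≤ q) :
    w.defect x = w'.defect x ∧ w.fwd x = w'.fwd x ∧ w.bwd x = w'.bwd x ∧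
    w.anti x = w'.anti x ∧ w.stack x = w'.stack x ∧ w.tmp x = w'.tmp x ∧ w.cor x = w'.cor x :=
  ⟨h.defect x h1 h2, h.fwd x h1 h2, h.bwd x h1 h2, h.anti x h1 h2, h.stack x h1 h2,
    h.tmp x h1 h2, h.cor x h1 h2⟩

theorem AgreeOn.mono {w w' : Work ℤ} {p q p' q' : ℤ} (h : AgreeOn w w' p q) (h1 : p ≤ p')
    (h2 : q' ≤ q) : AgreeOn w w' p' q' :=
  ⟨fun x h3 h4 => h.defect x (h1.trans h3) (h4.trans h2),
    fun x h3 h4 => h.fwd x (h1.trans h3) (h4.trans h2),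
    fun x h3 h4 => h.bwd x (h1.trans h3) (h4.trans h2),
    fun x h3 h4 => h.anti x (h1.trans h3) (h4.trans h2),
    fun x h3 h4 => h.stack x (h1.trans h3) (h4.trans h2),
    fun x h3 h4 => h.tmp x (h1.trans h3) (h4.trans h2),
    fun x h3 h4 => h.cor x (h1.trans h3) (h4.trans h2)⟩

/-- An instruction that reads only the sites at distance at most `r`. -/
def Local (F : Work ℤ → Work ℤ) (r : ℤ) : Prop :=
  ∀ w w' p q, AgreeOn w w' p q → AgreeOn (F w) (F w') (p + r) (q - r)

theorem Local.comp {F G : Work ℤ → Work ℤ} {r s : ℤ} (hF : Local F r) (hG : Local G s) :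
    Local (fun w => F (G w)) (s + r) := by
  intro w w' p q h
  have := hF _ _ _ _ (hG w w' p q h)
  rwa [add_assoc, sub_sub] at this

theorem local_of_neighbours {F : Work ℤ → Work ℤ}
    (hF : ∀ w w' x, AgreeOn w w' (x - 1) (x + 1) → AgreeOn (F w) (F w') x x) : Local F 1 := by
  intro w w' p q h
  have key : ∀ x, p + 1 ≤ x → x ≤ q - 1 → AgreeOn (F w) (F w') x x := fun x h1 h2 =>
    hF w w' x (h.mono (by omega) (by omega))
  exact ⟨fun x h1 h2 => (key x h1 h2).defect x le_rfl le_rfl,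
    fun x h1 h2 => (key x h1 h2).fwd x le_rfl le_rfl,
    fun x h1 h2 => (key x h1 h2).bwd x le_rfl le_rfl,
    fun x h1 h2 => (key x h1 h2).anti x le_rfl le_rfl,
    fun x h1 h2 => (key x h1 h2).stack x le_rfl le_rfl,
    fun x h1 h2 => (key x h1 h2).tmp x le_rfl le_rfl,
    fun x h1 h2 => (key x h1 h2).cor x le_rfl le_rfl⟩

theorem local_of_site {F : Work ℤ → Work ℤ}
    (hF : ∀ w w' x, AgreeOn w w' x x → AgreeOn (F w) (F w') x x) : Local F 0 := by
  intro w w' p q h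
  rw [add_zero, sub_zero]
  have key : ∀ x, p ≤ x → x ≤ q → AgreeOn (F w) (F w') x x := fun x h1 h2 =>
    hF w w' x (h.mono h1 h2)
  exact ⟨fun x h1 h2 => (key x h1 h2).defect x le_rfl le_rfl,
    fun x h1 h2 => (key x h1 h2).fwd x le_rfl le_rfl,
    fun x h1 h2 => (key x h1 h2).bwd x le_rfl le_rfl,
    fun x h1 h2 => (key x h1 h2).anti x le_rfl le_rfl,
    fun x h1 h2 => (key x h1 h2).stack x le_rfl le_rfl,
    fun x h1 h2 => (key x h1 h2).tmp x le_rfl le_rfl,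
    fun x h1 h2 => (key x h1 h2).cor x le_rfl le_rfl⟩

theorem agreeOn_site {w w' : Work ℤ} {x : ℤ} (h : w.defect x = w'.defect x ∧ w.fwd x = w'.fwd x ∧
    w.bwd x = w'.bwd x ∧ w.anti x = w'.anti x ∧ w.stack x = w'.stack x ∧ w.tmp x = w'.tmp x ∧
    w.cor x = w'.cor x) : AgreeOn w w' x x := by
  obtain ⟨h1, h2, h3, h4, h5, h6, h7⟩ := h
  constructor <;> intro y hy hy' <;> obtain rfl := le_antisymm hy hy' <;> assumption

theorem local_matchLeft : Local matchLeft 1 :=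
  local_of_neighbours fun w w' x h => by
    obtain ⟨h1, h2, h3, h4, h5, h6, h7⟩ := h.at (x := x) (by omega) (by omega)
    obtain ⟨l1, l2, l3, l4, l5, l6, l7⟩ := h.at (x := x - 1) (by omega) (by omega)
    obtain ⟨r1, r2, r3, r4, r5, r6, r7⟩ := h.at (x := x + 1) (by omega) (by omega)
    exact agreeOn_site (by simp only [matchLeft, *, and_self])

theorem local_matchRight : Local matchRight 1 :=
  local_of_neighbours fun w w' x h => by
    obtain ⟨h1, h2, h3, h4, h5, h6, h7⟩ := h.at (x := x) (by omega) (by omega)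
    obtain ⟨l1, l2, l3, l4, l5, l6, l7⟩ := h.at (x := x - 1) (by omega) (by omega)
    obtain ⟨r1, r2, r3, r4, r5, r6, r7⟩ := h.at (x := x + 1) (by omega) (by omega)
    exact agreeOn_site (by simp only [matchRight, *, and_self])

theorem local_sendForward : Local sendForward 1 :=
  local_of_neighbours fun w w' x h => by
    obtain ⟨h1, h2, h3, h4, h5, h6, h7⟩ := h.at (x := x) (by omega) (by omega)
    obtain ⟨l1, l2, l3, l4, l5, l6, l7⟩ := h.at (x := x - 1) (by omega) (by omega)
    obtain ⟨r1, r2, r3, r4, r5, r6, r7⟩ := h.at (x := x + 1) (by omega) (by omega)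
    exact agreeOn_site (by simp only [sendForward, *, and_self])

theorem local_moveForward : Local moveForward 1 :=
  local_of_neighbours fun w w' x h => by
    obtain ⟨h1, h2, h3, h4, h5, h6, h7⟩ := h.at (x := x) (by omega) (by omega)
    obtain ⟨l1, l2, l3, l4, l5, l6, l7⟩ := h.at (x := x - 1) (by omega) (by omega)
    obtain ⟨r1, r2, r3, r4, r5, r6, r7⟩ := h.at (x := x + 1) (by omega) (by omega)
    exact agreeOn_site (by simp only [moveForward, *, and_self])

theorem local_reflectHere : Local reflectHere 0 :=
  local_of_site fun w w' x h => by
    obtain ⟨h1, h2, h3, h4, h5, h6, h7⟩ := h.at le_rfl le_rfl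
    exact agreeOn_site (by simp only [reflectHere, h1, h2, h3, h4, h5, h6, h7, and_self])

theorem local_reflectLeft : Local reflectLeft 1 :=
  local_of_neighbours fun w w' x h => by
    obtain ⟨h1, h2, h3, h4, h5, h6, h7⟩ := h.at (x := x) (by omega) (by omega)
    obtain ⟨l1, l2, l3, l4, l5, l6, l7⟩ := h.at (x := x - 1) (by omega) (by omega)
    obtain ⟨r1, r2, r3, r4, r5, r6, r7⟩ := h.at (x := x + 1) (by omega) (by omega)
    exact agreeOn_site (by simp only [reflectLeft, *, and_self])

theorem local_moveBackward : Local moveBackward 1 :=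
  local_of_neighbours fun w w' x h => by
    obtain ⟨h1, h2, h3, h4, h5, h6, h7⟩ := h.at (x := x) (by omega) (by omega)
    obtain ⟨l1, l2, l3, l4, l5, l6, l7⟩ := h.at (x := x - 1) (by omega) (by omega)
    obtain ⟨r1, r2, r3, r4, r5, r6, r7⟩ := h.at (x := x + 1) (by omega) (by omega)
    exact agreeOn_site (by simp only [moveBackward, *, and_self])

theorem local_annihilateBackward : Local annihilateBackward 0 :=
  local_of_site fun w w' x h => by
    obtain ⟨h1, h2, h3, h4, h5, h6, h7⟩ := h.at le_rfl le_rfl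
    exact agreeOn_site (by simp only [annihilateBackward, h1, h2, h3, h4, h5, h6, h7, and_self])

theorem local_absorbBackward : Local absorbBackward 0 :=
  local_of_site fun w w' x h => by
    obtain ⟨h1, h2, h3, h4, h5, h6, h7⟩ := h.at le_rfl le_rfl
    exact agreeOn_site (by simp only [absorbBackward, h1, h2, h3, h4, h5, h6, h7, and_self])

theorem local_sendAnti : Local sendAnti 0 :=
  local_of_site fun w w' x h => by
    obtain ⟨h1, h2, h3, h4, h5, h6, h7⟩ := h.at le_rfl le_rfl
    exact agreeOn_site (by simp only [sendAnti, h1, h2, h3, h4, h5, h6, h7, and_self])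

theorem local_moveAnti : Local moveAnti 1 :=
  local_of_neighbours fun w w' x h => by
    obtain ⟨h1, h2, h3, h4, h5, h6, h7⟩ := h.at (x := x) (by omega) (by omega)
    obtain ⟨l1, l2, l3, l4, l5, l6, l7⟩ := h.at (x := x - 1) (by omega) (by omega)
    obtain ⟨r1, r2, r3, r4, r5, r6, r7⟩ := h.at (x := x + 1) (by omega) (by omega)
    exact agreeOn_site (by simp only [moveAnti, *, and_self])

theorem local_annihilateForward : Local annihilateForward 0 :=
  local_of_site fun w w' x h => by
    obtain ⟨h1, h2, h3, h4, h5, h6, h7⟩ := h.at le_rfl le_rfl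
    exact agreeOn_site (by simp only [annihilateForward, h1, h2, h3, h4, h5, h6, h7, and_self])

/-- The radius adds up as two for matching, two for sending and moving forward-signals, one for
reflection, three for backward- and three for anti-signals. -/
theorem local_iteration : Local (fun w => iteration 3 3 w.toConfig) 11 := by
  have hs : Local (fun w => start w.toConfig) 0 := local_of_site fun w w' x h => by
    obtain ⟨h1, h2, h3, h4, h5, h6, h7⟩ := h.at le_rfl le_rfl
    exact agreeOn_site (by simp only [start, h1, h2, h3, h4, h5, and_self])
  have hm := local_matchRight.comp (local_matchLeft.comp hs)
  have hf := local_moveForward.comp (local_sendForward.comp hm)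
  have hr := local_reflectLeft.comp (local_reflectHere.comp hf)
  have hB : Local backwardRound 1 :=
    local_absorbBackward.comp (local_annihilateBackward.comp local_moveBackward)
  have hA : Local antiRound 1 :=
    local_annihilateBackward.comp (local_annihilateForward.comp local_moveAnti)
  have hL : Local lastAntiRound 1 := local_annihilateBackward.comp local_moveAnti
  exact hL.comp (hA.comp (hA.comp (local_sendAnti.comp (hB.comp (hB.comp (hB.comp hr))))))

/-- Two states of the decoder and the error agree at `x`. -/
structure SameAt (s s' : Config ℤ × (ℤ → Bool)) (x : ℤ) : Prop where
  defect : s.1.defect x = s'.1.defect x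
  fwd : s.1.fwd x = s'.1.fwd x
  bwd : s.1.bwd x = s'.1.bwd x
  anti : s.1.anti x = s'.1.anti x
  stack : s.1.stack x = s'.1.stack x
  error : s.2 x = s'.2 x

theorem Quiet.sameAt {s s' : Config ℤ × (ℤ → Bool)} {x : ℤ} (h : Quiet s x) (h' : Quiet s' x) :
    SameAt s s' x :=
  ⟨h.defect.trans h'.defect.symm, h.fwd.trans h'.fwd.symm, h.bwd.trans h'.bwd.symm,
    h.anti.trans h'.anti.symm, h.stack.trans h'.stack.symm, h.error.trans h'.error.symm⟩

theorem SameAt.trans {s s' s'' : Config ℤ × (ℤ → Bool)} {x : ℤ} (h : SameAt s s' x)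
    (h' : SameAt s' s'' x) : SameAt s s'' x :=
  ⟨h.defect.trans h'.defect, h.fwd.trans h'.fwd, h.bwd.trans h'.bwd, h.anti.trans h'.anti,
    h.stack.trans h'.stack, h.error.trans h'.error⟩

theorem eq_of_sameAt {s s' : Config ℤ × (ℤ → Bool)} (h : ∀ x, SameAt s s' x) : s = s' :=
  Prod.ext (Config.ext (funext fun x => (h x).defect) (funext fun x => (h x).fwd)
    (funext fun x => (h x).bwd) (funext fun x => (h x).anti) (funext fun x => (h x).stack))
    (funext fun x => (h x).error)

theorem sameAt_step {s s' : Config ℤ × (ℤ → Bool)} {x : ℤ}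
    (h : ∀ y, x - 11 ≤ y → y ≤ x + 11 → SameAt s s' y) : SameAt (step 3 3 s) (step 3 3 s') x := by
  have h1 : AgreeOn (iteration 3 3 s.1) (iteration 3 3 s'.1) (x - 11 + 11) (x + 11 - 11) :=
    local_iteration (start s.1) (start s'.1) (x - 11) (x + 11)
    ⟨fun y h1 h2 => (h y h1 h2).defect, fun y h1 h2 => (h y h1 h2).fwd,
      fun y h1 h2 => (h y h1 h2).bwd, fun y h1 h2 => (h y h1 h2).anti,
      fun y h1 h2 => (h y h1 h2).stack, fun _ _ _ => rfl, fun _ _ _ => rfl⟩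
  obtain ⟨h2, h3, h4, h5, h6, -, h7⟩ := h1.at (x := x) (by omega) (by omega)
  refine ⟨h2, h3, h4, h5, h6, ?_⟩
  simp only [step, (h x (by omega) (by omega)).error, h7]

end SignalRule

namespace SignalRule

theorem run_no_error (t : ℕ) : run 3 3 (fun _ : ℤ => false) t = (Config.zero ℤ, fun _ => false) := by
  have h : ∀ x, Quiet (run 3 3 (fun _ : ℤ => false) t) x := fun x =>
    quiet_window _ (p := x - 1 - t) (q := x) (fun _ _ _ => rfl) t (by omega) le_rfl
  exact Prod.ext (Config.ext (funext fun x => (h x).defect) (funext fun x => (h x).fwd)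
    (funext fun x => (h x).bwd) (funext fun x => (h x).anti) (funext fun x => (h x).stack))
    (funext fun x => (h x).error)

theorem run_eq_of_le {E E' : ℤ → Bool} {s t : ℕ} (hst : s ≤ t)
    (h : run 3 3 E s = run 3 3 E' s) : run 3 3 E t = run 3 3 E' t := by
  obtain ⟨r, rfl⟩ := Nat.exists_eq_add_of_le hst
  induction r with
  | zero => exact h
  | succ r ih => rw [← add_assoc, run_succ, run_succ, ih (by omega)]

/-! ### Deleting isolated clusters of errors -/

/-- The error at `x` lies in an interval of length `L` that has distance more than `G` to all other
errors. -/
def Removable (E : ℤ → Bool) (L G : ℤ) (x : ℤ) : Prop :=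
  ∃ α β, α ≤ x ∧ x ≤ β ∧ β ≤ α + L ∧
    ∀ y, α - G ≤ y → y ≤ β + G → E y = true → α ≤ y ∧ y ≤ β

open Classical in
/-- The error without its isolated clusters. -/
noncomputable def prune (E : ℤ → Bool) (L G : ℤ) (x : ℤ) : Bool :=
  E x && decide (¬ Removable E L G x)

theorem prune_le {E : ℤ → Bool} {L G x : ℤ} (hx : prune E L G x) : E x = true := by
  simp only [prune, Bool.and_eq_true] at hx
  exact hx.1

theorem not_removable_of_prune {E : ℤ → Bool} {L G x : ℤ} (hx : prune E L G x) :
    ¬ Removable E L G x := by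
  simp only [prune, Bool.and_eq_true, decide_eq_true_eq] at hx
  exact hx.2

section Cluster

variable {E : ℤ → Bool} {α β G : ℤ} (hαβ : α ≤ β)
  (hE : ∀ y, α - G ≤ y → y ≤ β + G → E y = true → α ≤ y ∧ y ≤ β)
include hαβ hE

theorem quiet_before_cluster {t : ℕ} {x : ℤ} (h1 : α - G + 1 + t ≤ x) (h2 : x < α) :
    Quiet (run 3 3 E t) x := by
  refine quiet_window E (p := α - G) (q := α - 1) (fun y h3 h4 => ?_) t (by omega) (by omega)
  by_contra hc
  rw [Bool.not_eq_false] at hc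
  have := hE y h3 (by omega) hc
  omega

theorem quiet_after_cluster {t : ℕ} {x : ℤ} (h1 : β + 1 + t < x) (h2 : x ≤ β + G) :
    Quiet (run 3 3 E t) x := by
  refine quiet_window E (p := β + 1) (q := β + G) (fun y h3 h4 => ?_) t (by omega) (by omega)
  by_contra hc
  rw [Bool.not_eq_false] at hc
  have := hE y (by omega) h4 hc
  omega

/-- Near an isolated cluster, the evolution is that of the cluster alone. -/
theorem sameAt_cluster {T : ℕ} (hT : T + 13 ≤ G) {t : ℕ} (ht : t ≤ T) :
    ∀ x, α - G + 1 + T ≤ x → x ≤ β + G →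
      SameAt (run 3 3 E t) (run 3 3 (fun y => E y && decide (α ≤ y ∧ y ≤ β)) t) x := by
  have hC : ∀ y, α - G ≤ y → y ≤ β + G → (E y && decide (α ≤ y ∧ y ≤ β)) = true →
      α ≤ y ∧ y ≤ β := fun y _ _ h => by simpa using (Bool.and_eq_true_iff.mp h).2
  have hq : ∀ t ≤ T, ∀ x, α - G + 1 + T ≤ x → x ≤ β + G → x < α ∨ β + 1 + t < x →
      SameAt (run 3 3 E t) (run 3 3 (fun y => E y && decide (α ≤ y ∧ y ≤ β)) t) x := by
    rintro t ht x h1 h2 (h | h)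
    · exact (quiet_before_cluster hαβ hE (by omega) h).sameAt
        (quiet_before_cluster hαβ hC (by omega) h)
    · exact (quiet_after_cluster hαβ hE h h2).sameAt (quiet_after_cluster hαβ hC h h2)
  induction t with
  | zero =>
    intro x h1 h2
    by_cases hx : x < α ∨ β + 1 + (0 : ℕ) < x
    · exact hq 0 ht x h1 h2 hx
    · have e : ∀ y, α - G ≤ y → y ≤ β + G → E y = (E y && decide (α ≤ y ∧ y ≤ β)) := by
        intro y h3 h4
        by_cases hy : E y = true
        · simp [hy, hE y h3 h4 hy]
        · simp [hy]
      push_cast at hx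
      refine ⟨?_, rfl, rfl, rfl, rfl, e x (by omega) (by omega)⟩
      exact congrArg₂ xor (e (x - 1) (by omega) (by omega)) (e x (by omega) (by omega))
  | succ t ih =>
    intro x h1 h2
    by_cases hx : x < α ∨ β + 1 + (t + 1 : ℕ) < x
    · exact hq (t + 1) ht x h1 h2 hx
    · push_cast at hx
      rw [run_succ, run_succ]
      exact sameAt_step fun y h3 h4 => ih (by omega) y (by omega) (by omega)

end Cluster

/-- Isolated clusters of errors of length `L` can be deleted. -/
theorem run_prune (E : ℤ → Bool) {L T : ℕ} {G : ℤ} (hT : 20 * (L + 1) + 18 ≤ T)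
    (hG : T + 13 ≤ G) : run 3 3 E T = run 3 3 (prune E L G) T := by
  have hP : ∀ α β : ℤ, α ≤ β → β ≤ α + L →
      (∀ y, α - G ≤ y → y ≤ β + G → E y = true → α ≤ y ∧ y ≤ β) →
      ∀ y, α - G ≤ y → y ≤ β + G → prune E L G y = false := by
    intro α β h1 h2 h3 y h4 h5
    by_contra hc
    rw [Bool.not_eq_false] at hc
    obtain ⟨h6, h7⟩ := h3 y h4 h5 (prune_le hc)
    exact not_removable_of_prune hc ⟨α, β, h6, h7, h2, h3⟩
  have hQ : ∀ α β : ℤ, α ≤ β → β ≤ α + L →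
      (∀ y, α - G ≤ y → y ≤ β + G → E y = true → α ≤ y ∧ y ≤ β) →
      ∀ t ≤ T, ∀ x, α - G + 1 + T ≤ x → x ≤ β + G → Quiet (run 3 3 (prune E L G) t) x :=
    fun α β h1 h2 h3 t ht x h4 h5 =>
      quiet_window _ (hP α β h1 h2 h3) t (by omega) h5
  have key : ∀ t ≤ T, ∀ x : ℤ, (∀ α β : ℤ, α ≤ β → β ≤ α + L →
      (∀ y, α - G ≤ y → y ≤ β + G → E y = true → α ≤ y ∧ y ≤ β) → ¬ (α ≤ x ∧ x ≤ β + 1 + t)) →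
      SameAt (run 3 3 E t) (run 3 3 (prune E L G) t) x := by
    intro t
    induction t with
    | zero =>
      intro _ x hx
      have e : ∀ y, x - 1 ≤ y → y ≤ x → E y = prune E L G y := by
        intro y h1 h2
        by_cases hy : E y = true
        · have : ¬ Removable E L G y := by
            rintro ⟨α, β, h3, h4, h5, h6⟩
            exact hx α β (by omega) h5 h6 ⟨by omega, by push_cast; omega⟩
          simp [prune, hy, this]
        · simp [prune, hy]
      refine ⟨?_, rfl, rfl, rfl, rfl, e x (by omega) le_rfl⟩
      exact congrArg₂ xor (e (x - 1) le_rfl (by omega)) (e x (by omega) le_rfl)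
    | succ t ih =>
      intro ht x hx
      -- Sites within the reading radius 11 of the cone of a cluster lie in its empty buffer, where
      -- both runs are quiet. For all other sites, everything read is covered by the induction
      -- hypothesis.
      by_cases hn : ∃ α β : ℤ, α ≤ β ∧ β ≤ α + L ∧
          (∀ y, α - G ≤ y → y ≤ β + G → E y = true → α ≤ y ∧ y ≤ β) ∧
          α - 11 ≤ x ∧ x ≤ β + 12 + t
      · obtain ⟨α, β, h1, h2, h3, h4, h5⟩ := hn
        have h6 := hx α β h1 h2 h3
        push_cast at h6
        refine Quiet.sameAt ?_ (hQ α β h1 h2 h3 (t + 1) ht x (by omega) (by omega))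
        by_cases h7 : x < α
        · exact quiet_before_cluster h1 h3 (by push_cast; omega) h7
        · exact quiet_after_cluster h1 h3 (by push_cast; omega) (by omega)
      · rw [run_succ, run_succ]
        refine sameAt_step fun y h3 h4 => ih (by omega) y fun α β h5 h6 h7 h8 => hn ?_
        exact ⟨α, β, h5, h6, h7, by omega, by omega⟩
  refine eq_of_sameAt fun x => ?_
  -- Inside a cone the full run looks like the cluster alone, which has been corrected by time `T`,
  -- and the pruned run is quiet.
  by_cases hn : ∃ α β : ℤ, α ≤ β ∧ β ≤ α + L ∧
      (∀ y, α - G ≤ y → y ≤ β + G → E y = true → α ≤ y ∧ y ≤ β) ∧ α ≤ x ∧ x ≤ β + 1 + T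
  · obtain ⟨α, β, h1, h2, h3, h4, h5⟩ := hn
    refine (sameAt_cluster h1 h3 hG le_rfl x (by omega) (by omega)).trans (Quiet.sameAt ?_
      (hQ α β h1 h2 h3 T le_rfl x (by omega) (by omega)))
    rw [run_eq_zero (a := α) (d := L + 1) (fun y hy => ?_) hT]
    · exact ⟨rfl, rfl, rfl, rfl, rfl, rfl⟩
    · have : α ≤ y ∧ y ≤ β := by simpa using (Bool.and_eq_true_iff.mp hy).2
      push_cast
      omega
  · exact key T le_rfl x fun α β h1 h2 h3 h4 => hn ⟨α, β, h1, h2, h3, h4⟩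

/-! ### Deleting isolated single errors -/

/-- The error without the edges that have no other error at distance at most 2. -/
def dropIsolated (E : ℤ → Bool) (x : ℤ) : Bool :=
  E x && (E (x - 2) || E (x - 1) || E (x + 1) || E (x + 2))

/-- An isolated error is a matched pair of defects, removed before anything else happens. Whether a
defect survives depends on finitely many nearby errors, so all patterns are checked. -/
theorem kept_syndrome_dropIsolated (E : ℤ → Bool) (x : ℤ) :
    kept (syndrome (dropIsolated E)) x = kept (syndrome E) x := by
  simp only [kept, pairStart, syndrome, dropIsolated]
  simp only [sub_eq_add_neg, add_assoc, Int.reduceNeg, Int.reduceAdd, add_zero]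
  generalize E (x + -5) = a₁
  generalize E (x + -4) = a₂
  generalize E (x + -3) = a₃
  generalize E (x + -2) = a₄
  generalize E (x + -1) = a₅
  generalize E x = a₆
  generalize E (x + 1) = a₇
  generalize E (x + 2) = a₈
  generalize E (x + 3) = a₉
  generalize E (x + 4) = b₁
  clear E x
  revert a₁ a₂ a₃ a₄ a₅ a₆ a₇ a₈ a₉ b₁
  decide

theorem error_dropIsolated (E : ℤ → Bool) (x : ℤ) :
    xor (dropIsolated E x) (pairStart (syndrome (dropIsolated E)) x) =
      xor (E x) (pairStart (syndrome E) x) := by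
  simp only [pairStart, syndrome, dropIsolated]
  simp only [sub_eq_add_neg, add_assoc, Int.reduceNeg, Int.reduceAdd, add_zero]
  generalize E (x + -5) = a₁
  generalize E (x + -4) = a₂
  generalize E (x + -3) = a₃
  generalize E (x + -2) = a₄
  generalize E (x + -1) = a₅
  generalize E x = a₆
  generalize E (x + 1) = a₇
  generalize E (x + 2) = a₈
  generalize E (x + 3) = a₉
  generalize E (x + 4) = b₁
  clear E x
  revert a₁ a₂ a₃ a₄ a₅ a₆ a₇ a₈ a₉ b₁
  decide

theorem hit_initial (E : ℤ → Bool) (x : ℤ) : hit (initial E) x = false := by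
  simp only [hit, sent, emits, sub_add_cancel, initial, Config.zero, Bool.false_or]
  cases kept (syndrome E) x <;> simp

/-- The registers with another correction. -/
def Work.setCor {V : Type*} (w : Work V) (c : V → Bool) : Work V := { w with cor := c }

/-- Once matching is done, the correction is written but never read by the registers. The two runs
may thus differ in it, since the error itself is compared separately. -/
theorem rounds_setCor (w : Work ℤ) (c : ℤ → Bool) :
    (lastAntiRound (antiRound^[3 - 1] (sendAnti (backwardRound^[3] (reflectLeft (reflectHere
      (moveForward (sendForward (w.setCor c))))))))).toConfig =
    (lastAntiRound (antiRound^[3 - 1] (sendAnti (backwardRound^[3] (reflectLeft (reflectHere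
      (moveForward (sendForward w)))))))).toConfig := by
  have hF : moveForward (sendForward (w.setCor c)) = (moveForward (sendForward w)).setCor c := rfl
  have hH : ∀ (w : Work ℤ) (c : ℤ → Bool),
      reflectHere (w.setCor c) = (reflectHere w).setCor c := fun _ _ => rfl
  have hL : ∀ (w : Work ℤ) (c : ℤ → Bool), reflectLeft (w.setCor c) =
      (reflectLeft w).setCor fun i => if w.tmp (i + 1) then true else c i := fun _ _ => rfl
  have hB : ∀ (w : Work ℤ) (c : ℤ → Bool),
      backwardRound (w.setCor c) = (backwardRound w).setCor c := fun _ _ => rfl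
  have hS : ∀ (w : Work ℤ) (c : ℤ → Bool),
      sendAnti (w.setCor c) = (sendAnti w).setCor c := fun _ _ => rfl
  have hA : ∀ (w : Work ℤ) (c : ℤ → Bool),
      antiRound (w.setCor c) = (antiRound w).setCor c := fun _ _ => rfl
  have hE : ∀ (w : Work ℤ) (c : ℤ → Bool),
      lastAntiRound (w.setCor c) = (lastAntiRound w).setCor c := fun _ _ => rfl
  simp only [Function.iterate_succ_apply, Function.iterate_zero, id_eq, Nat.reduceSub, hF, hH, hL,
    hB, hS, hA, hE]
  rfl

theorem run_dropIsolated (E : ℤ → Bool) : run 3 3 E 1 = run 3 3 (dropIsolated E) 1 := by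
  rw [show 1 = 0 + 1 from rfl, run_succ, run_succ, run_zero, run_zero]
  refine Prod.ext ?_ (funext fun x => ?_)
  · have hw : matchRight (matchLeft (start (initial E))) =
        (matchRight (matchLeft (start (initial (dropIsolated E))))).setCor
          (matchRight (matchLeft (start (initial E)))).cor := by
      refine Work.ext ?_ rfl rfl rfl rfl rfl rfl
      funext x
      rw [matched_defect]
      exact (kept_syndrome_dropIsolated E x).symm.trans (matched_defect (initial (dropIsolated E)) x).symm
    simp only [step, iteration]
    rw [hw]
    exact rounds_setCor _ _
  · rw [step_error (inv_initial E), step_error (inv_initial _), hit_initial, hit_initial]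
    simpa [initial] using (error_dropIsolated E x).symm

end SignalRule

namespace SignalRule

/-! ### Chunks -/

/-- The diameter allowed for a chunk of level `k`. -/
def scale : ℕ → ℕ
  | 0 => 0
  | k + 1 => 2 * 116 ^ k

theorem two_le_scale_succ (k : ℕ) : 2 ≤ scale (k + 1) := by
  have := Nat.one_le_pow k 116 (by norm_num)
  simp only [scale]
  omega

theorem scale_succ_succ (k : ℕ) : scale (k + 2) = 116 * scale (k + 1) := by
  simp only [scale]
  ring

/-- `S` is a chunk of level `k` of the error `E` with first element `l`. -/
def IsChunk (E : ℤ → Bool) : ℕ → ℤ → Finset ℤ → Prop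
  | 0, l, S => S = {l} ∧ E l = true
  | k + 1, l, S => ∃ l' A B, IsChunk E k l A ∧ IsChunk E k l' B ∧ Disjoint A B ∧ S = A ∪ B ∧
      l < l' ∧ ∀ p ∈ S, ∀ q ∈ S, p - q ≤ scale (k + 1)

section Chunk

variable {E : ℤ → Bool} {k : ℕ} {l : ℤ} {S : Finset ℤ}

theorem IsChunk.base_mem (h : IsChunk E k l S) : l ∈ S := by
  induction k generalizing S with
  | zero => simp [h.1]
  | succ k ih =>
    obtain ⟨l', A, B, hA, -, -, rfl, -⟩ := h
    exact Finset.mem_union_left _ (ih hA)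

theorem IsChunk.error (h : IsChunk E k l S) : ∀ x ∈ S, E x = true := by
  induction k generalizing l S with
  | zero =>
    intro x hx
    rw [h.1, Finset.mem_singleton] at hx
    rw [hx, h.2]
  | succ k ih =>
    obtain ⟨l', A, B, hA, hB, -, rfl, -⟩ := h
    intro x hx
    rcases Finset.mem_union.mp hx with hx | hx
    · exact ih hA x hx
    · exact ih hB x hx

theorem IsChunk.diam (h : IsChunk E k l S) : ∀ p ∈ S, ∀ q ∈ S, p - q ≤ scale k := by
  cases k with
  | zero =>
    intro p hp q hq
    rw [h.1, Finset.mem_singleton] at hp hq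
    simp [hp, hq, scale]
  | succ k =>
    obtain ⟨l', A, B, -, -, -, -, -, h⟩ := h
    exact h

theorem IsChunk.card (h : IsChunk E k l S) : S.card = 2 ^ k := by
  induction k generalizing l S with
  | zero => simp [h.1]
  | succ k ih =>
    obtain ⟨l', A, B, hA, hB, hd, rfl, -⟩ := h
    rw [Finset.card_union_of_disjoint hd, ih hA, ih hB]
    ring

/-- Two disjoint chunks close to each other form a chunk of the next level. -/
theorem IsChunk.union {l' : ℤ} {S' : Finset ℤ} (h : IsChunk E k l S) (h' : IsChunk E k l' S')
    (hd : Disjoint S S') (hD : ∀ p ∈ S ∪ S', ∀ q ∈ S ∪ S', p - q ≤ scale (k + 1)) :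
    ∃ m, IsChunk E (k + 1) m (S ∪ S') := by
  rcases lt_trichotomy l l' with hl | rfl | hl
  · exact ⟨l, l', S, S', h, h', hd, rfl, hl, hD⟩
  · exact (Finset.disjoint_left.mp hd h.base_mem h'.base_mem).elim
  · exact ⟨l', l, S', S, h', h, hd.symm, Finset.union_comm _ _, hl, hD⟩

end Chunk

/-- The errors remaining at level `k` after isolated clusters have been deleted. -/
noncomputable def reduced (E : ℤ → Bool) : ℕ → ℤ → Bool
  | 0 => E
  | 1 => dropIsolated E
  | k + 2 => prune (reduced E (k + 1)) (4 * scale (k + 1) : ℕ) (80 * scale (k + 1) + 51 : ℕ)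

/-- Each deletion compares two runs from time zero, so the times of the levels do not add up; the
longest one counts. -/
theorem run_reduced (E : ℤ → Bool) (k : ℕ) {t : ℕ} (ht : scale k ≤ t) :
    run 3 3 E t = run 3 3 (reduced E k) t := by
  induction k generalizing t with
  | zero => rfl
  | succ k ih =>
    cases k with
    | zero =>
      have := two_le_scale_succ 0
      exact run_eq_of_le (by omega) (run_dropIsolated E)
    | succ k =>
      have h1 := two_le_scale_succ k
      rw [scale_succ_succ] at ht
      rw [ih (by omega)]
      -- With clusters of length `4 * s` for `s = scale (k + 1)`, the correction time is `20 * (4 *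
      -- s + 1) + 18`; the gap used in `reduced` exceeds it by the required 13.
      refine run_eq_of_le (s := 80 * scale (k + 1) + 38) (by omega) (run_prune _ (by omega) ?_)
      push_cast
      omega

theorem exists_chunk_one {E : ℤ → Bool} {x y : ℤ} (hx : E x) (hy : E y) (hxy : x < y)
    (h : y ≤ x + 2) : IsChunk E 1 x {x, y} := by
  refine ⟨y, {x}, {y}, ⟨rfl, hx⟩, ⟨rfl, hy⟩, by simpa using hxy.ne, rfl, hxy, ?_⟩
  intro p hp q hq
  simp only [Finset.mem_insert, Finset.mem_singleton] at hp hq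
  simp only [scale]
  push_cast
  omega

/-- Every remaining error of level `k` lies in a chunk of level `k`. -/
theorem exists_chunk_of_reduced (E : ℤ → Bool) (k : ℕ) : ∀ x, reduced E k x →
    ∃ l S, IsChunk E k l S ∧ x ∈ S := by
  induction k with
  | zero => exact fun x hx => ⟨x, {x}, ⟨rfl, hx⟩, by simp⟩
  | succ k ih =>
    cases k with
    | zero =>
      intro x hx
      have hx' : dropIsolated E x = true := hx
      simp only [dropIsolated, Bool.and_eq_true, Bool.or_eq_true] at hx'
      obtain ⟨h0, ((h | h) | h) | h⟩ := hx'
      · exact ⟨_, _, exists_chunk_one h h0 (by omega) (by omega), by simp⟩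
      · exact ⟨_, _, exists_chunk_one h h0 (by omega) (by omega), by simp⟩
      · exact ⟨_, _, exists_chunk_one h0 h (by omega) (by omega), by simp⟩
      · exact ⟨_, _, exists_chunk_one h0 h (by omega) (by omega), by simp⟩
    | succ k =>
      intro x hx
      obtain ⟨l, S, hS, hxS⟩ := ih x (prune_le hx)
      by_contra hno
      -- Every nearby error either has a chunk meeting that of `x`, and then is within two diameters
      -- of `x`, or a disjoint one, and then the two chunks combine to the next level.
      refine not_removable_of_prune hx
        ⟨x - 2 * scale (k + 1), x + 2 * scale (k + 1), by omega, by omega, by push_cast; omega, ?_⟩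
      intro y h1 h2 hy
      obtain ⟨l', S', hS', hyS'⟩ := ih y hy
      have hs := two_le_scale_succ k
      have hss := scale_succ_succ k
      push_cast at h1 h2
      by_cases hd : Disjoint S S'
      · exfalso
        -- With `s = scale (k + 1)`, the points `x` and `y` are at most `82 * s + 51` apart, so the
        -- union has diameter at most `84 * s + 51`. This is below `116 * s` because `s` is at least
        -- 2.
        obtain ⟨m, hm⟩ := hS.union hS' hd (by
          rw [hss]
          push_cast
          intro p hp q hq
          rcases Finset.mem_union.mp hp with hp | hp <;> rcases Finset.mem_union.mp hq with hq | hq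
          · have := hS.diam p hp q hq
            omega
          · have := hS.diam p hp x hxS
            have := hS'.diam y hyS' q hq
            omega
          · have := hS.diam x hxS q hq
            have := hS'.diam p hp y hyS'
            omega
          · have := hS'.diam p hp q hq
            omega)
        exact hno ⟨m, _, hm, Finset.mem_union_left _ hxS⟩
      · rw [Finset.not_disjoint_iff] at hd
        obtain ⟨z, hz, hz'⟩ := hd
        have d1 := hS.diam x hxS z hz
        have d2 := hS.diam z hz x hxS
        have d3 := hS'.diam y hyS' z hz'
        have d4 := hS'.diam z hz' y hyS'
        omega

theorem success_of_no_chunk {E : ℤ → Bool} {k t : ℕ} (ht : scale k ≤ t)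
    (h : ∀ l S, ¬ IsChunk E k l S) : Success 3 3 E t := by
  have : reduced E k = fun _ => false := by
    funext x
    by_contra hc
    rw [Bool.not_eq_false] at hc
    obtain ⟨l, S, hS, -⟩ := exists_chunk_of_reduced E k x hc
    exact h l S hS
  rw [Success, run_reduced E k ht, this, run_no_error]

end SignalRule

namespace SignalRule

/-! ### Counting chunks -/

/-- The translates to the origin of all chunks of level `k`. -/
def shapes : ℕ → Finset (Finset ℤ)
  | 0 => {{0}}
  | k + 1 => (shapes k ×ˢ shapes k ×ˢ Finset.range (scale (k + 1))).image
      fun x => x.1 ∪ x.2.1.image (· + ((x.2.2 : ℤ) + 1))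

theorem card_shapes_succ (k : ℕ) :
    (shapes (k + 1)).card ≤ (shapes k).card ^ 2 * scale (k + 1) := by
  refine Finset.card_image_le.trans ?_
  rw [Finset.card_product, Finset.card_product, Finset.card_range]
  exact le_of_eq (by ring)

/-- The factor `2 * 116 ^ (k + 1)` turns the recursion into exact squaring, so the base is its value
232 at level 0. It also leaves room to absorb the number of translates on the cycle. -/
theorem card_shapes_le (k : ℕ) : 2 * 116 ^ (k + 1) * (shapes k).card ≤ 232 ^ 2 ^ k := by
  induction k with
  | zero => simp [shapes]
  | succ k ih =>
    calc 2 * 116 ^ (k + 1 + 1) * (shapes (k + 1)).card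
        ≤ 2 * 116 ^ (k + 1 + 1) * ((shapes k).card ^ 2 * scale (k + 1)) := by
          gcongr
          exact card_shapes_succ k
      _ = (2 * 116 ^ (k + 1) * (shapes k).card) ^ 2 := by
          simp only [scale]
          ring
      _ ≤ (232 ^ 2 ^ k) ^ 2 := by gcongr
      _ = 232 ^ 2 ^ (k + 1) := by rw [← pow_mul, pow_succ]

theorem IsChunk.exists_shape {E : ℤ → Bool} {k : ℕ} {l : ℤ} {S : Finset ℤ}
    (h : IsChunk E k l S) : ∃ P ∈ shapes k, S = P.image (· + l) := by
  induction k generalizing l S with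
  | zero => exact ⟨{0}, by simp [shapes], by simp [h.1]⟩
  | succ k ih =>
    have hD := h.diam
    have hl := h.base_mem
    obtain ⟨l', A, B, hA, hB, -, rfl, hll, -⟩ := h
    obtain ⟨P, hP, rfl⟩ := ih hA
    obtain ⟨Q, hQ, rfl⟩ := ih hB
    have h1 := hD l' (Finset.mem_union_right _ hB.base_mem) l hl
    refine ⟨P ∪ Q.image (· + (((l' - l - 1).toNat : ℤ) + 1)), ?_, ?_⟩
    · refine Finset.mem_image.mpr ⟨(P, Q, (l' - l - 1).toNat), ?_, rfl⟩
      simp only [Finset.mem_product, Finset.mem_range]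
      exact ⟨hP, hQ, by omega⟩
    · rw [Finset.image_union, Finset.image_image]
      congr 2
      funext x
      simp only [Function.comp_apply]
      omega

/-! ### The logical error rate -/

theorem sum_biUnion_le {ι α : Type*} [DecidableEq ι] [DecidableEq α] (s : Finset ι)
    (t : ι → Finset α) {f : α → ℝ} (hf : ∀ x, 0 ≤ f x) :
    ∑ x ∈ s.biUnion t, f x ≤ ∑ i ∈ s, ∑ x ∈ t i, f x := by
  induction s using Finset.induction_on with
  | empty => simp
  | insert i s hi ih =>
    rw [Finset.biUnion_insert, Finset.sum_insert hi]
    have h1 := Finset.sum_union_inter (s₁ := t i) (s₂ := s.biUnion t) (f := f)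
    have h2 : 0 ≤ ∑ x ∈ t i ∩ s.biUnion t, f x := Finset.sum_nonneg fun x _ => hf x
    linarith

section Probability

variable (n : ℕ) [NeZero n]

theorem errorProb_nonneg {ε : ℝ} (h0 : 0 ≤ ε) (h1 : ε ≤ 1) (E : ZMod n → Bool) :
    0 ≤ errorProb n ε E := by
  refine Finset.prod_nonneg fun i _ => ?_
  split_ifs
  · exact h0
  · linarith

theorem sum_errorProb_superset (ε : ℝ) (U : Finset (ZMod n)) :
    ∑ E : ZMod n → Bool with ∀ i ∈ U, E i = true, errorProb n ε E = ε ^ U.card := by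
  have h1 : (Finset.univ.filter fun E : ZMod n → Bool => ∀ i ∈ U, E i = true) =
      Fintype.piFinset fun i => if i ∈ U then {true} else Finset.univ := by
    ext E
    simp only [Finset.mem_filter, Finset.mem_univ, true_and, Fintype.mem_piFinset]
    refine forall_congr' fun i => ?_
    by_cases hi : i ∈ U <;> simp [hi]
  rw [h1]
  simp only [errorProb]
  rw [← Finset.prod_univ_sum (fun i => if i ∈ U then {true} else Finset.univ)
    (fun (_ : ZMod n) (b : Bool) => if b then ε else 1 - ε)]
  rw [← Finset.prod_const, ← Finset.prod_subset (Finset.subset_univ U)]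
  · exact Finset.prod_congr rfl fun i hi => by simp [hi]
  · intro i _ hi
    simp [hi]

/-- The lifted periodic error contains a chunk, and its diameter is below `n`, so its `2 ^ k`
elements remain distinct on the cycle and count as independent edges. -/
theorem exists_shape_of_not_success {k : ℕ} (hk : 116 ^ k ≤ n) {E : ZMod n → Bool}
    (hE : ¬ Success 3 3 E n) : ∃ c : ZMod n, ∃ P ∈ shapes k,
      (P.image fun s : ℤ => (s : ZMod n) + c).card = 2 ^ k ∧
      ∀ i ∈ P.image fun s : ℤ => (s : ZMod n) + c, E i = true := by
  have hs : scale k < n := by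
    cases k with
    | zero => simpa [scale] using Nat.pos_of_ne_zero (NeZero.ne n)
    | succ k =>
      have := Nat.one_le_pow k 116 (by norm_num)
      simp only [scale]
      rw [pow_succ] at hk
      omega
  have hno : ¬ ∀ l S, ¬ IsChunk (E ∘ (Int.castAddHom (ZMod n))) k l S := fun h =>
    hE (success_of_pullback (Int.castAddHom (ZMod n)) (by simp) (ZMod.intCast_surjective)
      (success_of_no_chunk hs.le h))
  push Not at hno
  obtain ⟨l, S, hS⟩ := hno
  obtain ⟨P, hP, rfl⟩ := hS.exists_shape
  have himg : (P.image fun s : ℤ => (s : ZMod n) + (l : ZMod n)) =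
      (P.image (· + l)).image fun s : ℤ => (s : ZMod n) := by
    rw [Finset.image_image]
    congr 1
    funext s
    simp
  refine ⟨(l : ZMod n), P, hP, ?_, ?_⟩
  · rw [himg, Finset.card_image_of_injOn, hS.card]
    intro p hp q hq hpq
    have h1 := hS.diam p hp q hq
    have h2 := hS.diam q hq p hp
    have h3 : (n : ℤ) ∣ q - p := (ZMod.intCast_eq_intCast_iff_dvd_sub p q n).mp hpq
    have h4 : q - p = 0 := Int.eq_zero_of_abs_lt_dvd h3 (by rw [abs_lt]; constructor <;> omega)
    omega
  · rw [himg]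
    intro i hi
    obtain ⟨s, hs, rfl⟩ := Finset.mem_image.mp hi
    exact hS.error s hs

theorem logicalErrorRate_le {k : ℕ} (hk : 116 ^ k ≤ n) (hk' : n < 116 ^ (k + 1)) {ε : ℝ}
    (h0 : 0 ≤ ε) (h1 : ε ≤ 1) : logicalErrorRate n n ε ≤ 1 / 2 * (232 * ε) ^ 2 ^ k := by
  classical
  have hnn := errorProb_nonneg n h0 h1
  have hb : logicalErrorRate n n ε ≤ ∑ c : ZMod n, ∑ P ∈ shapes k, ε ^ 2 ^ k := by
    calc logicalErrorRate n n ε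
        ≤ ∑ E ∈ Finset.univ.biUnion fun c : ZMod n => (shapes k).biUnion fun P =>
            if (P.image fun s : ℤ => (s : ZMod n) + c).card = 2 ^ k then
              Finset.univ.filter fun E : ZMod n → Bool =>
                ∀ i ∈ P.image fun s : ℤ => (s : ZMod n) + c, E i = true
            else ∅, errorProb n ε E := by
          refine Finset.sum_le_sum_of_subset_of_nonneg (fun E hE => ?_) fun E _ _ => hnn E
          obtain ⟨c, P, hP, hc, hE'⟩ := exists_shape_of_not_success n hk (Finset.mem_filter.mp hE).2
          refine Finset.mem_biUnion.mpr ⟨c, Finset.mem_univ c, Finset.mem_biUnion.mpr ⟨P, hP, ?_⟩⟩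
          rw [if_pos hc]
          exact Finset.mem_filter.mpr ⟨Finset.mem_univ E, hE'⟩
      _ ≤ _ := by
          refine (sum_biUnion_le _ _ hnn).trans (Finset.sum_le_sum fun c _ =>
            (sum_biUnion_le _ _ hnn).trans (Finset.sum_le_sum fun P _ => ?_))
          split_ifs with hc
          · rw [sum_errorProb_superset, hc]
          · simpa using pow_nonneg h0 _
  refine hb.trans ?_
  simp only [Finset.sum_const, Finset.card_univ, ZMod.card, nsmul_eq_mul]
  -- The `n` translates are paid for by the spare factor `116 ^ (k + 1)`.
  have h2 : 2 * n * (shapes k).card ≤ 232 ^ 2 ^ k :=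
    le_trans (by gcongr) (card_shapes_le k)
  have h3 : (2 * n * (shapes k).card : ℝ) ≤ 232 ^ 2 ^ k := by exact_mod_cast h2
  rw [mul_pow]
  have h4 := mul_le_mul_of_nonneg_right h3 (pow_nonneg h0 (2 ^ k))
  linarith

end Probability

/-! ### The threshold -/

theorem alphaStar_pos : 0 < alphaStar :=
  div_pos (Real.log_pos (by norm_num)) (Real.log_pos (by norm_num))

theorem alphaStar_gt : alphaStar > 0.12 := by
  -- Chosen since 3 / 25 = 0.12.
  have h : Real.log ((232 : ℝ) ^ 3) < Real.log ((2 : ℝ) ^ 25) :=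
    Real.log_lt_log (by norm_num) (by norm_num)
  rw [Real.log_pow, Real.log_pow] at h
  push_cast at h
  rw [alphaStar, gt_iff_lt, lt_div_iff₀ (Real.log_pos (by norm_num))]
  linarith

theorem rpow_alphaStar_le {n k : ℕ} (h : n < 116 ^ (k + 1)) :
    1 / 2 * (n : ℝ) ^ alphaStar ≤ (2 ^ k : ℕ) := by
  have h1 : (232 : ℝ) ^ alphaStar = 2 := by
    rw [alphaStar, Real.rpow_def_of_pos (by norm_num), mul_div_cancel₀ _
      (Real.log_pos (by norm_num)).ne', Real.exp_log (by norm_num)]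
  -- Replacing 116 by 232 is lossy, but `alphaStar` is defined so that `232 ^ alphaStar = 2`.
  have h2 : (n : ℝ) ≤ 232 ^ (k + 1) := by
    have : n ≤ 232 ^ (k + 1) := h.le.trans (Nat.pow_le_pow_left (by norm_num) _)
    exact_mod_cast this
  have h3 : (n : ℝ) ^ alphaStar ≤ 2 ^ (k + 1) := by
    calc (n : ℝ) ^ alphaStar ≤ ((232 : ℝ) ^ (k + 1)) ^ alphaStar :=
          Real.rpow_le_rpow (by positivity) h2 alphaStar_pos.le
      _ = ((232 : ℝ) ^ alphaStar) ^ (k + 1) := by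
          rw [← Real.rpow_natCast, ← Real.rpow_mul (by norm_num), mul_comm,
            Real.rpow_mul (by norm_num), Real.rpow_natCast]
      _ = 2 ^ (k + 1) := by rw [h1]
  push_cast
  rw [pow_succ] at h3
  linarith

theorem logicalErrorRate_le_exp (n : ℕ) [NeZero n] {ε : ℝ} (h0 : 0 < ε) (h1 : ε < epsTh) :
    logicalErrorRate n n ε ≤
      Real.exp (1 / 2 * (n : ℝ) ^ alphaStar * Real.log (ε / epsTh)) := by
  have e : ε / epsTh = 232 * ε := by rw [epsTh]; ring
  have hx : 232 * ε < 1 := by rw [epsTh] at h1; linarith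
  have hx0 : 0 < 232 * ε := by linarith
  have hk := Nat.pow_log_le_self 116 (NeZero.ne n)
  have hk' := Nat.lt_pow_succ_log_self (b := 116) (by norm_num) n
  generalize Nat.log 116 n = k at hk hk'
  have hp : 0 ≤ (232 * ε) ^ 2 ^ k := by positivity
  calc logicalErrorRate n n ε ≤ 1 / 2 * (232 * ε) ^ 2 ^ k :=
        logicalErrorRate_le n hk hk' h0.le (by linarith)
    _ ≤ (232 * ε) ^ 2 ^ k := by linarith
    _ = (232 * ε) ^ ((2 ^ k : ℕ) : ℝ) := (Real.rpow_natCast _ _).symm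
    _ ≤ (232 * ε) ^ (1 / 2 * (n : ℝ) ^ alphaStar) :=
        Real.rpow_le_rpow_of_exponent_ge hx0 hx.le (rpow_alphaStar_le hk')
    _ = _ := by rw [e, Real.rpow_def_of_pos hx0, mul_comm]

theorem logicalErrorRate_zero (n : ℕ) [NeZero n] : logicalErrorRate n n 0 ≤ 0 := by
  have hk := Nat.pow_log_le_self 116 (NeZero.ne n)
  have hk' := Nat.lt_pow_succ_log_self (b := 116) (by norm_num) n
  simpa using logicalErrorRate_le n hk hk' le_rfl zero_le_one

theorem logicalErrorRate_le_of_large {α ε : ℝ} (hα' : α < alphaStar) (h0 : 0 ≤ ε)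
    (h1 : ε < epsTh) : ∃ N : ℕ, ∀ (n : ℕ) [NeZero n], N ≤ n →
      logicalErrorRate n n ε ≤ Real.exp (-(n : ℝ) ^ α) := by
  rcases eq_or_lt_of_le h0 with rfl | h0
  · exact ⟨0, fun n _ _ => (logicalErrorRate_zero n).trans (Real.exp_pos _).le⟩
  have hl : 0 < -Real.log (ε / epsTh) := by
    have hp : 0 < epsTh := h0.trans h1
    have := Real.log_neg (div_pos h0 hp) ((div_lt_one hp).mpr h1)
    linarith
  generalize hc : -Real.log (ε / epsTh) = c at hl
  have ht := (tendsto_rpow_atTop (sub_pos.mpr hα')).comp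
    (tendsto_natCast_atTop_atTop (R := ℝ))
  -- The gap between the exponents makes `n ^ (alphaStar - α)` outgrow the constant `2 / c`, which
  -- undoes the prefactor `c / 2`.
  obtain ⟨N, hN⟩ := Filter.eventually_atTop.mp (ht.eventually_ge_atTop (2 / c))
  refine ⟨N, fun n _ hn => (logicalErrorRate_le_exp n h0 h1).trans (Real.exp_le_exp.mpr ?_)⟩
  have hn0 : (0 : ℝ) < n := Nat.cast_pos.mpr (Nat.pos_of_ne_zero (NeZero.ne n))
  have h2 : 2 / c ≤ (n : ℝ) ^ (alphaStar - α) := hN n hn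
  rw [div_le_iff₀ hl] at h2
  have h3 : (n : ℝ) ^ alphaStar = (n : ℝ) ^ (alphaStar - α) * (n : ℝ) ^ α := by
    rw [← Real.rpow_add hn0, sub_add_cancel]
  have h4 := mul_le_mul_of_nonneg_right h2 (Real.rpow_nonneg hn0.le α)
  rw [show Real.log (ε / epsTh) = -c by linarith, h3]
  linarith

theorem logicalErrorRate_le_of_small (n : ℕ) [NeZero n] {ε : ℝ} (h0 : 0 ≤ ε)
    (h1 : ε < Real.exp (-2) * epsTh) :
    logicalErrorRate n n ε ≤ Real.exp (-(n : ℝ) ^ alphaStar) := by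
  rcases eq_or_lt_of_le h0 with rfl | h0
  · exact (logicalErrorRate_zero n).trans (Real.exp_pos _).le
  have hp : 0 < epsTh := by rw [epsTh]; norm_num
  have h2 : ε < epsTh := h1.trans (mul_lt_of_lt_one_left hp (Real.exp_lt_one_iff.mpr (by norm_num)))
  refine (logicalErrorRate_le_exp n h0 h2).trans (Real.exp_le_exp.mpr ?_)
  -- The factor `exp (-2)` in the bound on `ε` is there to cancel the one half in the exponent.
  have h3 : Real.log (ε / epsTh) ≤ -2 := by
    rw [Real.log_le_iff_le_exp (div_pos h0 hp), div_le_iff₀ hp]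
    exact h1.le
  have h4 : (0 : ℝ) ≤ (n : ℝ) ^ alphaStar := by positivity
  nlinarith [mul_le_mul_of_nonneg_left h3 h4]

end SignalRule

theorem theorem1 :
    (SignalRule.epsTh > 0.004 ∧ SignalRule.alphaStar > 0.12) ∧
    ∃ τ : ℕ → ℕ,
      (fun n => (τ n : ℝ)) =O[Filter.atTop] (fun n => (n : ℝ)) ∧
      (∃ K : ℝ, ∀ (n : ℕ) [NeZero n] (ε : ℝ), 0 < ε → ε < SignalRule.epsTh →
        SignalRule.logicalErrorRate n (τ n) ε ≤
          K * Real.exp (1 / 2 * (n : ℝ) ^ SignalRule.alphaStar *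
            Real.log (ε / SignalRule.epsTh))) ∧
      (∀ α : ℝ, 0 < α → α < SignalRule.alphaStar →
        ∀ ε : ℝ, 0 ≤ ε → ε < SignalRule.epsTh →
          ∃ N : ℕ, ∀ (n : ℕ) [NeZero n], N ≤ n →
            SignalRule.logicalErrorRate n (τ n) ε ≤ Real.exp (-(n : ℝ) ^ α)) ∧
      (∃ ε₀ : ℝ, 0 < ε₀ ∧ ∃ α : ℝ, 0 < α ∧
        ∀ (n : ℕ) [NeZero n] (ε : ℝ), 0 ≤ ε → ε < ε₀ →
          SignalRule.logicalErrorRate n (τ n) ε ≤ Real.exp (-(n : ℝ) ^ α)) := by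
  -- Running for `n` steps suffices, because the relevant scale is below `n`.
  refine ⟨⟨by rw [SignalRule.epsTh]; norm_num, SignalRule.alphaStar_gt⟩, id,
    Asymptotics.isBigO_refl _ _, ⟨1, fun n _ ε h0 h1 => ?_⟩, fun α _ hα ε h0 h1 =>
      SignalRule.logicalErrorRate_le_of_large hα h0 h1,
    Real.exp (-2) * SignalRule.epsTh, ?_, SignalRule.alphaStar, SignalRule.alphaStar_pos,
    fun n _ ε h0 h1 => SignalRule.logicalErrorRate_le_of_small n h0 h1⟩
  · rw [one_mul]
    exact SignalRule.logicalErrorRate_le_exp n h0 h1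
  · exact mul_pos (Real.exp_pos _) (by rw [SignalRule.epsTh]; norm_num)
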